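/- **Types and morphisms.** Resource types are $a ::= \overline a\multimap o$ with $\overline a=(\vec a_1\cdots\vec a_n)$, $n\ge 0$ (we write $o$ for $()\multimap o$), where each intersection type $\vec a=\langle a_1,\dots,a_k\rangle$, $k\ge 0$, is a finite list of resource types. A morphism $\langle a_1,\dots,a_k\rangle\to\langle b_1,\dots,b_l\rangle$ is $\langle\alpha;f_1,\dots,f_l\rangle$ with $\alpha:\{1,\dots,l\}\to\{1,\dots,k\}$ any function and $f_j:a_{\alpha(j)}\to b_j$; a morphism $\overline f\multimap o:(\overline a\multimap o)\to(\overline b\multimap o)$ is given by a sequence $\overline f:\overline b\to\overline a$ of such morphisms (componentwise). With the evident identities and compositions this is the category $\mathcal{RT}$ of cartesian resource types. A *ground* morphism is one of the form $\langle\alpha;\mathrm{id},\dots,\mathrm{id}\rangle:\vec a\to\vec a^{[\alpha]}$; it is a *permutation* if $\alpha$ is bijective. A typing context $\gamma$ assigns an intersection type to every variable (the empty list to all but finitely many); $\mathsf{Ctx}$ is the category of contexts and families of morphisms, and $\otimes$ is variable-wise concatenation. **Terms.** Terms in $\eta$-long form, up to renaming of bound variables, are $s ::= x\,\overline q\mid\lambda(x_1^{f_1}\cdots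 x_n^{f_n}).s\mid(\lambda\overline x^{\overline f}.s)\,\overline q$ with $n\ge1$ and each $f_i$ a morphism of intersection types, where $\overline q=(\vec q_1\cdots\vec q_m)$ is a sequence of bags (finite lists of terms). Typing: $x:\langle\overline a\multimap o\rangle\otimes\gamma\vdash x\,\overline q:o$ if $\gamma\vdash\overline q:\overline a$; $\gamma\vdash\lambda\overline x^{\overline f}.s:\overline a\multimap o$ if $\gamma,\overline x:\overline b\vdash s:o$ and $\overline f:\overline a\to\overline b$; $\gamma\otimes\delta\vdash(\lambda\overline x^{\overline f}.s)\overline q:o$ if $\gamma\vdash\lambda\overline x^{\overline f}.s:\overline a\multimap o$ and $\delta\vdash\overline q:\overline a$; bags and sequences are typed componentwise, in the tensor product of the contexts. So the occurrences of a variable, from left to right, correspond to the entries of its intersection type. **Actions and substitution.** For $f:a\to b$ and $\gamma\vdash s:a$, the covariant action $\gamma^{[\mu]}\vdash[f]s:b$ is given by $[\overline f\multimap o](\lambda\overline x^{\overline g}.s)=\lambda\overline x^{\overline g\circ\overline f}.s$, and $[\mathrm{id}_o]s=s$; on bags $[\langle\alpha;f_1,\dots,f_l\rangle]\langle t_1,\dots,t_k\rangle=\langle[f_1]t_{\alpha(1)},\dots,[f_l]t_{\alpha(l)}\rangle$,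 and componentwise on sequences of bags; the ground morphism $\mu$ records the resulting duplication, erasure and permutation of variable occurrences. For $\theta:\delta\to\gamma$ and $\gamma\vdash s:a$, the contravariant action $\delta^{[\nu]}\vdash s\{\theta\}:a$, with a ground morphism $\nu:\delta\to\delta^{[\nu]}$, splits $\theta$ along the variable occurrences of $s$. At an occurrence $x\,\overline q$ whose component of $\theta$ is $\overline f\multimap o$, the arguments become $[\overline f](\overline q\{\theta'\})$, with $\theta'$ the remaining components; under binders $\theta$ is extended by identities, and the part of $\nu$ at the bound variables is postcomposed to their annotations. For $\gamma,\overline x:\overline a\vdash s:o$ and $\delta\vdash\overline t:\overline a$, the linear substitution $(\gamma\otimes\delta)^{[\sigma]}\vdash s\{\overline t/\overline x\}:o$ replaces the $i$-th occurrence of each $x_k$ with the $i$-th term of $\vec t_k$ (where $x_k\,\overline q$ becomes the application of that term to the substituted arguments); $\sigma$ is the induced permutation of variable occurrences, and its parts at bound variables are postcomposed to their annotations. **Reduction.** Structural reduction is a relation $(\gamma\vdash s:a)\to_{\theta;f}(\gamma'\vdash s':a')$ between typed terms, with labels $\theta:\gamma\to\gamma'$ in $\mathsf{Ctx}$ and $f:a'\to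 a$ in $\mathcal{RT}$. It is the union of exponential and linear reduction, the contextual closures of the following two ground steps, respectively. * Exponential: if $\gamma,\overline x:\overline a\vdash s:o$ and $\overline f:\overline b\to\overline a$ is not the identity, then $(\gamma\vdash\lambda\overline x^{\overline f}.s:\overline b\multimap o)\to_{\nu;\,\nu'\multimap o}(\gamma^{[\nu]}\vdash\lambda\overline x^{\mathrm{id}}.\,s\{\mathrm{id}_\gamma,\overline f\}:\overline b^{[\nu']}\multimap o)$, where $\nu,\nu'$ are the parts at $\gamma$ and at $\overline x$ of the ground morphism of the action. * Linear: if $\gamma,\overline x:\overline a\vdash s:o$, $\delta\vdash\overline t:\overline b$, and $\overline\tau:\overline b\to\overline a$ consists of permutations, then $(\gamma\otimes\delta\vdash(\lambda\overline x^{\overline\tau}.s)\overline t:o)\to_{\sigma\circ(\gamma\otimes\mu);\,\mathrm{id}_o}s\{[\overline\tau]\overline t/\overline x\}:o$, where $\mu$ is the ground morphism of the action $[\overline\tau]\overline t$ and $\sigma$ is the permutation of the substitution, and the new context is the codomain of $\sigma$. Contextual closure: * if $(\gamma,\overline x:\overline a\vdash s:o)\to_{\theta,\overline f;\,\mathrm{id}_o}(\gamma',\overline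 x:\overline a'\vdash s':o)$ and $\overline g:\overline b\to\overline a$, then $\lambda\overline x^{\overline g}.s\to_{\theta;\mathrm{id}}\lambda\overline x^{\overline f\circ\overline g}.s'$ (both of type $\overline b\multimap o$); * for $s,s'$ abstractions, if $(\gamma\vdash s:\overline a\multimap o)\to_{\theta;\overline f\multimap o}(\gamma'\vdash s':\overline a'\multimap o)$ and $\delta\vdash\overline t:\overline a$, then $s\,\overline t\to_{\theta\otimes\mu;\mathrm{id}_o}s'\,([\overline f]\overline t)$, where $\mu$ is the ground morphism of the action $[\overline f]\overline t$; * if $(\delta\vdash\overline t:\overline a)\to_{\theta;\overline f}(\delta'\vdash\overline t':\overline a')$, then $s\,\overline t\to_{\mathrm{id}\otimes\theta;\mathrm{id}_o}([\overline f\multimap o]s)\,\overline t'$ for every abstraction $\gamma\vdash s:\overline a\multimap o$, and $x\,\overline t\to_{\langle\overline f\multimap o\rangle\otimes\theta;\mathrm{id}_o}x\,\overline t'$ for every variable $x$ (where $\langle\overline f\multimap o\rangle$ is at $x$); * a step in one element of a bag, or in one bag of a sequence, is a step of the bag, or of the sequence; its labels are the tensor products, respectively the sequences, of the label of that step with identities.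 **Theorem.** Structural reduction is confluent as a labelled reduction system. Let $\to^*$ be its reflexive and transitive closure, where the label of a reduction sequence is the composite of the labels of its steps (an identity for the empty sequence). Whenever $s\to^*_{l_1}t_1$ and $s\to^*_{l_2}t_2$, there are a typed term $u$ and labels $h_1,h_2$ with $t_1\to^*_{h_1}u$, $t_2\to^*_{h_2}u$ and $h_1\cdot l_1=h_2\cdot l_2$, where $\cdot$ is composition of labels: $(\theta';f')\cdot(\theta;f)=(\theta'\circ\theta;\,f\circ f')$. -/

import Mathlib

open CategoryTheory

namespace ResourceCalculus

/-- Resource types. `Ty.arr [a₁, …, aₙ]` is `(a₁ ⋯ aₙ) ⊸ o`, where every `aᵢ` is an intersection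
type, that is, a finite list of resource types. -/
inductive Ty : Type
  | arr (args : List (List Ty)) : Ty

/-- The atomic type `o`, that is, `() ⊸ o`. -/
abbrev Ty.o : Ty := .arr []

instance : Inhabited Ty := ⟨.o⟩

/-- Expressions for morphisms of resource types. `Mor.arr [f₁, …, fₙ]` is `(f₁ ⋯ fₙ) ⊸ o`, where
`fₖ` is a morphism of intersection types. The latter is a pair `(a, es)` of its domain
`a = ⟨a₀, …⟩` and a list of entries `(α j, g j)`: it stands for `⟨α; g₀, g₁, …⟩`, with
`g j : a_{α j} ⟶ b j`. The typing `IsHom` below singles out the morphisms. -/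
inductive Mor : Type
  | arr (fs : List (List Ty × List (ℕ × Mor))) : Mor

instance : Inhabited Mor := ⟨.arr []⟩

/-- Expressions for morphisms of intersection types. -/
abbrev BMor : Type := List Ty × List (ℕ × Mor)

/-- The codomain of a morphism of resource types. -/
def Mor.cod : Mor → Ty
  | .arr fs => .arr (fs.map Prod.fst)
/-- The domain of a morphism of intersection types. -/
def BMor.src (f : BMor) : List Ty := f.1
/-- The codomain of a morphism of intersection types. -/
def BMor.tgt (f : BMor) : List Ty := f.2.map fun e => e.2.cod

/- Identities. -/
mutual
def Ty.id : Ty → Mor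
  | .arr as => .arr (idSeq as)
def idSeq : List (List Ty) → List BMor
  | [] => []
  | a :: as => (a, idEntries 0 a) :: idSeq as
def idEntries : ℕ → List Ty → List (ℕ × Mor)
  | _, [] => []
  | k, a :: as => (k, a.id) :: idEntries (k + 1) as
end

/-- The identity of an intersection type. -/
def idBag (a : List Ty) : BMor := (a, idEntries 0 a)

/-- The composite `g ∘ f`. It is `(f̄ ∘ ḡ) ⊸ o` for `g = ḡ ⊸ o` and `f = f̄ ⊸ o`
(see `Mor.comp_arr`). The last branch of the `match` does not occur for composable morphisms. -/
def Mor.comp : Mor → Mor → Mor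
  | .arr gs, .arr fs => .arr ((fs.zip gs).attach.map fun p =>
      (p.1.2.1, p.1.1.2.attach.map fun e =>
        match _h : p.1.2.2[e.1.1]? with
        | some d => (d.1, Mor.comp e.1.2 d.2)
        | none => (0, e.1.2)))
termination_by g f => sizeOf g + sizeOf f
decreasing_by
  obtain ⟨⟨⟨s1, es⟩, ⟨s2, ds⟩⟩, hp⟩ := p
  obtain ⟨⟨i, m⟩, he⟩ := e
  obtain ⟨k, n⟩ := d
  have h1 := List.sizeOf_lt_of_mem (List.of_mem_zip hp).1
  have h2 := List.sizeOf_lt_of_mem (List.of_mem_zip hp).2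
  have h3 := List.sizeOf_lt_of_mem he
  have h4 := List.sizeOf_lt_of_mem (List.mem_of_getElem? _h)
  simp at *
  omega

/-- The composite `g ∘ f = ⟨α ∘ β; gⱼ ∘ f_{β j}, …⟩` of `g = ⟨β; gⱼ, …⟩` and `f = ⟨α; fᵢ, …⟩`. -/
def BMor.comp (g f : BMor) : BMor :=
  (f.1, g.2.map fun e => match f.2[e.1]? with
    | some d => (d.1, Mor.comp e.2 d.2)
    | none => (0, e.2))

/-- Composition of sequences of morphisms of intersection types. -/
def seqComp (g f : List BMor) : List BMor := List.zipWith BMor.comp g f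

/-- The ground morphism `⟨α; id, …, id⟩ : a ⟶ a^[α]`. -/
def ground (α : List ℕ) (a : List Ty) : BMor := (a, α.map fun i => (i, (a.getD i .o).id))

/-- The composite of `f` followed by the ground morphism given by `α`. -/
def reindex (α : List ℕ) (f : BMor) : BMor := (f.1, α.map fun i => f.2.getD i default)

/-- The tensor product (concatenation) of morphisms of intersection types. -/
def BMor.tensor (f g : BMor) : BMor := (f.1 ++ g.1, f.2 ++ g.2.map fun e => (f.1.length + e.1, e.2))

/-- `f` is a permutation: a ground morphism given by a bijection. -/
def BMor.IsPerm (f : BMor) : Prop := ∃ α : List ℕ, α.Perm (List.range f.1.length) ∧ f = ground α f.1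

/- Typing of morphisms: `IsHom f a b` means `f : a ⟶ b`. -/
mutual
inductive Mor.IsHom : Mor → Ty → Ty → Prop
  | arr {fs a b} : SeqIsHom fs b a → Mor.IsHom (.arr fs) (.arr a) (.arr b)
inductive BMor.IsHom : BMor → List Ty → List Ty → Prop
  | mk {a es b} : EntriesIsHom a es b → BMor.IsHom (a, es) a b
inductive EntriesIsHom : List Ty → List (ℕ × Mor) → List Ty → Prop
  | nil {a} : EntriesIsHom a [] []
  | cons {a i m c d es b} : a[i]? = some c → Mor.IsHom m c d → EntriesIsHom a es b →
      EntriesIsHom a ((i, m) :: es) (d :: b)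
inductive SeqIsHom : List BMor → List (List Ty) → List (List Ty) → Prop
  | nil : SeqIsHom [] [] []
  | cons {f a b fs as bs} : BMor.IsHom f a b → SeqIsHom fs as bs →
      SeqIsHom (f :: fs) (a :: as) (b :: bs)
end

theorem Mor.comp_arr (gs fs : List BMor) :
    Mor.comp (.arr gs) (.arr fs) = .arr (seqComp fs gs) := by
  rw [Mor.comp, seqComp]
  congr 1
  rw [← List.map_uncurry_zip_eq_zipWith]
  conv_rhs => rw [← List.attach_map_subtype_val (fs.zip gs), List.map_map]
  refine List.map_congr_left ?_
  rintro ⟨⟨⟨s1, es⟩, ⟨s2, ds⟩⟩, _⟩ _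
  simp only [Function.uncurry, BMor.comp, Function.comp_apply]
  congr 1
  conv_rhs => rw [← List.attach_map_subtype_val es, List.map_map]
  refine List.map_congr_left ?_
  rintro ⟨⟨i, m⟩, _⟩ _
  dsimp only [Function.comp_apply]
  split <;> simp_all

theorem EntriesIsHom.get {a b : List Ty} {es : List (ℕ × Mor)} (h : EntriesIsHom a es b)
    {i : ℕ} {d : Ty} (hi : b[i]? = some d) :
    ∃ j m c, es[i]? = some (j, m) ∧ a[j]? = some c ∧ Mor.IsHom m c d := by
  induction b generalizing es i with
  | nil => simp at hi
  | cons d' b ih =>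
    cases h with
    | cons h1 h2 h3 =>
      cases i with
      | zero => simp at hi; subst hi; exact ⟨_, _, _, rfl, h1, h2⟩
      | succ i => simpa using ih h3 (by simpa using hi)

theorem isHom_comp_aux (n : ℕ) : ∀ {f g : Mor} {a b c : Ty}, sizeOf f + sizeOf g < n →
    f.IsHom a b → g.IsHom b c → (g.comp f).IsHom a c := by
  induction n with
  | zero => intro _ _ _ _ _ h; omega
  | succ n ih =>
    intro f g a b c hn hf hg
    cases hf with
    | @arr fs a b hf =>
    cases hg with
    | @arr gs b c hg =>
    rw [Mor.comp_arr]
    refine .arr ?_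
    simp only [Mor.arr.sizeOf_spec] at hn
    induction fs generalizing gs a b c with
    | nil => cases hf; cases hg; exact .nil
    | cons f fs ih' =>
      cases hf with
      | @cons _ b a _ bs as hf hfs =>
      cases hg with
      | @cons g c _ gs cs _ hg hgs =>
      refine .cons ?_ (by apply ih' <;> first | assumption | (simp at hn ⊢; omega))
      cases hg with
      | @mk _ ds _ hg =>
      cases hf with
      | @mk _ es _ hf =>
      refine .mk ?_
      simp only [List.cons.sizeOf_spec, Prod.mk.sizeOf_spec] at hn
      replace hn : sizeOf es + sizeOf ds < n := by omega
      clear * - ih hf hg hn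
      induction es generalizing a with
      | nil => cases hf; exact .nil
      | cons e es ih' =>
        cases hf with
        | @cons _ i m x d _ _ h1 h2 h3 =>
        obtain ⟨j, k, y, hd, hj, hk⟩ := hg.get h1
        rw [List.map_cons]
        simp only [hd]
        have := List.sizeOf_lt_of_mem (List.mem_of_getElem? hd)
        simp at this hn
        exact .cons hj (ih (by omega) hk h2) (by apply ih' <;> first | assumption | omega)

theorem Mor.IsHom.comp {f g : Mor} {a b c : Ty} (hf : f.IsHom a b) (hg : g.IsHom b c) :
    (g.comp f).IsHom a c := isHom_comp_aux _ (Nat.lt_succ_self _) hf hg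

theorem EntriesIsHom.comp {a b c ds es} (hf : EntriesIsHom a ds b) (hg : EntriesIsHom b es c) :
    BMor.IsHom (BMor.comp (b, es) (a, ds)) a c := by
  refine .mk ?_
  induction es generalizing c with
  | nil => cases hg; exact .nil
  | cons e es ih =>
    cases hg with
    | @cons _ i m x d _ _ h1 h2 h3 =>
    obtain ⟨j, k, y, hd, hj, hk⟩ := hf.get h1
    rw [List.map_cons]
    simp only [hd]
    exact .cons hj (hk.comp h2) (ih h3)

theorem BMor.IsHom.comp {f g : BMor} {a b c} (hf : f.IsHom a b) (hg : g.IsHom b c) :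
    (g.comp f).IsHom a c := by
  cases hf with
  | mk hf => cases hg with
    | mk hg => exact hf.comp hg

mutual
theorem Ty.id_isHom : ∀ a : Ty, a.id.IsHom a a
  | .arr as => by rw [Ty.id]; exact .arr (idSeq_isHom as)
theorem idSeq_isHom : ∀ as : List (List Ty), SeqIsHom (idSeq as) as as
  | [] => by rw [idSeq]; exact .nil
  | a :: as => by rw [idSeq]; exact .cons (.mk (idEntries_isHom a [])) (idSeq_isHom as)
theorem idEntries_isHom : ∀ b a : List Ty, EntriesIsHom (a ++ b) (idEntries a.length b) b
  | [], a => by rw [idEntries]; exact .nil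
  | c :: b, a => by
    rw [idEntries]
    have := idEntries_isHom b (a ++ [c])
    rw [List.append_assoc, List.length_append] at this
    exact .cons (by simp) c.id_isHom this
end

theorem idBag_isHom (a : List Ty) : (idBag a).IsHom a a := .mk (idEntries_isHom a [])

theorem idEntries_get : ∀ (b : List Ty) (k i : ℕ) (c : Ty), b[i]? = some c →
    (idEntries k b)[i]? = some (k + i, c.id)
  | [], _, _, _, h => by simp at h
  | d :: b, k, 0, c, h => by simp at h; subst h; simp [idEntries]
  | d :: b, k, i + 1, c, h => by
    rw [idEntries, List.getElem?_cons_succ, idEntries_get b (k + 1) i c (by simpa using h)]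
    simp only [Nat.add_assoc, Nat.add_comm 1]

theorem EntriesIsHom.idEntries_comp {a : List Ty} {es : List (ℕ × Mor)} {b : List Ty}
    (h : EntriesIsHom a es b)
    (hid : ∀ e ∈ es, ∀ c d, Mor.IsHom e.2 c d → d.id.comp e.2 = e.2) (l : List (ℕ × Mor)) :
    (idEntries l.length b).map (fun e => match (l ++ es)[e.1]? with
      | some d => (d.1, Mor.comp e.2 d.2)
      | none => (0, e.2)) = es := by
  induction b generalizing es l with
  | nil => cases h; rfl
  | cons d b ih =>
    cases h with
    | @cons _ i m c _ es _ h1 h2 h3 =>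
      rw [idEntries, List.map_cons]
      have := ih h3 (fun e he => hid e (List.mem_cons_of_mem _ he)) (l ++ [(i, m)])
      rw [List.append_assoc, List.length_append] at this
      congr 1
      simp [hid (i, m) List.mem_cons_self c d h2]

theorem EntriesIsHom.comp_idEntries {a : List Ty} {es : List (ℕ × Mor)} {b : List Ty}
    (h : EntriesIsHom a es b)
    (hid : ∀ e ∈ es, ∀ c d, Mor.IsHom e.2 c d → e.2.comp c.id = e.2) :
    es.map (fun e => match (idEntries 0 a)[e.1]? with
      | some d => (d.1, Mor.comp e.2 d.2)
      | none => (0, e.2)) = es := by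
  induction b generalizing es with
  | nil => cases h; rfl
  | cons d b ih =>
    cases h with
    | @cons _ i m c _ es _ h1 h2 h3 =>
      rw [List.map_cons]
      congr 1
      · simp [idEntries_get _ 0 _ _ h1, hid (i, m) List.mem_cons_self c d h2]
      · exact ih h3 fun e he => hid e (List.mem_cons_of_mem _ he)

theorem id_laws_aux (n : ℕ) : ∀ {f : Mor} {a b : Ty}, sizeOf f < n → f.IsHom a b →
    f.comp a.id = f ∧ b.id.comp f = f := by
  induction n with
  | zero => intro _ _ _ h; omega
  | succ n ih =>
    intro f a b hn hf
    cases hf with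
    | @arr fs a b hf =>
    simp only [Mor.arr.sizeOf_spec] at hn
    rw [Ty.id, Ty.id, Mor.comp_arr, Mor.comp_arr]
    suffices h : seqComp (idSeq a) fs = fs ∧ seqComp fs (idSeq b) = fs by rw [h.1, h.2]; simp
    induction fs generalizing a b with
    | nil => cases hf; simp [seqComp]
    | cons f fs ih' =>
      cases hf with
      | @cons _ b a _ bs as hf hfs =>
      simp only [List.cons.sizeOf_spec] at hn
      obtain ⟨h1, h2⟩ : seqComp (idSeq as) fs = fs ∧ seqComp fs (idSeq bs) = fs := by
        apply ih' <;> first | assumption | omega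
      rw [seqComp] at h1 h2
      simp only [seqComp, idSeq, List.zipWith_cons_cons, h1, h2]
      cases hf with
      | @mk _ es _ hf =>
      simp only [Prod.mk.sizeOf_spec] at hn
      have hm : ∀ e ∈ es, sizeOf e.2 < n := by
        intro e he
        have := List.sizeOf_lt_of_mem he
        obtain ⟨i, m⟩ := e
        simp at this ⊢
        omega
      have h3 := hf.idEntries_comp (fun e he c d h => (ih (hm e he) h).2) []
      have h4 := hf.comp_idEntries (fun e he c d h => (ih (hm e he) h).1)
      simp only [BMor.comp]
      constructor
      · congr 2
      · congr 2

theorem Mor.IsHom.comp_id {f : Mor} {a b : Ty} (h : f.IsHom a b) : f.comp a.id = f :=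
  (id_laws_aux _ (Nat.lt_succ_self _) h).1

theorem Mor.IsHom.id_comp {f : Mor} {a b : Ty} (h : f.IsHom a b) : b.id.comp f = f :=
  (id_laws_aux _ (Nat.lt_succ_self _) h).2

theorem BMor.IsHom.comp_id {f : BMor} {a b : List Ty} (h : f.IsHom a b) :
    f.comp (idBag a) = f := by
  cases h with
  | mk h =>
    have := h.comp_idEntries fun _ _ _ _ h => h.comp_id
    simp only [BMor.comp, idBag]
    congr 1

theorem BMor.IsHom.id_comp {f : BMor} {a b : List Ty} (h : f.IsHom a b) :
    (idBag b).comp f = f := by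
  cases h with
  | mk h =>
    have := h.idEntries_comp (fun _ _ _ _ h => h.id_comp) []
    simp only [BMor.comp, idBag]
    congr 1

theorem BMor.IsHom.assoc_of {f g h : BMor} {a b c d : List Ty}
    (hf : f.IsHom a b) (hg : g.IsHom b c) (hh : h.IsHom c d)
    (H : ∀ p ∈ f.2, ∀ q ∈ g.2, ∀ r ∈ h.2, ∀ w x y z, Mor.IsHom p.2 w x → Mor.IsHom q.2 x y →
      Mor.IsHom r.2 y z → (r.2.comp q.2).comp p.2 = r.2.comp (q.2.comp p.2)) :
    (h.comp g).comp f = h.comp (g.comp f) := by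
  cases hf with
  | @mk _ fs _ hf =>
  cases hg with
  | @mk _ gs _ hg =>
  cases hh with
  | @mk _ hs _ hh =>
  simp only [BMor.comp, List.map_map]
  congr 1
  induction hs generalizing d with
  | nil => rfl
  | cons e es ih =>
    cases hh with
    | @cons _ i m x d _ d' h1 h2 h3 =>
    rw [List.map_cons, List.map_cons]
    congr 1
    · obtain ⟨j, k, y, hd, hj, hk⟩ := hg.get h1
      obtain ⟨j', k', y', hd', hj', hk'⟩ := hf.get hj
      simpa [hd, hd'] using H (j', k') (List.mem_of_getElem? hd') (j, k) (List.mem_of_getElem? hd)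
        (i, m) List.mem_cons_self _ _ _ _ hk' hk h2
    · exact ih (fun p hp q hq r hr => H p hp q hq r (List.mem_cons_of_mem _ hr)) h3

theorem assoc_aux (n : ℕ) : ∀ {f g h : Mor} {a b c d : Ty},
    sizeOf f + sizeOf g + sizeOf h < n → f.IsHom a b → g.IsHom b c → h.IsHom c d →
    (h.comp g).comp f = h.comp (g.comp f) := by
  induction n with
  | zero => intro _ _ _ _ _ _ _ h; omega
  | succ n ih =>
    intro f g h a b c d hn hf hg hh
    cases hf with
    | @arr fs a b hf =>
    cases hg with
    | @arr gs _ c hg =>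
    cases hh with
    | @arr hs _ d hh =>
    simp only [Mor.comp_arr]
    simp only [Mor.arr.sizeOf_spec] at hn
    congr 1
    replace hn : sizeOf fs + sizeOf gs + sizeOf hs < n := by omega
    induction fs generalizing gs hs a b c d with
    | nil => simp [seqComp]
    | cons f fs ih' =>
      cases hf with
      | @cons _ b a _ bs as hf hfs =>
      cases hg with
      | @cons g c _ gs cs _ hg hgs =>
      cases hh with
      | @cons h d _ hs ds _ hh hhs =>
      have hi : seqComp fs (seqComp gs hs) = seqComp (seqComp fs gs) hs := by
        apply ih' <;> first | assumption | (simp at hn; omega)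
      simp only [seqComp, List.zipWith_cons_cons] at hi ⊢
      congr 1
      refine (BMor.IsHom.assoc_of hh hg hf ?_).symm
      intro p hp q hq r hr w x y z h1 h2 h3
      refine ih ?_ h1 h2 h3
      have s1 := List.sizeOf_lt_of_mem hp
      have s2 := List.sizeOf_lt_of_mem hq
      have s3 := List.sizeOf_lt_of_mem hr
      obtain ⟨_, _⟩ := p
      obtain ⟨_, _⟩ := q
      obtain ⟨_, _⟩ := r
      obtain ⟨_, _⟩ := f
      obtain ⟨_, _⟩ := g
      obtain ⟨_, _⟩ := h
      simp at hn s1 s2 s3 ⊢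
      omega

theorem Mor.IsHom.assoc {f g h : Mor} {a b c d : Ty} (hf : f.IsHom a b) (hg : g.IsHom b c)
    (hh : h.IsHom c d) : (h.comp g).comp f = h.comp (g.comp f) :=
  assoc_aux _ (Nat.lt_succ_self _) hf hg hh

theorem BMor.IsHom.assoc {f g h : BMor} {a b c d : List Ty} (hf : f.IsHom a b)
    (hg : g.IsHom b c) (hh : h.IsHom c d) : (h.comp g).comp f = h.comp (g.comp f) :=
  hf.assoc_of hg hh fun _ _ _ _ _ _ _ _ _ _ h1 h2 h3 => h1.assoc h2 h3

/-- Structural resource terms in η-long form, with de Bruijn indices. `lam [f₁, …, fₘ] s` is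
`λ(x₁^f₁ ⋯ xₘ^fₘ). s`; in its body the index `k < m` is the variable with annotation `f` number `k`
(counting from zero), and the index `m + x` is the free variable `x`. A sequence of arguments is a
list of bags, and a bag is a list of terms. `var x q` is `x q` and `redex f s q` is
`(λ x̄^f. s) q`. -/
inductive Tm : Type
  | var (x : ℕ) (q : List (List Tm)) : Tm
  | lam (f : List BMor) (s : Tm) : Tm
  | redex (f : List BMor) (s : Tm) (q : List (List Tm)) : Tm

instance : Inhabited Tm := ⟨.var 0 []⟩

/- The number of occurrences of the variable `x`. -/
mutual
def occ (x : ℕ) : Tm → ℕ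
  | .var y q => (if x = y then 1 else 0) + occSeq x q
  | .lam f s => occ (x + f.length) s
  | .redex f s q => occ (x + f.length) s + occSeq x q
def occBag (x : ℕ) : List Tm → ℕ
  | [] => 0
  | t :: ts => occ x t + occBag x ts
def occSeq (x : ℕ) : List (List Tm) → ℕ
  | [] => 0
  | q :: qs => occBag x q + occSeq x qs
end

/- Adding `d` to the free variables that are `≥ c`. -/
mutual
def lift (c d : ℕ) : Tm → Tm
  | .var y q => .var (if y < c then y else y + d) (liftSeq c d q)
  | .lam f s => .lam f (lift (c + f.length) d s)
  | .redex f s q => .redex f (lift (c + f.length) d s) (liftSeq c d q)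
def liftBag (c d : ℕ) : List Tm → List Tm
  | [] => []
  | t :: ts => lift c d t :: liftBag c d ts
def liftSeq (c d : ℕ) : List (List Tm) → List (List Tm)
  | [] => []
  | q :: qs => liftBag c d q :: liftSeq c d qs
end

/-- The extension of `g` by values for the `l.length` bound variables. -/
def ext {A : Type} (l : List A) (g : ℕ → A) : ℕ → A :=
  fun x => (l[x]?).getD (g (x - l.length))

/-- The covariant action `[f]t` of a type morphism on a term. It acts on abstractions by
precomposition of the annotation; the terms of type `o` admit the identity only. -/
def coact : Mor → Tm → Tm
  | .arr g, .lam f s => .lam (seqComp f g) s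
  | _, t => t

/-- The covariant action of `⟨α; f₁, …, fₗ⟩` on a bag: `⟨[f₁]t_{α 1}, …, [fₗ]t_{α l}⟩`. -/
def coactBag (f : BMor) (q : List Tm) : List Tm := f.2.map fun e => coact e.2 (q.getD e.1 default)
/-- The covariant action on a sequence of bags. -/
def coactSeq (f : List BMor) (q : List (List Tm)) : List (List Tm) := List.zipWith coactBag f q

/-- The occurrences of `x` in a bag, numbered from `k` on, and grouped by the terms of the bag.
In a typed term the occurrences of `x`, from left to right, correspond to the entries of the
intersection type of `x` in the context. -/
def blocks (x : ℕ) : ℕ → List Tm → List (List ℕ)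
  | _, [] => []
  | k, t :: ts => List.range' k (occ x t) :: blocks x (k + occ x t) ts

/-- The ground morphism `μ` of the covariant action of `f` on `q`, at the variable `x`: the list of
the occurrences of `x` in `q` (numbered from `k` on) to which those in `[f]q` correspond. -/
def muSeq (x : ℕ) : ℕ → List BMor → List (List Tm) → List ℕ
  | k, f :: fs, q :: qs =>
      (f.2.flatMap fun e => (blocks x k q).getD e.1 []) ++ muSeq x (k + occBag x q) fs qs
  | _, _, _ => []

/-- Postcomposition of the `k`-th annotation with the ground morphism given by `ν k`. -/
def reindexSeq (ν : ℕ → List ℕ) (f : List BMor) : List BMor := f.mapIdx fun k g => reindex (ν k) g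

/- The contravariant action of a context morphism `θ`, given by the lists of entries of its
components. The result is the pair of the term `s{θ}` and of the ground morphism `ν`, which is
given, for every variable, by a list of positions in the domain of `θ`. The morphism `θ` is split
along the occurrences of the variables. At a variable occurrence `x q` whose entry in `θ` is
`f ⊸ o`, the arguments become `[f](q{θ'})`, with the ground morphism `μ ∘ ν'` in the context of
the arguments. Under binders `θ` is extended by identities, and the ground morphism at the bound
variables is composed with their annotations. -/
mutual
def act : Tm → (ℕ → List (ℕ × Mor)) → Tm × (ℕ → List ℕ)
  | .var x q, θ =>
    match θ x with
    | (i, .arr f) :: r =>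
      let p := actSeq q (Function.update θ x r)
      (.var x (coactSeq f p.1), fun y =>
        (if y = x then [i] else []) ++ (muSeq y 0 f p.1).map fun j => (p.2 y).getD j 0)
    | [] => (.var x q, fun _ => [])
  | .lam f s, θ =>
    let p := act s (ext (f.map fun g => idEntries 0 g.tgt) θ)
    (.lam (reindexSeq p.2 f) p.1, fun x => p.2 (x + f.length))
  | .redex f s q, θ =>
    let p := act s (ext (f.map fun g => idEntries 0 g.tgt) fun x => (θ x).take (occ (x + f.length) s))
    let r := actSeq q fun x => (θ x).drop (occ (x + f.length) s)
    (.redex (reindexSeq p.2 f) p.1 r.1, fun x => p.2 (x + f.length) ++ r.2 x)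
def actBag : List Tm → (ℕ → List (ℕ × Mor)) → List Tm × (ℕ → List ℕ)
  | [], _ => ([], fun _ => [])
  | t :: ts, θ =>
    let p := act t fun x => (θ x).take (occ x t)
    let r := actBag ts fun x => (θ x).drop (occ x t)
    (p.1 :: r.1, fun x => p.2 x ++ r.2 x)
def actSeq : List (List Tm) → (ℕ → List (ℕ × Mor)) → List (List Tm) × (ℕ → List ℕ)
  | [], _ => ([], fun _ => [])
  | q :: qs, θ =>
    let p := actBag q fun x => (θ x).take (occBag x q)
    let r := actSeq qs fun x => (θ x).drop (occBag x q)
    (p.1 :: r.1, fun x => p.2 x ++ r.2 x)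
end

/-- What a variable occurrence is replaced with by a substitution: either the variable `y`, standing
for position `i` of the type of `y` in the new context, or the term `t`, where the occurrences of
any `y` in `t` stand for the positions `τ y` of the type of `y` in the new context. -/
inductive Arg : Type
  | keep (y i : ℕ) : Arg
  | put (t : Tm) (τ : ℕ → List ℕ) : Arg

/-- Moving under `m` binders. -/
def Arg.lift (m : ℕ) : Arg → Arg
  | .keep y i => .keep (y + m) i
  | .put t τ => .put (ResourceCalculus.lift 0 m t) fun y => if y < m then [] else τ (y - m)

/-- The application of a term of arrow type to a sequence of arguments. The term is a λ-abstraction,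
except that a term `t` of type `o` takes the empty sequence, with result `t`. -/
def Tm.app : Tm → List (List Tm) → Tm
  | .lam f s, q => .redex f s q
  | t, _ => t

/-- The bound variables are not substituted under their binder. -/
def keepBound (m : ℕ) (s : Tm) : List (List Arg) :=
  (List.range m).map fun k => (List.range (occ k s)).map fun i => .keep k i

/-- A substitution under `m` binders. -/
def underBinder (m : ℕ) (s : Tm) (e : ℕ → List Arg) : ℕ → List Arg :=
  ext (keepBound m s) fun x => (e x).map (Arg.lift m)

/- Simultaneous linear substitution: the `i`-th occurrence (from left to right) of the variable
`x` is replaced with the `i`-th entry of `e x`. The result is the pair of the substituted term and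
of the list, for every variable `z`, of the positions of the type of `z` to which the occurrences
of `z` in the result correspond, from left to right. Under binders the permutation of the
occurrences of the bound variables is composed with their annotations. -/
mutual
def subst : Tm → (ℕ → List Arg) → Tm × (ℕ → List ℕ)
  | .var x q, e =>
    match e x with
    | a :: r =>
      let p := substSeq q (Function.update e x r)
      match a with
      | .keep y i => (.var y p.1, fun z => (if z = y then [i] else []) ++ p.2 z)
      | .put t τ => (t.app p.1, fun z => τ z ++ p.2 z)
    | [] => (.var x q, fun _ => [])
  | .lam f s, e =>
    let p := subst s (underBinder f.length s e)
    (.lam (reindexSeq p.2 f) p.1, fun x => p.2 (x + f.length))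
  | .redex f s q, e =>
    let p := subst s (underBinder f.length s fun x => (e x).take (occ (x + f.length) s))
    let r := substSeq q fun x => (e x).drop (occ (x + f.length) s)
    (.redex (reindexSeq p.2 f) p.1 r.1, fun x => p.2 (x + f.length) ++ r.2 x)
def substBag : List Tm → (ℕ → List Arg) → List Tm × (ℕ → List ℕ)
  | [], _ => ([], fun _ => [])
  | t :: ts, e =>
    let p := subst t fun x => (e x).take (occ x t)
    let r := substBag ts fun x => (e x).drop (occ x t)
    (p.1 :: r.1, fun x => p.2 x ++ r.2 x)
def substSeq : List (List Tm) → (ℕ → List Arg) → List (List Tm) × (ℕ → List ℕ)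
  | [], _ => ([], fun _ => [])
  | q :: qs, e =>
    let p := substBag q fun x => (e x).take (occBag x q)
    let r := substSeq qs fun x => (e x).drop (occBag x q)
    (p.1 :: r.1, fun x => p.2 x ++ r.2 x)
end

/-- The terms of a bag as substitutes, where `k y` occurrences of `y` precede the bag. -/
def tagBag (k : ℕ → ℕ) : List Tm → List Arg
  | [] => []
  | t :: ts => .put t (fun x => List.range' (k x) (occ x t)) :: tagBag (fun x => k x + occ x t) ts
/-- The terms of a sequence of bags as substitutes, where `k y` occurrences of `y` precede it. -/
def tagSeq (k : ℕ → ℕ) : List (List Tm) → List (List Arg)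
  | [] => []
  | q :: qs => tagBag k q :: tagSeq (fun x => k x + occBag x q) qs

/-- The linear substitution `s{q/x̄}` of the bags `q` for the variables `0, …, q.length - 1` of `s`,
together with the permutation `σ`, from `γ ⊗ δ` to the context of the result, where `γ` is the
context of the free variables of `s`, and `δ` is that of `q`. -/
def linSubst (s : Tm) (q : List (List Tm)) : Tm × (ℕ → List ℕ) :=
  subst s (ext (tagSeq (fun x => occ (x + q.length) s) q) fun x =>
    (List.range (occ (x + q.length) s)).map fun i => .keep x i)

/-- The category of (cartesian) resource types. -/
instance : Category Ty where
  Hom a b := { f : Mor // f.IsHom a b }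
  id a := ⟨a.id, a.id_isHom⟩
  comp f g := ⟨g.1.comp f.1, f.2.comp g.2⟩
  id_comp f := Subtype.ext f.2.comp_id
  comp_id f := Subtype.ext f.2.id_comp
  assoc f g h := Subtype.ext (f.2.assoc g.2 h.2).symm

/-- Typing contexts: every variable is assigned an intersection type. All but finitely many of
these are the empty list in the context of a typed term. -/
def Ctx : Type := ℕ → List Ty

/-- Expressions for context morphisms. -/
abbrev CtxMor : Type := ℕ → BMor

/-- The category of typing contexts: a morphism is a family of morphisms of intersection types. -/
instance : Category Ctx where
  Hom γ δ := { θ : CtxMor // ∀ x, (θ x).IsHom (γ x) (δ x) }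
  id γ := ⟨fun x => idBag (γ x), fun x => idBag_isHom (γ x)⟩
  comp f g := ⟨fun x => (g.1 x).comp (f.1 x), fun x => (f.2 x).comp (g.2 x)⟩
  id_comp f := Subtype.ext (funext fun x => (f.2 x).comp_id)
  comp_id f := Subtype.ext (funext fun x => (f.2 x).id_comp)
  assoc f g h := Subtype.ext (funext fun x => ((f.2 x).assoc (g.2 x) (h.2 x)).symm)

/-- The context with empty intersection types. -/
def Ctx.empty : Ctx := fun _ => []

/-- The context `x : ⟨a⟩`. -/
def Ctx.single (x : ℕ) (a : Ty) : Ctx := fun y => if y = x then [a] else []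

/-- The tensor product of contexts. -/
def Ctx.tensor (γ δ : Ctx) : Ctx := fun x => γ x ++ δ x

/-- The context `γ, x̄ : a`. -/
def Ctx.cons (a : List (List Ty)) (γ : Ctx) : Ctx := ext a γ

/-- The identity of a context. -/
def CtxMor.id (γ : Ctx) : CtxMor := fun x => idBag (γ x)

/-- The morphism of contexts of the form `x : ⟨a⟩` that is given by a type morphism `f` with
domain `a`. -/
def CtxMor.single (x : ℕ) (a : Ty) (f : Mor) : CtxMor :=
  fun y => if y = x then ([a], [(0, f)]) else ([], [])

/-- The tensor product of context morphisms. -/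
def CtxMor.tensor (θ η : CtxMor) : CtxMor := fun x => (θ x).tensor (η x)

/-- The ground morphism `γ ⟶ γ^[α]`. -/
def CtxMor.ground (α : ℕ → List ℕ) (γ : Ctx) : CtxMor := fun x => ResourceCalculus.ground (α x) (γ x)

/-- The codomain of a context morphism. -/
def CtxMor.tgt (θ : CtxMor) : Ctx := fun x => (θ x).tgt

/-- The ground context morphism `μ : δ ⟶ δ^[μ]` of the covariant action of `f` on the sequence `q`
with context `δ`. -/
def CtxMor.mu (f : List BMor) (q : List (List Tm)) (δ : Ctx) : CtxMor :=
  .ground (fun x => muSeq x 0 f q) δ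

/- Typing of terms, of bags and of sequences of bags. -/
mutual
inductive HasType : Ctx → Tm → Ty → Prop
  | var {x a γ q} : SeqHasType γ q a →
      HasType ((Ctx.single x (.arr a)).tensor γ) (.var x q) .o
  | lam {f a b γ s} : f ≠ [] → SeqIsHom f a b → HasType (.cons b γ) s .o →
      HasType γ (.lam f s) (.arr a)
  | redex {f s a γ δ q} : HasType γ (.lam f s) (.arr a) → SeqHasType δ q a →
      HasType (γ.tensor δ) (.redex f s q) .o
inductive BagHasType : Ctx → List Tm → List Ty → Prop
  | nil : BagHasType .empty [] []
  | cons {γ t a δ ts as} : HasType γ t a → BagHasType δ ts as →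
      BagHasType (γ.tensor δ) (t :: ts) (a :: as)
inductive SeqHasType : Ctx → List (List Tm) → List (List Ty) → Prop
  | nil : SeqHasType .empty [] []
  | cons {γ q a δ qs as} : BagHasType γ q a → SeqHasType δ qs as →
      SeqHasType (γ.tensor δ) (q :: qs) (a :: as)
end

/-- The type of relations `(γ ⊢ s : a) →_{θ; f} (γ' ⊢ s' : a')`, with `θ : γ ⟶ γ'` and
`f : a' ⟶ a`. -/
abbrev LabelledRel : Type := Ctx → Tm → Ty → CtxMor → Mor → Ctx → Tm → Ty → Prop

/-- The ground step of exponential reduction. Here `p.1` is the body acted upon by `f` at the bound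
variables, and `p.2` is the ground morphism of this action; `θ` and `ν` are its parts at the free
and at the bound variables. -/
inductive ExpGround : LabelledRel
  | mk {γ : Ctx} {a b : List (List Ty)} {f : List BMor} {s : Tm} {p : Tm × (ℕ → List ℕ)}
      {θ : CtxMor} {ν : List BMor} :
      HasType (.cons a γ) s .o → SeqIsHom f b a → f ≠ idSeq b →
      p = act s (ext (f.map Prod.snd) fun x => idEntries 0 (γ x)) →
      θ = CtxMor.ground (fun x => p.2 (x + f.length)) γ →
      ν = b.mapIdx (fun k c => ground (p.2 k) c) →
      ExpGround γ (.lam f s) (.arr b) θ (.arr ν)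
        θ.tgt (.lam (ν.map fun g => idBag g.tgt) p.1) (.arr (ν.map BMor.tgt))

/-- The ground step of linear reduction. The label is the composite of `γ ⊗ μ` for the action of
the permutations `f` on the arguments, and of the permutation of the linear substitution. -/
inductive LinGround : LabelledRel
  | mk {γ δ : Ctx} {a b : List (List Ty)} {f : List BMor} {s : Tm} {q : List (List Tm)}
      {μ σ : CtxMor} {p : Tm × (ℕ → List ℕ)} :
      HasType (.cons a γ) s .o → f ≠ [] → SeqIsHom f b a → (∀ g ∈ f, g.IsPerm) →
      SeqHasType δ q b →
      μ = CtxMor.mu f q δ → p = linSubst s (coactSeq f q) → σ = CtxMor.ground p.2 (γ.tensor μ.tgt) →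
      LinGround (γ.tensor δ) (.redex f s q) .o
        (fun x => (σ x).comp ((CtxMor.id γ).tensor μ x)) (.arr []) σ.tgt p.1 .o

/- The contextual closure of a relation, on terms, bags and sequences of bags. -/
mutual
inductive Closure (R : LabelledRel) : LabelledRel
  | ground {γ s a θ f γ' s' a'} : R γ s a θ f γ' s' a' → Closure R γ s a θ f γ' s' a'
  | lam {γ γ' : Ctx} {a b : List (List Ty)} {g : List BMor} {s s' : Tm} {θ : CtxMor} :
      g ≠ [] → SeqIsHom g b a → Closure R (.cons a γ) s .o θ (.arr []) γ' s' .o →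
      Closure R γ (.lam g s) (.arr b) (fun x => θ (x + g.length)) (Ty.id (.arr b))
        (fun x => γ' (x + g.length)) (.lam (g.mapIdx fun k h => (θ k).comp h) s') (.arr b)
  | fn {γ γ' δ : Ctx} {f f' h s s' a a' θ q} :
      Closure R γ (.lam f s) (.arr a) θ (.arr h) γ' (.lam f' s') (.arr a') → SeqHasType δ q a →
      Closure R (γ.tensor δ) (.redex f s q) .o (θ.tensor (.mu h q δ)) (.arr [])
        (γ'.tensor (CtxMor.mu h q δ).tgt) (.redex f' s' (coactSeq h q)) .o
  | arg {γ δ δ' : Ctx} {f h s a a' θ q q'} :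
      HasType γ (.lam f s) (.arr a) → SeqClosure R δ q a θ h δ' q' a' →
      Closure R (γ.tensor δ) (.redex f s q) .o ((CtxMor.id γ).tensor θ) (.arr [])
        (γ.tensor δ') (.redex (seqComp f h) s q') .o
  | varArg {γ γ' : Ctx} {x h a a' θ q q'} :
      SeqClosure R γ q a θ h γ' q' a' →
      Closure R ((Ctx.single x (.arr a)).tensor γ) (.var x q) .o
        ((CtxMor.single x (.arr a) (.arr h)).tensor θ) (.arr [])
        ((Ctx.single x (.arr a')).tensor γ') (.var x q') .o
inductive BagClosure (R : LabelledRel) :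
    Ctx → List Tm → List Ty → CtxMor → BMor → Ctx → List Tm → List Ty → Prop
  | head {γ γ' δ : Ctx} {t t' a a' θ f ts b} :
      Closure R γ t a θ f γ' t' a' → BagHasType δ ts b →
      BagClosure R (γ.tensor δ) (t :: ts) (a :: b) (θ.tensor (.id δ))
        (BMor.tensor ([a'], [(0, f)]) (idBag b)) (γ'.tensor δ) (t' :: ts) (a' :: b)
  | tail {γ γ' δ : Ctx} {t a b b' θ f ts ts'} :
      HasType δ t a → BagClosure R γ ts b θ f γ' ts' b' →
      BagClosure R (δ.tensor γ) (t :: ts) (a :: b) ((CtxMor.id δ).tensor θ)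
        (BMor.tensor (idBag [a]) f) (δ.tensor γ') (t :: ts') (a :: b')
inductive SeqClosure (R : LabelledRel) :
    Ctx → List (List Tm) → List (List Ty) → CtxMor → List BMor →
      Ctx → List (List Tm) → List (List Ty) → Prop
  | head {γ γ' δ : Ctx} {q q' a a' θ f qs b} :
      BagClosure R γ q a θ f γ' q' a' → SeqHasType δ qs b →
      SeqClosure R (γ.tensor δ) (q :: qs) (a :: b) (θ.tensor (.id δ))
        (f :: idSeq b) (γ'.tensor δ) (q' :: qs) (a' :: b)
  | tail {γ γ' δ : Ctx} {q a b b' θ f qs qs'} :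
      BagHasType δ q a → SeqClosure R γ qs b θ f γ' qs' b' →
      SeqClosure R (δ.tensor γ) (q :: qs) (a :: b) ((CtxMor.id δ).tensor θ)
        (idBag a :: f) (δ.tensor γ') (q :: qs') (a :: b')
end

/-- Exponential reduction. -/
def Exponential : LabelledRel := Closure ExpGround

/-- Linear reduction. -/
def Linear : LabelledRel := Closure LinGround

/-- Structural reduction. -/
def Structural : LabelledRel := fun γ s a θ f γ' s' a' =>
  Exponential γ s a θ f γ' s' a' ∨ Linear γ s a θ f γ' s' a'

/-- Labelled reduction systems whose labels are the morphisms of a category `C`, with composition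
as the partial multiplication. Every term is assigned an object, and a step from `s` to `t` is
labelled with a morphism from the object of `s` to that of `t`. -/
structure LabelledReductionSystem (C : Type*) [Category C] where
  Carrier : Type
  obj : Carrier → C
  Step : ∀ s t : Carrier, (obj s ⟶ obj t) → Prop

namespace LabelledReductionSystem

variable {C : Type*} [Category C] (R : LabelledReductionSystem C)

/-- The reflexive and transitive extension: the label of a sequence of steps is the composite of
the labels of the steps. -/
inductive Star : ∀ s t : R.Carrier, (R.obj s ⟶ R.obj t) → Prop
  | refl (s : R.Carrier) : Star s s (𝟙 (R.obj s))
  | head {s t v : R.Carrier} {h : R.obj s ⟶ R.obj t} {l : R.obj t ⟶ R.obj v} :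
      R.Step s t h → Star t v l → Star s v (h ≫ l)

/-- Labelled confluence. -/
def Confluent : Prop :=
  ∀ (s t₁ t₂ : R.Carrier) (l₁ : R.obj s ⟶ R.obj t₁) (l₂ : R.obj s ⟶ R.obj t₂),
    R.Star s t₁ l₁ → R.Star s t₂ l₂ →
      ∃ (u : R.Carrier) (h₁ : R.obj t₁ ⟶ R.obj u) (h₂ : R.obj t₂ ⟶ R.obj u),
        R.Star t₁ u h₁ ∧ R.Star t₂ u h₂ ∧ l₁ ≫ h₁ = l₂ ≫ h₂

end LabelledReductionSystem

/-- Typed terms `γ ⊢ s : a`. -/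
structure TypedTm where
  ctx : Ctx
  term : Tm
  ty : Ty
  typed : HasType ctx term ty

/-- Structural reduction on typed terms as a labelled reduction system. A label is a pair
`(θ; f)` of a context morphism `θ : γ ⟶ γ'` and of a type morphism `f : a' ⟶ a`. -/
def structuralReduction : LabelledReductionSystem (Ctx × Tyᵒᵖ) where
  Carrier := TypedTm
  obj s := (s.ctx, Opposite.op s.ty)
  Step s t l := Structural s.ctx s.term s.ty l.1.1 l.2.unop.1 t.ctx t.term t.ty

end ResourceCalculus

/-!
Structural reduction is confluent because it preserves a denotation, because every typed term has a
redex-free reduct, and because redex-free terms with the same denotation have a common reduct.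

*Denotation.* The types are interpreted in the full type hierarchy over a set of observations: a
value of type `a ⊸ o` is any function from values of the arguments `a` to observations. Type
morphisms act on values (`coactV`), context morphisms on environments (`CtxMor.actEnv`). The
denotation `sem` of a term takes one value for each occurrence of a variable, and every step with
label `(θ; f)` from `s` to `s'` satisfies `sem s ρ = f · sem s' (θ · ρ)`; see `StepOK` and
`Closure.stepOK`. This is proved from the corresponding equations for the contravariant action
(`act_ok`) and for linear substitution (`subst_ok`). Hence all reducts of a term have the same
denotation once the labels of the reduction sequences are taken into account.

*Redex-free reducts* (`Reach.redexFree`). A redex is fired by an exponential step that makes its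
annotation the identity, followed by a linear one. The redexes that arise have an argument of the
fired one as their abstraction, whose type is smaller. Firing all redexes from the inside to the
outside therefore lowers the maximal depth of their types. Structural reduction need not terminate
on redex-free terms, nor are these in normal form: exponential steps remain possible.

*Joining redex-free terms* (`joinHyp`). Observations are trees, and values are turned into trees by
applying them to fresh variables (`reify`, `reflect`, as in normalisation by evaluation). If two
redex-free terms, each with a morphism from a common context and to a common type, have the same
tree, then by induction they have the same shape, and their variable occurrences arise from the same
entries of the common context. They still differ in the annotations of abstractions and in the
labels. Both are reduced to have identity annotations only: such a reduction absorbs the label of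
the body into the annotation and then into the label of the abstraction, which is determined by the
composite with the given morphisms (`LStar.exp_comp`). So the induction produces a common reduct
with equal composite labels.
-/

namespace ResourceCalculus

/-! ### Values -/

/-- Normal forms in which variables are named by de Bruijn levels: `var n i q` is the application to
`q` of the variable `n`, at its occurrence for the entry `i` of its intersection type. -/
inductive Tree : Type
  | var (n : ℤ) (i : ℕ) (q : List (List Tree)) : Tree
  | lam (b : List (List Ty)) (t : Tree) : Tree

/-- Observations: trees that depend on the number of the variables in scope, hence on the names that
are fresh. They are the values of type `o`. -/
abbrev Obs : Type := ℕ → Tree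

instance : Inhabited Tree := ⟨.lam [] (.var 0 0 [])⟩

mutual
/-- The values of a resource type: all functions from well-typed arguments to observations. -/
def Sem : Ty → Type
  | .arr as => SemSeq as → Obs
/-- The values of a sequence of intersection types. -/
def SemSeq : List (List Ty) → Type
  | [] => Unit
  | a :: as => SemBag a × SemSeq as
/-- The values of an intersection type. -/
def SemBag : List Ty → Type
  | [] => Unit
  | a :: as => Sem a × SemBag as
end

/-- Values of arbitrary type. Environments and arguments are lists of these, so that they can be cut
and concatenated without transport along equalities of types. -/
abbrev Val : Type := Σ a, Sem a

instance : ∀ a, Inhabited (Sem a)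
  | .arr _ => ⟨fun _ => default⟩

instance : Inhabited Val := ⟨⟨.o, default⟩⟩

open Classical in
/-- The component of a value at the type `a`, with a default value if `a` is not its type. -/
noncomputable def castTo (a : Ty) (v : Val) : Sem a := if h : v.1 = a then h ▸ v.2 else default

/-- The list of the components of a value of an intersection type. -/
def toBag : (a : List Ty) → SemBag a → List Val
  | [], _ => []
  | a :: as, v => ⟨a, v.1⟩ :: toBag as v.2

/-- The inverse of `toBag` on well-typed lists; other lists are padded with default values. -/
noncomputable def ofBag : (a : List Ty) → List Val → SemBag a
  | [], _ => ()
  | a :: as, l => (castTo a (l.headD default), ofBag as l.tail)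

/-- The components of a value of a sequence of intersection types. -/
def toSeq : (a : List (List Ty)) → SemSeq a → List (List Val)
  | [], _ => []
  | a :: as, v => toBag a v.1 :: toSeq as v.2

/-- The inverse of `toSeq` on well-typed arguments. -/
noncomputable def ofSeq : (a : List (List Ty)) → List (List Val) → SemSeq a
  | [], _ => ()
  | a :: as, l => (ofBag a (l.headD default), ofSeq as l.tail)

/-- The application of a value to arguments. -/
noncomputable def app : Val → List (List Val) → Obs
  | ⟨.arr a, F⟩, Q => F (ofSeq a Q)

/-- The value of type `b ⊸ o` that is given by a function. Only the values of the function at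
well-typed arguments matter. -/
def lamV (b : List (List Ty)) (F : List (List Val) → Obs) : Val := ⟨.arr b, fun Q => F (toSeq b Q)⟩

mutual
/-- The covariant action of morphisms on values: `f ⊸ o` acts by precomposition with the action
of `f` on arguments. -/
noncomputable def coactV : Mor → Val → Val
  | .arr fs, v => lamV (fs.map Prod.fst) fun Q => app v (coactSeqV fs Q)
/-- The action on arguments. The first components of the morphisms play no role. -/
noncomputable def coactSeqV : List BMor → List (List Val) → List (List Val)
  | (_, es) :: fs, q :: qs => coactEnt es q :: coactSeqV fs qs
  | _, _ => []
/-- The action on bags of values: `⟨α; m₀, m₁, …⟩` maps `q` to `m₀ q_{α 0}, m₁ q_{α 1}, …`. -/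
noncomputable def coactEnt : List (ℕ × Mor) → List Val → List Val
  | [], _ => []
  | (i, m) :: es, q => coactV m (q.getD i default) :: coactEnt es q
end

theorem castTo_self (v : Val) : castTo v.1 v = v.2 := by simp [castTo]

theorem mk_castTo {a : Ty} {v : Val} (h : v.1 = a) : (⟨a, castTo a v⟩ : Val) = v := by
  subst h; rw [castTo_self]

theorem ofBag_toBag : ∀ (a : List Ty) (v : SemBag a), ofBag a (toBag a v) = v
  | [], _ => rfl
  | a :: as, v => by
    simp only [toBag, ofBag, List.headD_cons, List.tail_cons, ofBag_toBag as]
    rw [castTo_self ⟨a, v.1⟩]; rfl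

theorem ofSeq_toSeq : ∀ (a : List (List Ty)) (v : SemSeq a), ofSeq a (toSeq a v) = v
  | [], _ => rfl
  | a :: as, v => by
    simp only [toSeq, ofSeq, List.headD_cons, List.tail_cons, ofSeq_toSeq as, ofBag_toBag]; rfl

theorem map_fst_toBag : ∀ (a : List Ty) (v : SemBag a), (toBag a v).map Sigma.fst = a
  | [], _ => rfl
  | a :: as, v => by simp [toBag, map_fst_toBag as]

/-- Well-typed sequences of bags of values. -/
def SeqEnv (a : List (List Ty)) (Q : List (List Val)) : Prop :=
  Q.map (fun q => q.map Sigma.fst) = a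

theorem seqEnv_toSeq : ∀ (a : List (List Ty)) (v : SemSeq a), SeqEnv a (toSeq a v)
  | [], _ => rfl
  | a :: as, v => by
    have := seqEnv_toSeq as v.2
    simp only [SeqEnv] at this ⊢
    simp [toSeq, map_fst_toBag, this]

theorem toBag_ofBag : ∀ {a : List Ty} {l : List Val}, l.map Sigma.fst = a → toBag a (ofBag a l) = l
  | [], l, h => by simp at h; simp [h, toBag]
  | a :: as, [], h => by simp at h
  | a :: as, v :: l, h => by
    simp only [List.map_cons, List.cons.injEq] at h
    simp only [toBag, ofBag, List.headD_cons, List.tail_cons, toBag_ofBag h.2, mk_castTo h.1]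

theorem toSeq_ofSeq : ∀ {a : List (List Ty)} {Q : List (List Val)}, SeqEnv a Q →
    toSeq a (ofSeq a Q) = Q
  | [], l, h => by simp [SeqEnv] at h; simp [h, toSeq]
  | a :: as, [], h => by simp [SeqEnv] at h
  | a :: as, v :: l, h => by
    simp only [SeqEnv, List.map_cons, List.cons.injEq] at h
    simp only [toSeq, ofSeq, List.headD_cons, List.tail_cons, toSeq_ofSeq h.2, toBag_ofBag h.1]

@[simp] theorem lamV_fst (b F) : (lamV b F).1 = .arr b := rfl

theorem app_lamV {b F Q} (h : SeqEnv b Q) : app (lamV b F) Q = F Q := by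
  simp only [app, lamV, toSeq_ofSeq h]

theorem lamV_app {b} {v : Val} (h : v.1 = .arr b) : lamV b (app v) = v := by
  obtain ⟨a, F⟩ := v
  subst h
  simp only [lamV, app, ofSeq_toSeq]

theorem lamV_congr {b F G} (h : ∀ Q, SeqEnv b Q → F Q = G Q) : lamV b F = lamV b G := by
  simp only [lamV]
  congr 1
  funext Q
  exact h _ (seqEnv_toSeq b Q)

theorem coactV_fst (m : Mor) (v : Val) : (coactV m v).1 = m.cod := by
  obtain ⟨fs⟩ := m
  rw [coactV]; rfl

theorem app_coactV {fs : List BMor} {v Q} (h : SeqEnv (fs.map Prod.fst) Q) :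
    app (coactV (.arr fs) v) Q = app v (coactSeqV fs Q) := by
  rw [coactV, app_lamV h]

/-- The value of type `o` of an observation. -/
def base (x : Obs) : Val := lamV [] fun _ => x

/-- The observation of a value of type `o`. -/
noncomputable def force (v : Val) : Obs := app v []

@[simp] theorem force_base (x : Obs) : force (base x) = x := by
  exact app_lamV (b := []) (Q := []) rfl

theorem base_force {v : Val} (h : v.1 = .o) : base (force v) = v := by
  conv_rhs => rw [← lamV_app h]
  refine lamV_congr fun Q hQ => ?_
  simp only [SeqEnv, List.map_eq_nil_iff] at hQ
  rw [force, hQ]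

/-! ### Lists of positions -/

/-- The entries of `l` at the positions `α`. -/
def sel {A : Type*} [Inhabited A] (l : List A) (α : List ℕ) : List A :=
  α.map fun i => l.getD i default

section sel
variable {A B : Type*} [Inhabited A] [Inhabited B]

@[simp] theorem sel_nil (l : List A) : sel l [] = [] := rfl

@[simp] theorem length_sel (l : List A) (α) : (sel l α).length = α.length := by simp [sel]

theorem sel_append (l : List A) (α β) : sel l (α ++ β) = sel l α ++ sel l β := by simp [sel]

theorem sel_range' (p l r : List A) : sel (p ++ (l ++ r)) (List.range' p.length l.length) = l := by
  apply List.ext_getElem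
  · simp
  · intro i h1 h2
    simp [sel, List.getElem?_append, h2]

theorem sel_range (l : List A) : sel l (List.range l.length) = l := by
  simpa [List.range_eq_range'] using sel_range' [] l []

theorem getD_sel (l : List A) (α : List ℕ) {i : ℕ} (h : i < α.length) :
    (sel l α).getD i default = l.getD (α.getD i default) default := by
  simp [sel, h]

theorem sel_sel (l : List A) (α : List ℕ) {β : List ℕ} (h : ∀ i ∈ β, i < α.length) :
    sel (sel l α) β = sel l (sel α β) := by
  simp only [sel, List.map_map]
  refine List.map_congr_left fun i hi => ?_
  simp [h i hi]

theorem map_sel (f : A → B) (hf : f default = default) (l : List A) (α : List ℕ) :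
    (sel l α).map f = sel (l.map f) α := by
  simp only [sel, List.map_map]
  refine List.map_congr_left fun i hi => ?_
  simp only [Function.comp_apply, List.getD_eq_getElem?_getD, List.getElem?_map]
  cases l[i]? <;> simp [hf]

theorem mem_sel {l : List A} {α : List ℕ} (h : ∀ i ∈ α, i < l.length) {x : A} (hx : x ∈ sel l α) :
    x ∈ l := by
  simp only [sel, List.mem_map] at hx
  obtain ⟨i, hi, rfl⟩ := hx
  have := h i hi
  simp [this]

end sel

/-! ### Extension -/

theorem ext_lt {A : Type} (l : List A) (g : ℕ → A) {x : ℕ} (h : x < l.length) :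
    ext l g x = l[x] := by simp [ext, h]

@[simp] theorem ext_add {A : Type} (l : List A) (g : ℕ → A) (x : ℕ) :
    ext l g (x + l.length) = g x := by simp [ext]

theorem ext_add' {A : Type} (l : List A) (g : ℕ → A) (x n : ℕ) (h : l.length = n) :
    ext l g (x + n) = g x := by subst h; simp

/-- Induction on the variables of an extended context. -/
theorem ext_cases {P : ℕ → Prop} (n : ℕ) (h1 : ∀ x < n, P x) (h2 : ∀ x, P (x + n)) (x : ℕ) : P x := by
  rcases lt_or_ge x n with h | h
  · exact h1 x h
  · have := h2 (x - n); rwa [Nat.sub_add_cancel h] at this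

/-! ### Morphisms of resource types -/

theorem Mor.IsHom.arr_inv {fs : List BMor} {c d : Ty} (h : Mor.IsHom (.arr fs) c d) :
    ∃ a b, c = .arr a ∧ d = .arr b ∧ SeqIsHom fs b a := by
  cases h with
  | arr h => exact ⟨_, _, rfl, rfl, h⟩

theorem Mor.isHom_arr_iff {fs : List BMor} {a b : List (List Ty)} :
    Mor.IsHom (.arr fs) (.arr a) (.arr b) ↔ SeqIsHom fs b a :=
  ⟨fun h => by cases h; assumption, .arr⟩

theorem BMor.isHom_iff {f : BMor} {a b} : f.IsHom a b ↔ f.1 = a ∧ EntriesIsHom a f.2 b := by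
  constructor
  · rintro ⟨h⟩; exact ⟨rfl, h⟩
  · obtain ⟨a', es⟩ := f
    rintro ⟨rfl, h⟩; exact .mk h

theorem seqIsHom_iff {f : List BMor} {a b} :
    SeqIsHom f a b ↔ f.map Prod.fst = a ∧ List.Forall₂ (fun g c => EntriesIsHom g.1 g.2 c) f b := by
  constructor
  · intro h
    induction f generalizing a b with
    | nil => cases h; simp
    | cons g f ih =>
      cases h with
      | cons h1 h2 =>
        rw [BMor.isHom_iff] at h1
        obtain ⟨rfl, h1⟩ := h1
        obtain ⟨rfl, h3⟩ := ih h2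
        exact ⟨rfl, .cons h1 h3⟩
  · rintro ⟨rfl, h⟩
    induction h with
    | nil => exact .nil
    | cons h1 h2 ih => exact .cons (.mk h1) ih

theorem entriesIsHom_iff {a es b} : EntriesIsHom a es b ↔
    List.Forall₂ (fun (e : ℕ × Mor) d => ∃ c, a[e.1]? = some c ∧ e.2.IsHom c d) es b := by
  constructor
  · intro h
    induction es generalizing b with
    | nil => cases h; simp
    | cons e es ih =>
      cases h with
      | cons h1 h2 h3 => exact .cons ⟨_, h1, h2⟩ (ih h3)
  · intro h
    induction h with
    | nil => exact .nil
    | cons h1 h2 ih =>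
      obtain ⟨c, h1, h3⟩ := h1
      exact .cons h1 h3 ih

theorem EntriesIsHom.length {a es b} (h : EntriesIsHom a es b) : es.length = b.length :=
  (entriesIsHom_iff.1 h).length_eq

theorem EntriesIsHom.lt {a es b} (h : EntriesIsHom a es b) {e} (he : e ∈ es) : e.1 < a.length := by
  rw [entriesIsHom_iff] at h
  induction h with
  | nil => simp at he
  | cons h1 h2 ih =>
    rcases List.mem_cons.1 he with rfl | he
    · obtain ⟨c, h1, _⟩ := h1
      exact (List.getElem?_eq_some_iff.1 h1).1
    · exact ih he

theorem EntriesIsHom.append {a es b es' b'} (h : EntriesIsHom a es b) (h' : EntriesIsHom a es' b') :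
    EntriesIsHom a (es ++ es') (b ++ b') := by
  rw [entriesIsHom_iff] at *
  exact List.rel_append h h'

theorem EntriesIsHom.take {a es b b'} (h : EntriesIsHom a es (b ++ b')) :
    EntriesIsHom a (es.take b.length) b := by
  rw [entriesIsHom_iff] at *
  simpa using List.forall₂_take b.length h

theorem EntriesIsHom.drop {a es b b'} (h : EntriesIsHom a es (b ++ b')) :
    EntriesIsHom a (es.drop b.length) b' := by
  rw [entriesIsHom_iff] at *
  simpa using List.forall₂_drop b.length h

theorem idSeq_map_fst (a : List (List Ty)) : (idSeq a).map Prod.fst = a := by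
  induction a with
  | nil => rfl
  | cons b as ih => simp [idSeq, ih]

theorem idSeq_eq_map (a : List (List Ty)) : idSeq a = a.map idBag := by
  induction a with
  | nil => rfl
  | cons b as ih => simp [idSeq, ih, idBag]

@[simp] theorem Ty.id_cod (a : Ty) : a.id.cod = a := by
  obtain ⟨as⟩ := a
  rw [Ty.id, Mor.cod, idSeq_map_fst]

theorem Mor.IsHom.cod_eq {m : Mor} {a b} (h : m.IsHom a b) : m.cod = b := by
  cases h with
  | arr h => rw [Mor.cod, (seqIsHom_iff.1 h).1]

theorem EntriesIsHom.tgt_eq {a es b} (h : EntriesIsHom a es b) :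
    BMor.tgt (a, es) = b := by
  rw [entriesIsHom_iff] at h
  simp only [BMor.tgt]
  induction h with
  | nil => rfl
  | cons h1 _ ih => obtain ⟨c, _, h1⟩ := h1; simp [ih, h1.cod_eq]

theorem BMor.IsHom.tgt_eq {f : BMor} {a b} (h : f.IsHom a b) : f.tgt = b := by
  obtain ⟨h⟩ := h; exact h.tgt_eq

theorem BMor.IsHom.src_eq {f : BMor} {a b} (h : f.IsHom a b) : f.1 = a := by
  obtain ⟨h⟩ := h; rfl

theorem SeqIsHom.src_eq {f a b} (h : SeqIsHom f a b) : f.map Prod.fst = a := (seqIsHom_iff.1 h).1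

theorem SeqIsHom.tgt_eq {f a b} (h : SeqIsHom f a b) : f.map BMor.tgt = b := by
  obtain ⟨_, h⟩ := seqIsHom_iff.1 h
  clear * - h
  induction h with
  | nil => rfl
  | cons h1 _ ih => simp [ih, h1.tgt_eq]

theorem SeqIsHom.length_src {f a b} (h : SeqIsHom f a b) : f.length = a.length := by
  rw [← h.src_eq, List.length_map]

theorem SeqIsHom.length_tgt {f a b} (h : SeqIsHom f a b) : f.length = b.length := by
  rw [← h.tgt_eq, List.length_map]

theorem ground_tgt (α a) : (ground α a).tgt = sel a α := by
  simp only [ground, BMor.tgt, List.map_map, sel]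
  refine List.map_congr_left fun i _ => ?_
  simp only [Function.comp_apply, Ty.id_cod]
  rfl

theorem getElem?_of_lt {A : Type*} [Inhabited A] {l : List A} {i : ℕ} (h : i < l.length) :
    l[i]? = some (l.getD i default) := by simp [h]

theorem ground_isHom {α : List ℕ} {a : List Ty} (h : ∀ i ∈ α, i < a.length) :
    (ground α a).IsHom a (sel a α) := by
  refine .mk ?_
  induction α with
  | nil => exact .nil
  | cons i α ih =>
    exact .cons (getElem?_of_lt (h i (by simp))) (Ty.id_isHom _)
      (ih fun j hj => h j (by simp [hj]))

theorem idEntries_eq_map (k : ℕ) (a : List Ty) :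
    idEntries k a = (List.range a.length).map fun i => (k + i, (a.getD i default).id) := by
  apply List.ext_getElem?
  intro i
  by_cases h : i < a.length
  · rw [idEntries_get a k i _ (getElem?_of_lt h)]; simp [h]
  · have : (idEntries k a).length = a.length := by
      clear h
      induction a generalizing k with
      | nil => rfl
      | cons c a ih => simp [idEntries, ih]
    rw [List.getElem?_eq_none (by omega), List.getElem?_eq_none (by simp; omega)]

theorem idBag_eq_ground (a : List Ty) : idBag a = ground (List.range a.length) a := by
  rw [idBag, ground, idEntries_eq_map]
  simp only [Nat.zero_add]; rfl

theorem idEntries_isHom' (a : List Ty) : EntriesIsHom a (idEntries 0 a) a := idEntries_isHom a []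

/-! ### The action of morphisms on values -/

theorem coactEnt_eq_map (es : List (ℕ × Mor)) (q : List Val) :
    coactEnt es q = es.map fun e => coactV e.2 (q.getD e.1 default) := by
  induction es with
  | nil => rw [coactEnt, List.map_nil]
  | cons e es ih => rw [coactEnt, ih, List.map_cons]

theorem coactSeqV_eq_zipWith (f : List BMor) (Q : List (List Val)) :
    coactSeqV f Q = List.zipWith (fun g q => coactEnt g.2 q) f Q := by
  induction f generalizing Q with
  | nil => simp [coactSeqV]
  | cons g f ih => cases Q <;> simp [coactSeqV, ih]

@[simp] theorem coactSeqV_cons (g f q Q) :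
    coactSeqV (g :: f) (q :: Q) = coactEnt g.2 q :: coactSeqV f Q := by rw [coactSeqV]

theorem coactEnt_fst {a es b} (h : EntriesIsHom a es b) (q : List Val) :
    (coactEnt es q).map Sigma.fst = b := by
  rw [← h.tgt_eq, coactEnt_eq_map, BMor.tgt, List.map_map]
  exact List.map_congr_left fun e _ => coactV_fst _ _

theorem seqEnv_coactSeqV {f a b} (h : SeqIsHom f a b) {Q : List (List Val)} (hQ : SeqEnv a Q) :
    SeqEnv b (coactSeqV f Q) := by
  obtain ⟨rfl, h'⟩ := seqIsHom_iff.1 h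
  clear h
  unfold SeqEnv at hQ ⊢
  induction h' generalizing Q with
  | nil => simp [coactSeqV]
  | @cons g c f b h1 h2 ih =>
    cases Q with
    | nil => simp at hQ
    | cons q Q =>
      simp only [List.map_cons, List.cons.injEq] at hQ
      simp [ih hQ.2, coactEnt_fst h1]

mutual
/-- The identity acts trivially. -/
theorem coactV_id : ∀ (a : Ty) {v : Val}, v.1 = a → coactV a.id v = v
  | .arr as, v, h => by
    rw [Ty.id, coactV, idSeq_map_fst]
    conv_rhs => rw [← lamV_app h]
    exact lamV_congr fun Q hQ => by rw [coactSeqV_id as hQ]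
theorem coactSeqV_id : ∀ (as : List (List Ty)) {Q : List (List Val)}, SeqEnv as Q →
    coactSeqV (idSeq as) Q = Q
  | [], Q, h => by simp [SeqEnv] at h; subst h; rw [idSeq, coactSeqV]; simp
  | a :: as, [], h => by simp [SeqEnv] at h
  | a :: as, q :: Q, h => by
    simp only [SeqEnv, List.map_cons, List.cons.injEq] at h
    rw [idSeq, coactSeqV_cons, coactSeqV_id as h.2]
    congr 1
    exact coactEnt_id a [] q h.1
/-- The identity acts trivially on bags. The list `p` accounts for the offset in `idEntries`. -/
theorem coactEnt_id : ∀ (a : List Ty) (p q : List Val), q.map Sigma.fst = a →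
    coactEnt (idEntries p.length a) (p ++ q) = q
  | [], p, q, h => by simp at h; subst h; rw [idEntries, coactEnt]
  | a :: as, p, [], h => by simp at h
  | a :: as, p, v :: q, h => by
    simp only [List.map_cons, List.cons.injEq] at h
    rw [idEntries, coactEnt]
    have h2 := coactEnt_id as (p ++ [v]) q h.2
    simp only [List.append_assoc, List.singleton_append, List.length_append,
      List.length_singleton] at h2
    rw [h2]
    congr 1
    simp [coactV_id a h.1]
end

theorem getD_fst {q : List Val} {a : List Ty} (h : q.map Sigma.fst = a) (i : ℕ) :
    (q.getD i default).1 = a.getD i default := by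
  subst h
  simp only [List.getD_eq_getElem?_getD, List.getElem?_map]
  cases q[i]? <;> rfl

theorem coactEnt_ground (α : List ℕ) {a : List Ty} {q : List Val} (h : q.map Sigma.fst = a) :
    coactEnt (ground α a).2 q = sel q α := by
  rw [coactEnt_eq_map, ground, List.map_map, sel]
  exact List.map_congr_left fun i _ => coactV_id _ (getD_fst h i)

theorem coactEnt_idBag {a : List Ty} {q : List Val} (h : q.map Sigma.fst = a) :
    coactEnt (idBag a).2 q = q := coactEnt_id a [] q h

theorem BMor.comp_snd_eq {g f : BMor} {a b c} (hf : EntriesIsHom a f.2 b)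
    (hg : EntriesIsHom b g.2 c) : (BMor.comp g f).2 = g.2.map fun e =>
      ((f.2.getD e.1 default).1, Mor.comp e.2 (f.2.getD e.1 default).2) := by
  simp only [BMor.comp]
  refine List.map_congr_left fun e he => ?_
  have h := hg.lt he
  rw [← hf.length] at h
  simp [h]

theorem EntriesIsHom.getD {a es b} (h : EntriesIsHom a es b) {i} (hi : i < es.length) :
    (es.getD i default).1 < a.length ∧ (es.getD i default).2.IsHom
      (a.getD (es.getD i default).1 default) (b.getD i default) := by
  have h1 : i < b.length := h.length ▸ hi
  obtain ⟨j, m, c, h2, h3, h4⟩ := h.get (getElem?_of_lt h1)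
  obtain ⟨h5, h6⟩ := List.getElem?_eq_some_iff.1 h3
  simp only [List.getD_eq_getElem?_getD, h2, Option.getD_some, h3] at h4 ⊢
  exact ⟨h5, h4⟩

theorem EntriesIsHom.mem {a es b} (h : EntriesIsHom a es b) {e} (he : e ∈ es) :
    ∃ d, e.2.IsHom (a.getD e.1 default) d := by
  obtain ⟨i, hi, rfl⟩ := List.getElem_of_mem he
  have := h.getD hi
  simp only [List.getD_eq_getElem?_getD, List.getElem?_eq_getElem hi, Option.getD_some] at this
  exact ⟨_, this.2⟩

theorem getD_map_of_lt {A B : Type*} (f : A → B) (l : List A) {i : ℕ} (h : i < l.length) (a : A)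
    (b : B) : (l.map f).getD i b = f (l.getD i a) := by simp [h]

/-- Functoriality on bags, from the functoriality for the entries of the two morphisms. -/
theorem coactEnt_comp_of {f g : BMor} {a b c} (hf : EntriesIsHom a f.2 b)
    (hg : EntriesIsHom b g.2 c) {q : List Val} (hq : q.map Sigma.fst = a)
    (H : ∀ p ∈ f.2, ∀ r ∈ g.2, ∀ w x y, Mor.IsHom p.2 w x → Mor.IsHom r.2 x y →
      ∀ v : Val, v.1 = w → coactV (r.2.comp p.2) v = coactV r.2 (coactV p.2 v)) :
    coactEnt (BMor.comp g f).2 q = coactEnt g.2 (coactEnt f.2 q) := by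
  rw [BMor.comp_snd_eq hf hg, coactEnt_eq_map, coactEnt_eq_map g.2, List.map_map]
  refine List.map_congr_left fun e he => ?_
  have h1 := hg.lt he
  rw [← hf.length] at h1
  obtain ⟨h2, h3⟩ := hf.getD h1
  obtain ⟨d, h4⟩ := hg.mem he
  simp only [Function.comp_apply]
  rw [H _ _ e he _ _ _ h3 h4 _ (getD_fst hq _), coactEnt_eq_map,
    getD_map_of_lt _ _ h1 default]
  rw [List.getD_eq_getElem _ _ h1]
  exact List.getElem_mem _

theorem seqComp_map_fst {f g : List BMor} (h : f.length = g.length) :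
    (seqComp g f).map Prod.fst = f.map Prod.fst := by
  induction f generalizing g with
  | nil => cases g <;> simp [seqComp] at h ⊢
  | cons x f ih =>
    cases g with
    | nil => simp at h
    | cons y g => simp only [seqComp] at ih; simp [seqComp, BMor.comp, ih (by simpa using h)]

theorem coactV_comp_aux (n : ℕ) : ∀ {f g : Mor} {a b c : Ty}, sizeOf f + sizeOf g < n →
    f.IsHom a b → g.IsHom b c → ∀ v : Val, v.1 = a →
    coactV (g.comp f) v = coactV g (coactV f v) := by
  induction n with
  | zero => intro _ _ _ _ _ h; omega
  | succ n ih =>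
    intro f g a b c hn hf hg v hv
    cases hf with
    | @arr fs a b hf =>
    cases hg with
    | @arr gs b c hg =>
    rw [Mor.comp_arr, coactV, coactV.eq_1 _ gs,
      seqComp_map_fst (by rw [hg.length_tgt, hf.length_src])]
    refine lamV_congr fun Q hQ => ?_
    rw [hg.src_eq] at hQ
    rw [app_coactV (by rw [hf.src_eq]; exact seqEnv_coactSeqV hg hQ)]
    congr 1
    simp only [Mor.arr.sizeOf_spec] at hn
    replace hn : sizeOf fs + sizeOf gs < n := by omega
    clear hv v
    induction fs generalizing gs a b c Q with
    | nil => cases hf; cases hg; simp [seqComp, coactSeqV]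
    | cons f fs ih' =>
      cases hf with
      | @cons _ b a _ bs as hf hfs =>
      cases hg with
      | @cons g c _ gs cs _ hg hgs =>
      cases Q with
      | nil => simp [SeqEnv] at hQ
      | cons q Q =>
      simp only [SeqEnv, List.map_cons, List.cons.injEq] at hQ
      have hi : coactSeqV (seqComp fs gs) Q = coactSeqV fs (coactSeqV gs Q) :=
        ih' hfs hgs Q hQ.2 (by simp at hn; omega)
      rw [seqComp] at hi
      rw [seqComp, List.zipWith_cons_cons]
      simp only [coactSeqV_cons]
      rw [hi]
      congr 1
      rw [BMor.isHom_iff] at hf hg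
      refine coactEnt_comp_of hg.2 hf.2 hQ.1 ?_
      intro p hp r hr w x y h1 h2
      refine ih ?_ h1 h2
      have s1 := List.sizeOf_lt_of_mem hp
      have s2 := List.sizeOf_lt_of_mem hr
      obtain ⟨_, _⟩ := p
      obtain ⟨_, _⟩ := r
      obtain ⟨_, _⟩ := f
      obtain ⟨_, _⟩ := g
      simp at hn s1 s2 ⊢
      omega

/-- The action on values is functorial. -/
theorem coactV_comp {f g : Mor} {a b c : Ty} (hf : f.IsHom a b) (hg : g.IsHom b c) {v : Val}
    (hv : v.1 = a) : coactV (g.comp f) v = coactV g (coactV f v) :=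
  coactV_comp_aux _ (Nat.lt_succ_self _) hf hg v hv

theorem coactEnt_comp {f g : BMor} {a b c} (hf : f.IsHom a b)
    (hg : g.IsHom b c) {q : List Val} (hq : q.map Sigma.fst = a) :
    coactEnt (BMor.comp g f).2 q = coactEnt g.2 (coactEnt f.2 q) := by
  rw [BMor.isHom_iff] at hf hg
  exact coactEnt_comp_of hf.2 hg.2 hq fun _ _ _ _ _ _ _ h1 h2 _ h3 => coactV_comp h1 h2 h3

theorem SeqIsHom.comp {f g a b c} (hf : SeqIsHom f a b) (hg : SeqIsHom g b c) :
    SeqIsHom (seqComp g f) a c := by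
  induction f generalizing g a b c with
  | nil => cases hf; cases hg; exact .nil
  | cons x f ih =>
    cases hf with
    | cons h1 h2 =>
      cases hg with
      | cons h3 h4 => exact .cons (h1.comp h3) (ih h2 h4)

theorem SeqIsHom.comp_id {f a b} (hf : SeqIsHom f a b) : seqComp f (idSeq a) = f := by
  have := (Mor.IsHom.arr hf).id_comp
  rw [Ty.id, Mor.comp_arr] at this
  simpa using this

theorem SeqIsHom.id_comp {f a b} (hf : SeqIsHom f a b) : seqComp (idSeq b) f = f := by
  have := (Mor.IsHom.arr hf).comp_id
  rw [Ty.id, Mor.comp_arr] at this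
  simpa using this

theorem SeqIsHom.assoc {f g h a b c d} (hf : SeqIsHom f a b) (hg : SeqIsHom g b c)
    (hh : SeqIsHom h c d) : seqComp (seqComp h g) f = seqComp h (seqComp g f) := by
  have := (Mor.IsHom.arr hh).assoc (.arr hg) (.arr hf)
  simp only [Mor.comp_arr] at this
  simpa using this.symm

theorem coactSeqV_comp {f g a b c} (hf : SeqIsHom f a b) (hg : SeqIsHom g b c)
    {Q : List (List Val)} (hQ : SeqEnv a Q) :
    coactSeqV (seqComp g f) Q = coactSeqV g (coactSeqV f Q) := by
  induction f generalizing g a b c Q with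
  | nil => cases hf; cases hg; simp [seqComp, coactSeqV]
  | cons x f ih =>
    cases hf with
    | cons h1 h2 =>
      cases hg with
      | cons h3 h4 =>
        cases Q with
        | nil => simp [SeqEnv] at hQ
        | cons q Q =>
          simp only [SeqEnv, List.map_cons, List.cons.injEq] at hQ
          have := ih h2 h4 hQ.2
          rw [seqComp] at this
          rw [seqComp, List.zipWith_cons_cons]
          simp only [coactSeqV_cons]
          rw [this, coactEnt_comp h1 h3 hQ.1]

/-! ### Ground morphisms and tensor products -/

/-- Postcomposition with a ground morphism is a reindexing. -/
theorem ground_comp {β : List ℕ} {f : BMor} {a b} (hf : f.IsHom a b) (hβ : ∀ i ∈ β, i < b.length) :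
    (ground β b).comp f = reindex β f := by
  have h := (BMor.isHom_iff.1 hf).2
  have h2 := (BMor.isHom_iff.1 (ground_isHom hβ)).2
  refine Prod.ext rfl ?_
  rw [BMor.comp_snd_eq h h2, ground, reindex, List.map_map]
  refine List.map_congr_left fun i hi => ?_
  have h3 := h.getD (i := i) (by rw [h.length]; exact hβ i hi)
  simp only [Function.comp_apply]
  exact Prod.ext rfl h3.2.id_comp

theorem reindex_ground {α β : List ℕ} (h : ∀ i ∈ β, i < α.length) (a : List Ty) :
    reindex β (ground α a) = ground (sel α β) a := by
  refine Prod.ext rfl ?_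
  simp only [reindex, ground, sel, List.map_map]
  refine List.map_congr_left fun i hi => ?_
  simp [h i hi]

theorem ground_comp_ground {α β : List ℕ} {a : List Ty} (hα : ∀ i ∈ α, i < a.length)
    (hβ : ∀ i ∈ β, i < α.length) :
    (ground β (sel a α)).comp (ground α a) = ground (sel α β) a := by
  rw [ground_comp (ground_isHom hα) (by simpa using hβ), reindex_ground hβ]

theorem reindex_isHom {f : BMor} {a b} (hf : f.IsHom a b) {β : List ℕ}
    (hβ : ∀ i ∈ β, i < b.length) : (reindex β f).IsHom a (sel b β) := by
  rw [← ground_comp hf hβ]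
  exact hf.comp (ground_isHom hβ)

theorem coactEnt_reindex {f : BMor} {β : List ℕ} (hβ : ∀ i ∈ β, i < f.2.length) (q : List Val) :
    coactEnt (reindex β f).2 q = sel (coactEnt f.2 q) β := by
  simp only [coactEnt_eq_map, reindex, sel, List.map_map]
  refine List.map_congr_left fun i hi => ?_
  simp [hβ i hi]

theorem EntriesIsHom.weaken {a es b} (h : EntriesIsHom a es b) (c : List Ty) :
    EntriesIsHom (a ++ c) es b := by
  rw [entriesIsHom_iff] at *
  refine h.imp fun e d => ?_
  rintro ⟨x, h1, h2⟩
  exact ⟨x, by rw [List.getElem?_append_left (List.getElem?_eq_some_iff.1 h1).1, h1], h2⟩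

theorem EntriesIsHom.shift {a es b} (h : EntriesIsHom a es b) (c : List Ty) :
    EntriesIsHom (c ++ a) (es.map fun e => (c.length + e.1, e.2)) b := by
  rw [entriesIsHom_iff] at *
  rw [List.forall₂_map_left_iff]
  refine h.imp fun e d => ?_
  rintro ⟨x, h1, h2⟩
  exact ⟨x, by rw [List.getElem?_append_right (by simp)]; simpa using h1, h2⟩

theorem BMor.IsHom.tensor {f g : BMor} {a b c d} (hf : f.IsHom a b) (hg : g.IsHom c d) :
    (f.tensor g).IsHom (a ++ c) (b ++ d) := by
  rw [BMor.isHom_iff] at *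
  obtain ⟨rfl, hf⟩ := hf
  obtain ⟨rfl, hg⟩ := hg
  exact ⟨rfl, (hf.weaken _).append (hg.shift _)⟩

theorem BMor.tensor_comp {f g f' g' : BMor} {a b c a' b' c'} (hf : f.IsHom a b) (hg : g.IsHom b c)
    (hf' : f'.IsHom a' b') (hg' : g'.IsHom b' c') :
    (g.tensor g').comp (f.tensor f') = (g.comp f).tensor (g'.comp f') := by
  have h1 := (BMor.isHom_iff.1 (hf.tensor hf')).2
  have h2 := (BMor.isHom_iff.1 (hg.tensor hg')).2
  refine Prod.ext rfl ?_
  rw [BMor.comp_snd_eq h1 h2]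
  rw [BMor.isHom_iff] at hf hg hf' hg'
  rw [BMor.tensor, BMor.tensor, BMor.tensor, BMor.comp_snd_eq hf.2 hg.2,
    BMor.comp_snd_eq hf'.2 hg'.2]
  simp only [List.map_append, List.map_map]
  congr 1
  · refine List.map_congr_left fun e he => ?_
    have h := hg.2.lt he
    rw [← hf.2.length] at h
    simp [List.getElem?_append, h]
  · refine List.map_congr_left fun e he => ?_
    have h := hg'.2.lt he
    rw [← hf'.2.length] at h
    simp only [Function.comp_apply, hg.1, ← hf.2.length]
    rw [List.getD_append_right _ _ _ _ (by simp)]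
    simp [h, BMor.comp]

theorem idBag_append (a b : List Ty) : idBag (a ++ b) = (idBag a).tensor (idBag b) := by
  refine Prod.ext rfl ?_
  simp only [idBag, BMor.tensor, idEntries_eq_map, List.length_append, List.range_add,
    List.map_append, List.map_map]
  congr 1
  · refine List.map_congr_left fun i hi => ?_
    simp at hi
    simp [List.getElem?_append, hi]
  · refine List.map_congr_left fun i hi => ?_
    simp [List.getElem?_append]

theorem coactEnt_append (es es' : List (ℕ × Mor)) (q) :
    coactEnt (es ++ es') q = coactEnt es q ++ coactEnt es' q := by simp [coactEnt_eq_map]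

/-- The action of a tensor product is componentwise. -/
theorem coactEnt_tensor {f g : BMor} {a b} (hf : f.IsHom a b) {u w : List Val}
    (hu : u.map Sigma.fst = a) :
    coactEnt (f.tensor g).2 (u ++ w) = coactEnt f.2 u ++ coactEnt g.2 w := by
  rw [BMor.isHom_iff] at hf
  subst hu
  rw [BMor.tensor, coactEnt_append]
  simp only [coactEnt_eq_map, List.map_map]
  congr 1
  · refine List.map_congr_left fun e he => ?_
    have h := hf.2.lt he
    rw [List.length_map] at h
    simp [List.getElem?_append, h]
  · refine List.map_congr_left fun e he => ?_
    have : f.1.length = u.length := by rw [hf.1, List.length_map]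
    simp [this, List.getElem?_append]

/-! ### The denotation of terms -/

mutual
/-- The denotation of terms. The environment gives one value for each occurrence of each variable,
and every subterm uses up as many of them as it has occurrences, from left to right. -/
noncomputable def sem : Tm → (ℕ → List Val) → Val
  | .var x q, ρ =>
    match ρ x with
    | v :: r => base (app v (semSeq q (Function.update ρ x r)))
    | [] => default
  | .lam f s, ρ => lamV (f.map Prod.fst) fun Q => force (sem s (ext (coactSeqV f Q) ρ))
  | .redex f s q, ρ =>
    base (app (lamV (f.map Prod.fst) fun Q => force (sem s (ext (coactSeqV f Q)
        fun x => (ρ x).take (occ (x + f.length) s))))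
      (semSeq q fun x => (ρ x).drop (occ (x + f.length) s)))
/-- The denotation of bags. -/
noncomputable def semBag : List Tm → (ℕ → List Val) → List Val
  | [], _ => []
  | t :: ts, ρ => sem t (fun x => (ρ x).take (occ x t)) :: semBag ts (fun x => (ρ x).drop (occ x t))
/-- The denotation of sequences of bags. -/
noncomputable def semSeq : List (List Tm) → (ℕ → List Val) → List (List Val)
  | [], _ => []
  | q :: qs, ρ => semBag q (fun x => (ρ x).take (occBag x q)) ::
      semSeq qs (fun x => (ρ x).drop (occBag x q))
end

theorem Ctx.cons_add (b : List (List Ty)) (γ : Ctx) (x : ℕ) :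
    Ctx.cons b γ (x + b.length) = γ x := ext_add b γ x

theorem Ctx.tensor_apply (γ δ : Ctx) (x : ℕ) : γ.tensor δ x = γ x ++ δ x := rfl

mutual
/-- The occurrences of a variable correspond to the entries of its intersection type. -/
theorem occ_eq : ∀ {γ s a}, HasType γ s a → ∀ x, occ x s = (γ x).length
  | _, _, _, .var (x := y) h, x => by
    rw [occ, occSeq_eq h x, Ctx.tensor, List.length_append, Ctx.single]
    split <;> rfl
  | _, _, _, .lam (b := b) _ hf h, x => by
    rw [occ, occ_eq h, hf.length_tgt, Ctx.cons_add]
  | _, _, _, .redex (.lam (b := b) _ hf h) hq, x => by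
    rw [occ, occ_eq h, occSeq_eq hq, hf.length_tgt, Ctx.cons_add, Ctx.tensor_apply,
      List.length_append]
theorem occBag_eq : ∀ {γ q a}, BagHasType γ q a → ∀ x, occBag x q = (γ x).length
  | _, _, _, .nil, _ => rfl
  | _, _, _, .cons h1 h2, x => by
    rw [occBag, occ_eq h1, occBag_eq h2, Ctx.tensor, List.length_append]
theorem occSeq_eq : ∀ {γ q a}, SeqHasType γ q a → ∀ x, occSeq x q = (γ x).length
  | _, _, _, .nil, _ => rfl
  | _, _, _, .cons h1 h2, x => by
    rw [occSeq, occBag_eq h1, occSeq_eq h2, Ctx.tensor, List.length_append]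
end

theorem occ_body_eq {γ f s a} (h : HasType γ (.lam f s) a) (x : ℕ) :
    occ (x + f.length) s = (γ x).length := occ_eq h x

/-- Well-typed environments. -/
def Env (γ : Ctx) (ρ : ℕ → List Val) : Prop := ∀ x, (ρ x).map Sigma.fst = γ x

theorem Env.length {γ ρ} (h : Env γ ρ) (x) : (ρ x).length = (γ x).length := by
  rw [← h x, List.length_map]

/-- An environment for a tensor product is a concatenation of environments. -/
theorem Env.split {γ δ : Ctx} {ρ} (h : Env (γ.tensor δ) ρ) :
    ∃ ρ1 ρ2, ρ = (fun x => ρ1 x ++ ρ2 x) ∧ Env γ ρ1 ∧ Env δ ρ2 := by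
  refine ⟨fun x => (ρ x).take (γ x).length, fun x => (ρ x).drop (γ x).length, ?_, ?_, ?_⟩
  · funext x; simp
  · intro x; simp [List.map_take, h x, Ctx.tensor]
  · intro x; simp [List.map_drop, h x, Ctx.tensor]

theorem Env.append {γ δ : Ctx} {ρ ρ'} (h : Env γ ρ) (h' : Env δ ρ') :
    Env (γ.tensor δ) (fun x => ρ x ++ ρ' x) := fun x => by
  rw [List.map_append, h x, h' x, Ctx.tensor]

theorem Env.ext {γ : Ctx} {ρ a Q} (h : Env γ ρ) (hQ : SeqEnv a Q) :
    Env (.cons a γ) (ext Q ρ) := by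
  intro x
  subst hQ
  simp only [ResourceCalculus.ext, Ctx.cons, List.getElem?_map, List.length_map]
  cases Q[x]? with
  | none => simpa using h _
  | some q => simp

theorem Env.sel {γ : Ctx} {ρ} (h : Env γ ρ) (α : ℕ → List ℕ) :
    Env (fun x => sel (γ x) (α x)) (fun x => sel (ρ x) (α x)) := fun x => by
  have := map_sel (Sigma.fst : Val → Ty) rfl (ρ x) (α x)
  rw [h x] at this
  exact this

theorem semBag_append {t ts} {ρ1 ρ2 : ℕ → List Val} (h : ∀ x, (ρ1 x).length = occ x t) :
    semBag (t :: ts) (fun x => ρ1 x ++ ρ2 x) = sem t ρ1 :: semBag ts ρ2 := by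
  simp [semBag, ← h]

theorem semSeq_append {q qs} {ρ1 ρ2 : ℕ → List Val} (h : ∀ x, (ρ1 x).length = occBag x q) :
    semSeq (q :: qs) (fun x => ρ1 x ++ ρ2 x) = semBag q ρ1 :: semSeq qs ρ2 := by
  simp [semSeq, ← h]

theorem sem_redex_append {f s q} {ρ1 ρ2 : ℕ → List Val}
    (h : ∀ x, (ρ1 x).length = occ (x + f.length) s) :
    sem (.redex f s q) (fun x => ρ1 x ++ ρ2 x) =
      base (app (sem (.lam f s) ρ1) (semSeq q ρ2)) := by
  simp [sem, ← h]

theorem sem_var_cons {x q} {ρ : ℕ → List Val} {v : Val} :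
    sem (.var x q) (fun y => (if y = x then [v] else []) ++ ρ y) = base (app v (semSeq q ρ)) := by
  rw [sem]
  simp only [↓reduceIte, List.singleton_append]
  congr 3
  funext y
  by_cases h : y = x
  · subst h; simp
  · simp [h]

theorem Env.var_split {γ : Ctx} {x a ρ} (h : Env ((Ctx.single x a).tensor γ) ρ) :
    ∃ v ρ', ρ = (fun y => (if y = x then [v] else []) ++ ρ' y) ∧ v.1 = a ∧ Env γ ρ' := by
  obtain ⟨ρ1, ρ2, rfl, h1, h2⟩ := h.split
  have hx := h1 x
  simp only [Ctx.single, ↓reduceIte, List.map_eq_singleton_iff] at hx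
  obtain ⟨v, hv, rfl⟩ := hx
  refine ⟨v, ρ2, ?_, rfl, h2⟩
  funext y
  by_cases h : y = x
  · subst h; simp [hv]
  · have := h1 y
    simp only [Ctx.single, h, ↓reduceIte, List.map_eq_nil_iff] at this
    simp [h, this]

theorem sem_fst {γ s a} (h : HasType γ s a) {ρ} (hρ : Env γ ρ) : (sem s ρ).1 = a := by
  cases h with
  | var h =>
    obtain ⟨v, ρ', rfl, _, _⟩ := hρ.var_split
    rw [sem_var_cons]; rfl
  | lam _ hf _ => rw [sem, lamV_fst, hf.src_eq]
  | redex h hq => rw [sem]; rfl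

theorem semBag_map_fst {γ q a} (h : BagHasType γ q a) : ∀ {ρ}, Env γ ρ →
    (semBag q ρ).map Sigma.fst = a := by
  induction q generalizing γ a with
  | nil => cases h; intros; rfl
  | cons t ts ih =>
    intro ρ hρ
    cases h with
    | cons h1 h2 =>
      obtain ⟨ρ1, ρ2, rfl, e1, e2⟩ := hρ.split
      rw [semBag_append (fun x => by rw [e1.length, occ_eq h1]), List.map_cons, sem_fst h1 e1,
        ih h2 e2]

theorem semSeq_seqEnv {γ q a} (h : SeqHasType γ q a) : ∀ {ρ}, Env γ ρ → SeqEnv a (semSeq q ρ) := by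
  induction q generalizing γ a with
  | nil => cases h; intros; rfl
  | cons t ts ih =>
    intro ρ hρ
    cases h with
    | cons h1 h2 =>
      obtain ⟨ρ1, ρ2, rfl, e1, e2⟩ := hρ.split
      have := ih h2 e2
      rw [SeqEnv] at this ⊢
      rw [semSeq_append (fun x => by rw [e1.length, occBag_eq h1]), List.map_cons,
        semBag_map_fst h1 e1, this]

theorem BagHasType.length {γ q a} (h : BagHasType γ q a) : q.length = a.length := by
  induction q generalizing γ a with
  | nil => cases h; rfl
  | cons t ts ih =>
    cases h with
    | cons h1 h2 => simp [ih h2]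

/-! ### Complexity -/

/-- The arrows of `a` are nested to a depth of at most `n`. The type `o` has depth one, so that no
type has depth zero. -/
def DepthLE : ℕ → Ty → Prop
  | 0, _ => False
  | n + 1, .arr bs => ∀ b ∈ bs, ∀ a ∈ b, DepthLE n a

/-- All redexes have an abstraction whose type has depth at most `d`. In particular, the terms with
`Deg 0` are redex-free. -/
inductive Deg (d : ℕ) : Tm → Prop
  | var {x q} : (∀ b ∈ q, ∀ t ∈ b, Deg d t) → Deg d (.var x q)
  | lam {f s} : Deg d s → Deg d (.lam f s)
  | redex {f s q} : DepthLE d (.arr (f.map Prod.fst)) → Deg d s → (∀ b ∈ q, ∀ t ∈ b, Deg d t) →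
      Deg d (.redex f s q)

/-- Redex-free terms of height at most `n`. -/
def RF : ℕ → Tm → Prop
  | 0, _ => False
  | n + 1, .var _ q => ∀ b ∈ q, ∀ t ∈ b, RF n t
  | n + 1, .lam _ s => RF n s
  | _ + 1, .redex _ _ _ => False

theorem Deg.coact {d s} (h : Deg d s) (m : Mor) : Deg d (coact m s) := by
  obtain ⟨fs⟩ := m
  cases h with
  | var h => exact .var h
  | lam h => exact .lam h
  | redex h1 h2 h3 => exact .redex h1 h2 h3

theorem RF.coact {n s} (h : RF n s) (m : Mor) : RF n (coact m s) := by
  obtain ⟨fs⟩ := m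
  cases n with
  | zero => exact h
  | succ n => cases s <;> exact h

/-! ### The covariant action -/

/-- The covariant action is well-typed. -/
theorem HasType.coact {γ t a b m} (h : HasType γ t a) (hm : Mor.IsHom m a b) :
    HasType γ (coact m t) b := by
  cases h with
  | var h => cases hm with | arr hm => cases hm; exact .var h
  | redex h hq => cases hm with | arr hm => cases hm; exact .redex h hq
  | lam h0 hf h =>
    cases hm with
    | arr hm =>
      refine .lam ?_ (hm.comp hf) h
      intro h1
      have := (hm.comp hf).length_tgt
      rw [h1, ← hf.length_tgt] at this
      exact h0 (List.length_eq_zero_iff.1 this.symm)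

/-- The covariant action denotes the action on values. -/
theorem sem_coact {γ t a b m} (h : HasType γ t a) (hm : Mor.IsHom m a b) {ρ} (hρ : Env γ ρ) :
    sem (coact m t) ρ = coactV m (sem t ρ) := by
  have h1 := sem_fst h hρ
  cases h with
  | var h => cases hm with
    | arr hm => cases hm; exact (coactV_id .o h1).symm
  | redex h hq => cases hm with
    | arr hm => cases hm; exact (coactV_id .o h1).symm
  | lam h0 hf h =>
    cases hm with
    | @arr g _ b hm =>
      simp only [ResourceCalculus.coact]
      rw [sem, coactV, seqComp_map_fst (by rw [hm.length_tgt, hf.length_src])]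
      refine lamV_congr fun Q hQ => ?_
      rw [hm.src_eq] at hQ
      rw [sem, app_lamV (by rw [hf.src_eq]; exact seqEnv_coactSeqV hm hQ), coactSeqV_comp hm hf hQ]

theorem blocks_mem {y : ℕ} {q : List Tm} {k i j : ℕ} (h : j ∈ (blocks y k q).getD i []) :
    k ≤ j ∧ j < k + occBag y q := by
  induction q generalizing k i with
  | nil => simp [blocks] at h
  | cons t ts ih =>
    cases i with
    | zero => simp [blocks] at h; simp only [occBag]; omega
    | succ i =>
      simp only [blocks, List.getD_cons_succ] at h
      have := ih h
      simp only [occBag]; omega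

theorem muSeq_mem {y : ℕ} {f : List BMor} {q : List (List Tm)} {k j : ℕ} (h : j ∈ muSeq y k f q) :
    k ≤ j ∧ j < k + occSeq y q := by
  induction q generalizing k f with
  | nil => cases f <;> simp [muSeq] at h
  | cons t ts ih =>
    cases f with
    | nil => simp [muSeq] at h
    | cons g f =>
      simp only [muSeq, List.mem_append, List.mem_flatMap] at h
      simp only [occSeq]
      rcases h with ⟨e, _, h⟩ | h
      · have := blocks_mem h; omega
      · have := ih h; omega

/-- The `i`-th term of a bag is typed in the context of the entries whose positions make up the
`i`-th block. Here `π` and `r` are the parts of the context before and after the bag. -/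
theorem BagHasType.block {ξ q a} (h : BagHasType ξ q a) (π r : ℕ → List Ty) {i : ℕ}
    (hi : i < a.length) : HasType (fun y => sel (π y ++ (ξ y ++ r y))
      ((blocks y (π y).length q).getD i [])) (q.getD i default) (a.getD i default) := by
  induction q generalizing ξ a π i with
  | nil => cases h; simp at hi
  | cons t ts ih =>
    cases h with
    | @cons γ _ a δ _ as h1 h2 =>
      cases i with
      | zero =>
        simp only [List.getD_cons_zero, blocks, occ_eq h1, Ctx.tensor, List.append_assoc,
          sel_range']
        exact h1
      | succ i =>
        have := ih h2 (fun y => π y ++ γ y) (by simpa using hi)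
        simp only [List.length_append, List.append_assoc] at this
        simpa only [List.getD_cons_succ, blocks, occ_eq h1, Ctx.tensor, List.append_assoc] using this

/-- The `i`-th component of the denotation of a bag is that of its `i`-th term, in the environment
of the values at the positions in the `i`-th block. -/
theorem BagHasType.sem_block {ξ q a} (h : BagHasType ξ q a) (π r : ℕ → List Val) {i : ℕ}
    (hi : i < a.length) {ρ} (hρ : Env ξ ρ) : sem (q.getD i default) (fun y =>
      sel (π y ++ (ρ y ++ r y)) ((blocks y (π y).length q).getD i [])) =
      (semBag q ρ).getD i default := by
  induction q generalizing ξ a π i ρ with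
  | nil => cases h; simp at hi
  | cons t ts ih =>
    cases h with
    | @cons γ _ a δ _ as h1 h2 =>
      obtain ⟨ρ1, ρ2, rfl, e1, e2⟩ := hρ.split
      rw [semBag_append (fun x => by rw [e1.length, occ_eq h1])]
      cases i with
      | zero =>
        simp only [List.getD_cons_zero, blocks, occ_eq h1, List.append_assoc, ← e1.length,
          sel_range']
      | succ i =>
        have := ih h2 (fun y => π y ++ ρ1 y) (by simpa using hi) e2
        simp only [List.length_append, List.append_assoc] at this
        simpa only [List.getD_cons_succ, blocks, occ_eq h1, List.append_assoc, ← e1.length]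
          using this

theorem coactBag_hasType {ξ q a} (h : BagHasType ξ q a) (π r : ℕ → List Ty) {es b}
    (hf : EntriesIsHom a es b) : BagHasType (fun y => sel (π y ++ (ξ y ++ r y))
      (es.flatMap fun e => (blocks y (π y).length q).getD e.1 []))
      (es.map fun e => coact e.2 (q.getD e.1 default)) b := by
  induction es generalizing b with
  | nil => cases hf; exact .nil
  | cons e es ih =>
    cases hf with
    | @cons _ i m c d _ b h1 h2 h3 =>
      simp only [List.flatMap_cons, sel_append, List.map_cons]
      obtain ⟨h4, h5⟩ := List.getElem?_eq_some_iff.1 h1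
      have := h.block π r h4
      rw [List.getD_eq_getElem _ _ h4, h5] at this
      exact .cons (this.coact h2) (ih h3)

theorem semBag_coactBag {ξ q a} (h : BagHasType ξ q a) (π r : ℕ → List Val) {es b}
    (hf : EntriesIsHom a es b) {ρ} (hρ : Env ξ ρ) :
    semBag (es.map fun e => coact e.2 (q.getD e.1 default)) (fun y => sel (π y ++ (ρ y ++ r y))
      (es.flatMap fun e => (blocks y (π y).length q).getD e.1 [])) =
      coactEnt es (semBag q ρ) := by
  induction es generalizing b with
  | nil => rw [coactEnt]; rfl
  | cons e es ih =>
    cases hf with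
    | @cons _ i m c d _ b h1 h2 h3 =>
      simp only [List.flatMap_cons, sel_append, List.map_cons]
      obtain ⟨h4, h5⟩ := List.getElem?_eq_some_iff.1 h1
      have ht := h.block (fun y => (π y).map Sigma.fst) (fun y => (r y).map Sigma.fst) h4
      rw [List.getD_eq_getElem _ _ h4, h5] at ht
      have he : Env _ (fun y => sel (π y ++ (ρ y ++ r y)) ((blocks y (π y).length q).getD i [])) :=
        Env.sel (γ := fun y => (π y).map Sigma.fst ++ (ξ y ++ (r y).map Sigma.fst))
          (fun y => by simp [hρ y]) _
      simp only [List.length_map] at ht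
      rw [semBag_append (fun x => by rw [he.length, occ_eq (ht.coact h2)]),
        sem_coact ht h2 he, ih h3, coactEnt, h.sem_block π r h4 hρ]

theorem coactSeq_hasType_aux {ξ q a} (h : SeqHasType ξ q a) (π r : ℕ → List Ty) {f b}
    (hf : SeqIsHom f a b) : SeqHasType (fun y => sel (π y ++ (ξ y ++ r y))
      (muSeq y (π y).length f q)) (coactSeq f q) b := by
  induction q generalizing ξ a π f b with
  | nil => cases h; cases hf; exact .nil
  | cons q qs ih =>
    cases h with
    | @cons γ _ a δ _ as h1 h2 =>
      cases hf with
      | @cons g _ b f _ bs h3 h4 =>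
        have i1 := coactBag_hasType h1 π (fun y => δ y ++ r y) (BMor.isHom_iff.1 h3).2
        have i2 := ih h2 (fun y => π y ++ γ y) h4
        simp only [List.length_append, List.append_assoc, ← occBag_eq h1] at i2
        simp only [muSeq, sel_append, Ctx.tensor, List.append_assoc]
        exact .cons i1 i2

theorem semSeq_coactSeq_aux {ξ q a} (h : SeqHasType ξ q a) (π r : ℕ → List Val) {f b}
    (hf : SeqIsHom f a b) {ρ} (hρ : Env ξ ρ) :
    semSeq (coactSeq f q) (fun y => sel (π y ++ (ρ y ++ r y)) (muSeq y (π y).length f q)) =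
      coactSeqV f (semSeq q ρ) := by
  induction q generalizing ξ a π f b ρ with
  | nil => cases h; cases hf; simp [coactSeq, semSeq, coactSeqV]
  | cons q qs ih =>
    cases h with
    | @cons γ _ a δ _ as h1 h2 =>
      cases hf with
      | @cons g _ b f _ bs h3 h4 =>
        obtain ⟨ρ1, ρ2, rfl, e1, e2⟩ := hρ.split
        have hg := (BMor.isHom_iff.1 h3).2
        have i1 := semBag_coactBag h1 π (fun y => ρ2 y ++ r y) hg e1
        have t1 := coactBag_hasType h1 (fun y => (π y).map Sigma.fst) (fun _ => []) hg
        have i2 := ih h2 (fun y => π y ++ ρ1 y) h4 e2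
        have o1 := fun y => occBag_eq h1 y
        simp only [← e1.length] at o1
        simp only [List.length_append, List.append_assoc, ← o1] at i2
        simp only [muSeq, sel_append, List.append_assoc, coactSeq, List.zipWith_cons_cons]
        simp only [coactSeq] at i2
        rw [semSeq_append, semSeq_append (fun x => (o1 x).symm), coactSeqV_cons, i2]
        · congr 1
        · intro x
          have := occBag_eq t1 x
          simp only [length_sel, List.length_map] at this ⊢
          exact this.symm

/-- The covariant action on sequences of bags is well-typed. -/
theorem coactSeq_hasType {ξ q a} (h : SeqHasType ξ q a) {f b} (hf : SeqIsHom f a b) :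
    SeqHasType (fun y => sel (ξ y) (muSeq y 0 f q)) (coactSeq f q) b := by
  simpa using coactSeq_hasType_aux h (fun _ => []) (fun _ => []) hf

/-- The covariant action on sequences of bags denotes the action on values. -/
theorem semSeq_coactSeq {ξ q a} (h : SeqHasType ξ q a) {f b} (hf : SeqIsHom f a b) {ρ}
    (hρ : Env ξ ρ) : semSeq (coactSeq f q) (fun y => sel (ρ y) (muSeq y 0 f q)) =
      coactSeqV f (semSeq q ρ) := by
  simpa using semSeq_coactSeq_aux h (fun _ => []) (fun _ => []) hf hρ

theorem muSeq_lt {ξ q a} (h : SeqHasType ξ q a) {f : List BMor} {y j} (hj : j ∈ muSeq y 0 f q) :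
    j < (ξ y).length := by
  have := (muSeq_mem hj).2
  rwa [Nat.zero_add, occSeq_eq h] at this

theorem forall_coactSeq {P : Tm → Prop} (hP : ∀ m t, P t → P (coact m t)) {q : List (List Tm)}
    (h : ∀ b ∈ q, ∀ t ∈ b, P t) {ξ a} (hq : SeqHasType ξ q a) {f b} (hf : SeqIsHom f a b) :
    ∀ b ∈ coactSeq f q, ∀ t ∈ b, P t := by
  induction q generalizing ξ a f b with
  | nil => cases f <;> simp [coactSeq]
  | cons q qs ih =>
    cases hq with
    | @cons γ _ a δ _ as h1 h2 =>
      cases hf with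
      | @cons g _ b f _ bs h3 h4 =>
        simp only [List.mem_cons, forall_eq_or_imp] at h
        simp only [coactSeq, List.zipWith_cons_cons, List.mem_cons, forall_eq_or_imp]
        refine ⟨?_, ih h.2 h2 h4⟩
        simp only [coactBag, List.mem_map]
        rintro _ ⟨e, he, rfl⟩
        refine hP _ _ (h.1 _ ?_)
        have := (BMor.isHom_iff.1 h3).2.lt he
        rw [← h1.length] at this
        rw [List.getD_eq_getElem _ _ this]
        exact List.getElem_mem _

/-! ### The contravariant action -/

/-- The context that consists of the entries of `δ` at the positions `α`. -/
def Ctx.sel (δ : Ctx) (α : ℕ → List ℕ) : Ctx := fun x => ResourceCalculus.sel (δ x) (α x)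

/-- The entries `θ` form a morphism of contexts from `δ` to `γ`. -/
def EntCtx (δ : Ctx) (θ : ℕ → List (ℕ × Mor)) (γ : Ctx) : Prop :=
  ∀ x, EntriesIsHom (δ x) (θ x) (γ x)

theorem Ctx.cons_lt {b : List (List Ty)} {γ : Ctx} {x : ℕ} (h : x < b.length) :
    Ctx.cons b γ x = b[x] := ext_lt b γ h

theorem EntCtx.split {δ γ γ' : Ctx} {θ} (h : EntCtx δ θ (γ.tensor γ')) :
    ∃ θ1 θ2, θ = (fun x => θ1 x ++ θ2 x) ∧ EntCtx δ θ1 γ ∧ EntCtx δ θ2 γ' :=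
  ⟨fun x => (θ x).take (γ x).length, fun x => (θ x).drop (γ x).length, by funext x; simp,
    fun x => (h x).take, fun x => (h x).drop⟩

theorem EntCtx.length {δ γ : Ctx} {θ} (h : EntCtx δ θ γ) (x) : (θ x).length = (γ x).length :=
  (h x).length

theorem EntCtx.var_split {δ γ : Ctx} {x a θ} (h : EntCtx δ θ ((Ctx.single x (.arr a)).tensor γ)) :
    ∃ i f c θ', θ = (fun y => (if y = x then [(i, .arr f)] else []) ++ θ' y) ∧
      (δ x)[i]? = some (.arr c) ∧ SeqIsHom f a c ∧ EntCtx δ θ' γ := by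
  obtain ⟨θ1, θ2, rfl, h1, h2⟩ := h.split
  have hx := h1 x
  simp only [Ctx.single, ↓reduceIte] at hx
  generalize hθ : θ1 x = es at hx
  cases hx with
  | @cons _ i m c _ es _ hi hm hn =>
    cases hn
    cases hm with
    | @arr f c _ hm =>
      refine ⟨i, f, c, θ2, ?_, hi, hm, h2⟩
      funext y
      by_cases hy : y = x
      · subst hy; simp [hθ]
      · have := (h1 y).length
        simp only [Ctx.single, hy, ↓reduceIte, List.length_nil, List.length_eq_zero_iff] at this
        simp [hy, this]

theorem EntCtx.ext {δ γ : Ctx} {θ f a b} (h : EntCtx δ θ γ) (hf : SeqIsHom f a b) :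
    EntCtx (.cons a δ) (ext (f.map Prod.snd) θ) (.cons b γ) := by
  have h1 := hf.length_src
  have h2 := hf.length_tgt
  refine ext_cases f.length (fun x hx => ?_) (fun x => ?_)
  · rw [Ctx.cons_lt (h1 ▸ hx), Ctx.cons_lt (h2 ▸ hx), ext_lt _ _ (by simpa using hx)]
    obtain ⟨h3, h4⟩ := seqIsHom_iff.1 hf
    subst h3
    simpa using h4.get (i := x) hx (h2 ▸ hx)
  · rw [ext_add' _ _ _ _ (by simp)]
    conv in (occs := 1) x + f.length => rw [h1]
    conv in (occs := 1) x + f.length => rw [h2]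
    rw [Ctx.cons_add, Ctx.cons_add]
    exact h x

theorem map_idEntries_tgt {f a b} (hf : SeqIsHom f a b) :
    (f.map fun g => idEntries 0 g.tgt) = (idSeq b).map Prod.snd := by
  rw [← hf.tgt_eq, idSeq_eq_map, List.map_map, List.map_map]
  rfl

theorem act_var_cons {x q i f} {θ : ℕ → List (ℕ × Mor)} :
    act (.var x q) (fun y => (if y = x then [(i, .arr f)] else []) ++ θ y) =
      (.var x (coactSeq f (actSeq q θ).1), fun y => (if y = x then [i] else []) ++
        sel ((actSeq q θ).2 y) (muSeq y 0 f (actSeq q θ).1)) := by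
  have : Function.update (fun y => (if y = x then [(i, .arr f)] else []) ++ θ y) x (θ x) = θ := by
    funext y
    by_cases h : y = x
    · subst h; simp
    · simp [h]
  rw [act]
  simp only [↓reduceIte, List.singleton_append, this]
  rfl

theorem actBag_append {t ts} {θ1 θ2 : ℕ → List (ℕ × Mor)} (h : ∀ x, (θ1 x).length = occ x t) :
    actBag (t :: ts) (fun x => θ1 x ++ θ2 x) = ((act t θ1).1 :: (actBag ts θ2).1,
      fun x => (act t θ1).2 x ++ (actBag ts θ2).2 x) := by
  simp [actBag, ← h]

theorem actSeq_append {q qs} {θ1 θ2 : ℕ → List (ℕ × Mor)} (h : ∀ x, (θ1 x).length = occBag x q) :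
    actSeq (q :: qs) (fun x => θ1 x ++ θ2 x) = ((actBag q θ1).1 :: (actSeq qs θ2).1,
      fun x => (actBag q θ1).2 x ++ (actSeq qs θ2).2 x) := by
  simp [actSeq, ← h]

theorem act_redex_append {f s q} {θ1 θ2 : ℕ → List (ℕ × Mor)}
    (h : ∀ x, (θ1 x).length = occ (x + f.length) s) :
    ∃ f' s' ν, act (.lam f s) θ1 = (.lam f' s', ν) ∧ act (.redex f s q) (fun x => θ1 x ++ θ2 x) =
      (.redex f' s' (actSeq q θ2).1, fun x => ν x ++ (actSeq q θ2).2 x) := by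
  refine ⟨_, _, _, by rw [act], ?_⟩
  simp [act, ← h]

/-- Extension commutes with the selection of positions. -/
theorem ext_mapIdx_sel {A : Type} [Inhabited A] (l : List (List A)) (g : ℕ → List A)
    (ν : ℕ → List ℕ) (n : ℕ) (hn : l.length = n) :
    ext (l.mapIdx fun k c => sel c (ν k)) (fun x => sel (g x) (ν (x + n))) =
      fun x => sel (ext l g x) (ν x) := by
  subst hn
  funext x
  refine ext_cases (P := fun x => _ = sel (ext l g x) (ν x)) l.length (fun x hx => ?_)
    (fun x => ?_) x
  · rw [ext_lt _ _ hx, ext_lt _ _ (by simpa using hx), List.getElem_mapIdx]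
  · rw [ext_add, ext_add' _ _ _ _ (by simp)]

theorem Ctx.sel_cons (b : List (List Ty)) (δ : Ctx) (ν : ℕ → List ℕ) (n : ℕ) (hn : b.length = n) :
    (Ctx.cons b δ).sel ν = .cons (b.mapIdx fun k c => ResourceCalculus.sel c (ν k))
      (δ.sel fun x => ν (x + n)) := (ext_mapIdx_sel b δ ν n hn).symm

theorem reindexSeq_isHom {f a b} (hf : SeqIsHom f a b) {ν : ℕ → List ℕ}
    (hν : ∀ k (_ : k < b.length), ∀ i ∈ ν k, i < b[k].length) :
    SeqIsHom (reindexSeq ν f) a (b.mapIdx fun k c => sel c (ν k)) := by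
  induction f generalizing a b ν with
  | nil => cases hf; exact .nil
  | cons g f ih =>
    cases hf with
    | cons h1 h2 =>
      rw [reindexSeq, List.mapIdx_cons, List.mapIdx_cons]
      exact .cons (reindex_isHom h1 (hν 0 (by simp)))
        (ih h2 (ν := fun k => ν (k + 1)) fun k hk => hν (k + 1) (by simpa using hk))

theorem reindexSeq_map_fst (ν : ℕ → List ℕ) (f : List BMor) :
    (reindexSeq ν f).map Prod.fst = f.map Prod.fst := by
  induction f generalizing ν with
  | nil => rfl
  | cons g f ih =>
    have := ih fun k => ν (k + 1)
    rw [reindexSeq] at this ⊢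
    rw [List.mapIdx_cons, List.map_cons, List.map_cons, this]; rfl

theorem coactSeqV_reindexSeq {f a b} (hf : SeqIsHom f a b) {ν : ℕ → List ℕ}
    (hν : ∀ k (_ : k < b.length), ∀ i ∈ ν k, i < b[k].length) {Q : List (List Val)}
    (hQ : SeqEnv a Q) :
    coactSeqV (reindexSeq ν f) Q = (coactSeqV f Q).mapIdx fun k c => sel c (ν k) := by
  induction f generalizing a b ν Q with
  | nil => simp [reindexSeq, coactSeqV]
  | cons g f ih =>
    cases hf with
    | cons h1 h2 =>
      cases Q with
      | nil => simp [SeqEnv] at hQ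
      | cons q Q =>
        simp only [SeqEnv, List.map_cons, List.cons.injEq] at hQ
        have := ih h2 (ν := fun k => ν (k + 1)) (fun k hk => hν (k + 1) (by simpa using hk)) hQ.2
        rw [reindexSeq] at this ⊢
        rw [List.mapIdx_cons, coactSeqV_cons, coactSeqV_cons, List.mapIdx_cons, this]
        congr 1
        refine coactEnt_reindex (fun i hi => ?_) q
        rw [(BMor.isHom_iff.1 h1).2.length]
        exact hν 0 (by simp) i hi

theorem length_coactSeqV {f a b} (hf : SeqIsHom f a b) {Q : List (List Val)} (hQ : SeqEnv a Q) :
    (coactSeqV f Q).length = b.length := by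
  have := seqEnv_coactSeqV hf hQ
  rw [← this, List.length_map]

theorem coactEnt_ext {f a b} (hf : SeqIsHom f a b) (θ : ℕ → List (ℕ × Mor)) {Q : List (List Val)}
    (hQ : SeqEnv a Q) (ρ : ℕ → List Val) :
    (fun x => coactEnt (ext (f.map Prod.snd) θ x) (ext Q ρ x)) =
      ext (coactSeqV f Q) fun x => coactEnt (θ x) (ρ x) := by
  have h1 : f.length = Q.length := by rw [hf.length_src, ← hQ, List.length_map]
  have h2 : f.length = (coactSeqV f Q).length := by rw [length_coactSeqV hf hQ, hf.length_tgt]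
  funext x
  refine ext_cases (P := fun x => coactEnt (ext (f.map Prod.snd) θ x) (ext Q ρ x) =
    ext (coactSeqV f Q) (fun x => coactEnt (θ x) (ρ x)) x) f.length (fun x hx => ?_)
    (fun x => ?_) x
  · rw [ext_lt _ _ (by simpa using hx), ext_lt _ _ (h1 ▸ hx), ext_lt _ _ (h2 ▸ hx)]
    simp [coactSeqV_eq_zipWith]
  · rw [ext_add' _ _ _ _ (by simp), ext_add' _ _ _ _ h1.symm, ext_add' _ _ _ _ h2.symm]

/-- The properties of the action of `θ` on a term: it is well-typed; its denotation at an
environment `ρ`, restricted along the resulting ground morphism, is that of the original term at the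
image of `ρ`; and it creates no redexes. -/
structure ActTm (δ : Ctx) (θ : ℕ → List (ℕ × Mor)) (s : Tm) (a : Ty) : Prop where
  typed : HasType (δ.sel (act s θ).2) (act s θ).1 a
  lt : ∀ x, ∀ i ∈ (act s θ).2 x, i < (δ x).length
  sem_eq : ∀ ρ, Env δ ρ → sem (act s θ).1 (fun x => sel (ρ x) ((act s θ).2 x)) =
    sem s (fun x => coactEnt (θ x) (ρ x))
  deg : ∀ d, Deg d s → Deg d (act s θ).1
  rf : ∀ n, RF n s → RF n (act s θ).1

/-- The properties of the action on a bag. -/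
structure ActBag (δ : Ctx) (θ : ℕ → List (ℕ × Mor)) (q : List Tm) (a : List Ty) : Prop where
  typed : BagHasType (δ.sel (actBag q θ).2) (actBag q θ).1 a
  lt : ∀ x, ∀ i ∈ (actBag q θ).2 x, i < (δ x).length
  sem_eq : ∀ ρ, Env δ ρ → semBag (actBag q θ).1 (fun x => sel (ρ x) ((actBag q θ).2 x)) =
    semBag q (fun x => coactEnt (θ x) (ρ x))
  deg : ∀ d, (∀ t ∈ q, Deg d t) → ∀ t ∈ (actBag q θ).1, Deg d t
  rf : ∀ n, (∀ t ∈ q, RF n t) → ∀ t ∈ (actBag q θ).1, RF n t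

/-- The properties of the action on a sequence of bags. -/
structure ActSeq (δ : Ctx) (θ : ℕ → List (ℕ × Mor)) (q : List (List Tm)) (a : List (List Ty)) :
    Prop where
  typed : SeqHasType (δ.sel (actSeq q θ).2) (actSeq q θ).1 a
  lt : ∀ x, ∀ i ∈ (actSeq q θ).2 x, i < (δ x).length
  sem_eq : ∀ ρ, Env δ ρ → semSeq (actSeq q θ).1 (fun x => sel (ρ x) ((actSeq q θ).2 x)) =
    semSeq q (fun x => coactEnt (θ x) (ρ x))
  deg : ∀ d, (∀ b ∈ q, ∀ t ∈ b, Deg d t) → ∀ b ∈ (actSeq q θ).1, ∀ t ∈ b, Deg d t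
  rf : ∀ n, (∀ b ∈ q, ∀ t ∈ b, RF n t) → ∀ b ∈ (actSeq q θ).1, ∀ t ∈ b, RF n t

theorem Ctx.sel_append (δ : Ctx) (α β : ℕ → List ℕ) :
    δ.sel (fun x => α x ++ β x) = (δ.sel α).tensor (δ.sel β) := by
  funext x; exact ResourceCalculus.sel_append _ _ _

theorem ActTm.length {δ θ s a} (h : ActTm δ θ s a) {A : Type*} [Inhabited A] (l : List A) (x : ℕ) :
    (sel l ((act s θ).2 x)).length = occ x (act s θ).1 := by
  rw [occ_eq h.typed, length_sel, Ctx.sel, length_sel]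

theorem ActBag.length {δ θ s a} (h : ActBag δ θ s a) {A : Type*} [Inhabited A] (l : List A) (x : ℕ) :
    (sel l ((actBag s θ).2 x)).length = occBag x (actBag s θ).1 := by
  rw [occBag_eq h.typed, length_sel, Ctx.sel, length_sel]

theorem Env.lt_cons {b : List (List Ty)} {δ : Ctx} {ν : ℕ → List ℕ}
    (h : ∀ x, ∀ i ∈ ν x, i < (Ctx.cons b δ x).length) :
    (∀ k (_ : k < b.length), ∀ i ∈ ν k, i < b[k].length) ∧
    (∀ x, ∀ i ∈ ν (x + b.length), i < (δ x).length) :=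
  ⟨fun k hk i hi => by simpa [Ctx.cons_lt hk] using h k i hi,
    fun x i hi => by simpa [Ctx.cons_add] using h _ i hi⟩

theorem Deg.var_iff {d x q} : Deg d (.var x q) ↔ ∀ b ∈ q, ∀ t ∈ b, Deg d t :=
  ⟨fun h => by cases h; assumption, .var⟩

theorem Deg.lam_iff {d f s} : Deg d (.lam f s) ↔ Deg d s :=
  ⟨fun h => by cases h; assumption, .lam⟩

/-- At an occurrence of a variable, the component of `θ` acts covariantly on the arguments. -/
theorem act_ok_var {γ : Ctx} {x q a} (ih : ∀ δ θ, EntCtx δ θ γ → ActSeq δ θ q a) {δ θ}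
    (hθ : EntCtx δ θ ((Ctx.single x (.arr a)).tensor γ)) : ActTm δ θ (.var x q) .o := by
  obtain ⟨i, f, c, θ, rfl, hi, hf, hθ⟩ := hθ.var_split
  have IH := ih δ θ hθ
  have hlt : ∀ y, ∀ j ∈ muSeq y 0 f (actSeq q θ).1, j < ((actSeq q θ).2 y).length := by
    intro y j hj
    simpa [Ctx.sel] using muSeq_lt IH.typed hj
  have hi' := List.getElem?_eq_some_iff.1 hi
  constructor
  · rw [act_var_cons, Ctx.sel_append]
    have e1 : δ.sel (fun y => if y = x then [i] else []) = Ctx.single x (.arr c) := by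
      funext y
      by_cases h : y = x
      · subst h; simp [Ctx.sel, Ctx.single, sel, hi]
      · simp [Ctx.sel, Ctx.single, sel, h]
    have e2 : (δ.sel fun y => sel ((actSeq q θ).2 y) (muSeq y 0 f (actSeq q θ).1)) =
        fun y => sel (δ.sel (actSeq q θ).2 y) (muSeq y 0 f (actSeq q θ).1) := by
      funext y
      exact (sel_sel _ _ (hlt y)).symm
    rw [e1, e2]
    exact .var (coactSeq_hasType IH.typed hf)
  · rw [act_var_cons]
    intro y j hj
    rcases List.mem_append.1 hj with hj | hj
    · by_cases h : y = x
      · subst h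
        simp at hj
        subst hj
        exact hi'.1
      · simp [h] at hj
    · exact IH.lt y j (mem_sel (hlt y) hj)
  · intro ρ hρ
    rw [act_var_cons]
    have e1 : (fun y => sel (ρ y) ((if y = x then [i] else []) ++
        sel ((actSeq q θ).2 y) (muSeq y 0 f (actSeq q θ).1))) =
        (fun y => (if y = x then [(ρ x).getD i default] else []) ++
          sel (sel (ρ y) ((actSeq q θ).2 y)) (muSeq y 0 f (actSeq q θ).1)) := by
      funext y
      rw [sel_append, sel_sel _ _ (hlt y)]
      by_cases h : y = x
      · subst h; simp [sel]
      · simp [h]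
    have e2 : (fun y => coactEnt ((if y = x then [(i, Mor.arr f)] else []) ++ θ y) (ρ y)) =
        (fun y => (if y = x then [coactV (.arr f) ((ρ x).getD i default)] else []) ++
          coactEnt (θ y) (ρ y)) := by
      funext y
      rw [coactEnt_append]
      by_cases h : y = x
      · subst h; simp [coactEnt]
      · simp [h, coactEnt]
    have hq := IH.sem_eq ρ hρ
    have hE := semSeq_seqEnv IH.typed (Env.sel hρ (actSeq q θ).2)
    rw [e1, e2, sem_var_cons, sem_var_cons, semSeq_coactSeq IH.typed hf (Env.sel hρ _), hq,
      app_coactV]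
    rw [hf.src_eq, ← hq]
    exact hE
  · intro d h
    rw [Deg.var_iff] at h
    rw [act_var_cons, Deg.var_iff]
    exact forall_coactSeq (fun m t h => h.coact m) (IH.deg d h) IH.typed hf
  · intro n h
    cases n with
    | zero => exact h.elim
    | succ n =>
      rw [act_var_cons]
      exact forall_coactSeq (fun m t h => h.coact m) (IH.rf n h) IH.typed hf

theorem act_ok_lam {γ : Ctx} {f s a b} (hne : f ≠ []) (hf : SeqIsHom f a b)
    (ih : ∀ δ θ, EntCtx δ θ (.cons b γ) → ActTm δ θ s .o) {δ θ}
    (hθ : EntCtx δ θ γ) : ActTm δ θ (.lam f s) (.arr a) := by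
  have IH := ih _ _ (hθ.ext (idSeq_isHom b))
  rw [← map_idEntries_tgt hf] at IH
  obtain ⟨l1, l2⟩ := Env.lt_cons IH.lt
  have hb := hf.length_tgt
  constructor
  · rw [act]
    refine .lam (fun h => ?_) (reindexSeq_isHom hf l1) ?_
    · have := congrArg List.length h
      rw [reindexSeq, List.length_mapIdx] at this
      exact hne (List.length_eq_zero_iff.1 this)
    · have := IH.typed
      rwa [Ctx.sel_cons _ _ _ _ hb.symm] at this
  · rw [act]
    simpa only [hb] using l2
  · intro ρ hρ
    rw [act, sem, sem, reindexSeq_map_fst]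
    refine lamV_congr fun Q hQ => ?_
    rw [hf.src_eq] at hQ
    have hQ' := seqEnv_coactSeqV hf hQ
    rw [coactSeqV_reindexSeq hf l1 hQ, ext_mapIdx_sel _ _ _ _
      ((length_coactSeqV hf hQ).trans hb.symm), IH.sem_eq _ (hρ.ext hQ'),
      map_idEntries_tgt hf, coactEnt_ext (idSeq_isHom b) θ hQ' ρ, coactSeqV_id b hQ']
  · intro d h
    rw [Deg.lam_iff] at h
    rw [act]
    exact .lam (IH.deg d h)
  · intro n h
    cases n with
    | zero => exact h.elim
    | succ n => rw [act]; exact IH.rf n h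

theorem length_coactEnt (es : List (ℕ × Mor)) (q) : (coactEnt es q).length = es.length := by
  rw [coactEnt_eq_map, List.length_map]

theorem act_ok_redex {γ γ' : Ctx} {f s q a} (ht : HasType γ (.lam f s) (.arr a))
    (ih : ∀ δ θ, EntCtx δ θ γ → ActTm δ θ (.lam f s) (.arr a))
    (ihq : ∀ δ θ, EntCtx δ θ γ' → ActSeq δ θ q a) {δ θ}
    (hθ : EntCtx δ θ (γ.tensor γ')) : ActTm δ θ (.redex f s q) .o := by
  obtain ⟨θ1, θ2, rfl, h1, h2⟩ := hθ.split
  have I1 := ih _ _ h1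
  have I2 := ihq _ _ h2
  obtain ⟨f', s', ν, e1, e2⟩ := act_redex_append (f := f) (s := s) (q := q) (θ1 := θ1) (θ2 := θ2)
    (fun x => by rw [h1.length, occ_body_eq ht])
  have T1 := I1.typed
  rw [e1] at T1
  constructor
  · rw [e2, Ctx.sel_append]
    exact .redex T1 I2.typed
  · have := I1.lt
    rw [e1] at this
    rw [e2]
    intro x i hi
    rcases List.mem_append.1 hi with hi | hi
    exacts [this x i hi, I2.lt x i hi]
  · intro ρ hρ
    have i1 := I1.sem_eq ρ hρ
    rw [e1] at i1
    rw [e2]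
    simp only [sel_append, coactEnt_append]
    rw [sem_redex_append, sem_redex_append, i1, I2.sem_eq ρ hρ]
    · intro x
      rw [length_coactEnt, h1.length, occ_body_eq ht]
    · intro x
      rw [occ_body_eq T1]
      simp [Ctx.sel]
  · intro d h
    have := I1.deg d
    rw [e1] at this
    rw [e2]
    cases h with
    | redex d1 d2 d3 =>
      have h3 : f'.map Prod.fst = f.map Prod.fst := by
        have := congrArg Prod.fst e1
        rw [act] at this
        simp only [Tm.lam.injEq] at this
        rw [← this.1, reindexSeq_map_fst]
      exact .redex (h3 ▸ d1) (Deg.lam_iff.1 (this (.lam d2))) (I2.deg d d3)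
  · intro n h
    cases n <;> exact h.elim


mutual
/-- The action is well-typed, and it denotes the composition with the denotation of morphisms. -/
theorem act_ok : ∀ {γ s a}, HasType γ s a → ∀ δ θ, EntCtx δ θ γ → ActTm δ θ s a
  | _, _, _, .var h, _, _, hθ => act_ok_var (actSeq_ok h) hθ
  | _, _, _, .lam hne hf h, _, _, hθ => act_ok_lam hne hf (act_ok h) hθ
  | _, _, _, .redex h hq, _, _, hθ => act_ok_redex h (act_ok h) (actSeq_ok hq) hθ
theorem actBag_ok : ∀ {γ q a}, BagHasType γ q a → ∀ δ θ, EntCtx δ θ γ → ActBag δ θ q a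
  | _, _, _, .nil, _, _, _ => ⟨.nil, fun _ _ h => by simp [actBag] at h, fun _ _ => rfl,
      fun _ _ _ h => by simp [actBag] at h, fun _ _ _ h => by simp [actBag] at h⟩
  | _, _, _, .cons h h', δ, θ, hθ => by
    obtain ⟨θ1, θ2, rfl, h1, h2⟩ := hθ.split
    have I1 := act_ok h δ θ1 h1
    have I2 := actBag_ok h' δ θ2 h2
    have e := fun ts => actBag_append (ts := ts) (θ2 := θ2) (fun x => by rw [h1.length, occ_eq h])
    constructor
    · rw [e, Ctx.sel_append]; exact .cons I1.typed I2.typed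
    · rw [e]
      intro x i hi
      rcases List.mem_append.1 hi with hi | hi
      exacts [I1.lt x i hi, I2.lt x i hi]
    · intro ρ hρ
      simp only [e, sel_append, coactEnt_append]
      rw [semBag_append (ρ1 := fun x => sel (ρ x) ((act _ θ1).2 x)) (fun x => I1.length _ x),
        semBag_append, I1.sem_eq ρ hρ, I2.sem_eq ρ hρ]
      intro x
      rw [length_coactEnt, h1.length, occ_eq h]
    · intro d hd
      rw [e]
      simp only [List.mem_cons, forall_eq_or_imp] at hd ⊢
      exact ⟨I1.deg d hd.1, I2.deg d hd.2⟩
    · intro d hd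
      rw [e]
      simp only [List.mem_cons, forall_eq_or_imp] at hd ⊢
      exact ⟨I1.rf d hd.1, I2.rf d hd.2⟩
theorem actSeq_ok : ∀ {γ q a}, SeqHasType γ q a → ∀ δ θ, EntCtx δ θ γ → ActSeq δ θ q a
  | _, _, _, .nil, _, _, _ => ⟨.nil, fun _ _ h => by simp [actSeq] at h, fun _ _ => rfl,
      fun _ _ _ h => by simp [actSeq] at h, fun _ _ _ h => by simp [actSeq] at h⟩
  | _, _, _, .cons h h', δ, θ, hθ => by
    obtain ⟨θ1, θ2, rfl, h1, h2⟩ := hθ.split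
    have I1 := actBag_ok h δ θ1 h1
    have I2 := actSeq_ok h' δ θ2 h2
    have e := fun ts => actSeq_append (qs := ts) (θ2 := θ2) (fun x => by rw [h1.length, occBag_eq h])
    constructor
    · rw [e, Ctx.sel_append]; exact .cons I1.typed I2.typed
    · rw [e]
      intro x i hi
      rcases List.mem_append.1 hi with hi | hi
      exacts [I1.lt x i hi, I2.lt x i hi]
    · intro ρ hρ
      simp only [e, sel_append, coactEnt_append]
      rw [semSeq_append (ρ1 := fun x => sel (ρ x) ((actBag _ θ1).2 x)) (fun x => I1.length _ x),
        semSeq_append, I1.sem_eq ρ hρ, I2.sem_eq ρ hρ]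
      intro x
      rw [length_coactEnt, h1.length, occBag_eq h]
    · intro d hd
      rw [e]
      simp only [List.mem_cons, forall_eq_or_imp] at hd ⊢
      exact ⟨I1.deg d hd.1, I2.deg d hd.2⟩
    · intro d hd
      rw [e]
      simp only [List.mem_cons, forall_eq_or_imp] at hd ⊢
      exact ⟨I1.rf d hd.1, I2.rf d hd.2⟩
end

/-! ### Lifting -/

/-- The renaming of variables that underlies `lift c d`. -/
def shiftVar (c d y : ℕ) : ℕ := if y < c then y else y + d

theorem shiftVar_add (c d m y : ℕ) : shiftVar (c + m) d (y + m) = shiftVar c d y + m := by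
  simp only [shiftVar]; split <;> split <;> omega

theorem shiftVar_inj {c d x y : ℕ} : shiftVar c d x = shiftVar c d y ↔ x = y := by
  simp only [shiftVar]; split <;> split <;> omega

mutual
theorem occ_lift (d : ℕ) : ∀ (s : Tm) (c y : ℕ), occ (shiftVar c d y) (lift c d s) = occ y s
  | .var x q, c, y => by
    have := shiftVar_inj (c := c) (d := d) (x := y) (y := x)
    rw [lift, occ, occ, occSeq_lift d q]
    congr 1
    by_cases h : y = x
    · subst h; simp [shiftVar]
    · rw [if_neg h, if_neg]
      rwa [← this] at h
  | .lam f s, c, y => by rw [lift, occ, occ, ← shiftVar_add, occ_lift d s]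
  | .redex f s q, c, y => by
    rw [lift, occ, occ, ← shiftVar_add, occ_lift d s, occSeq_lift d q]
theorem occBag_lift (d : ℕ) : ∀ (q : List Tm) (c y : ℕ),
    occBag (shiftVar c d y) (liftBag c d q) = occBag y q
  | [], _, _ => rfl
  | t :: ts, c, y => by rw [liftBag, occBag, occBag, occ_lift d t, occBag_lift d ts]
theorem occSeq_lift (d : ℕ) : ∀ (q : List (List Tm)) (c y : ℕ),
    occSeq (shiftVar c d y) (liftSeq c d q) = occSeq y q
  | [], _, _ => rfl
  | t :: ts, c, y => by rw [liftSeq, occSeq, occSeq, occBag_lift d t, occSeq_lift d ts]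
end

theorem ext_shiftVar {A : Type} (l : List A) (g : ℕ → A) (c d n : ℕ) (hn : l.length = n) :
    (fun y => ext l g (shiftVar (c + n) d y)) = ext l fun y => g (shiftVar c d y) := by
  subst hn
  funext y
  refine ext_cases (P := fun y => ext l g (shiftVar (c + l.length) d y) =
    ext l (fun y => g (shiftVar c d y)) y) l.length (fun y hy => ?_) (fun y => ?_) y
  · have : shiftVar (c + l.length) d y = y := by simp only [shiftVar]; split <;> omega
    rw [this, ext_lt _ _ hy, ext_lt _ _ hy]
  · rw [shiftVar_add, ext_add, ext_add]

theorem length_coactSeqV' {f : List BMor} {Q : List (List Val)} (h : SeqEnv (f.map Prod.fst) Q) :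
    (coactSeqV f Q).length = f.length := by
  have := congrArg List.length h
  rw [coactSeqV_eq_zipWith, List.length_zipWith]
  simp at this
  omega

mutual
theorem sem_lift (d : ℕ) : ∀ (s : Tm) (c : ℕ) (ρ : ℕ → List Val),
    sem (lift c d s) ρ = sem s fun y => ρ (shiftVar c d y)
  | .var x q, c, ρ => by
    rw [lift, sem, sem]
    change (match ρ (shiftVar c d x) with
      | v :: r => base (app v (semSeq (liftSeq c d q) (Function.update ρ (shiftVar c d x) r)))
      | [] => default) = _
    cases ρ (shiftVar c d x) with
    | nil => rfl
    | cons v r =>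
      simp only
      rw [semSeq_lift d q]
      congr 3
      funext y
      by_cases h : y = x
      · subst h; simp
      · have h' := h
        rw [← shiftVar_inj (c := c) (d := d)] at h'
        simp [h, h']
  | .lam f s, c, ρ => by
    rw [lift, sem, sem]
    refine lamV_congr fun Q hQ => ?_
    rw [sem_lift d s, ext_shiftVar _ _ _ _ _ (length_coactSeqV' hQ)]
  | .redex f s q, c, ρ => by
    rw [lift, sem, sem, semSeq_lift d q]
    simp only [← shiftVar_add, occ_lift]
    congr 2
    refine lamV_congr fun Q hQ => ?_
    rw [sem_lift d s, ext_shiftVar _ _ _ _ _ (length_coactSeqV' hQ)]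
    simp only [← shiftVar_add, occ_lift]
theorem semBag_lift (d : ℕ) : ∀ (s : List Tm) (c : ℕ) (ρ : ℕ → List Val),
    semBag (liftBag c d s) ρ = semBag s fun y => ρ (shiftVar c d y)
  | [], _, _ => rfl
  | t :: ts, c, ρ => by
    rw [liftBag, semBag, semBag, sem_lift d t, semBag_lift d ts]
    simp only [occ_lift]
theorem semSeq_lift (d : ℕ) : ∀ (s : List (List Tm)) (c : ℕ) (ρ : ℕ → List Val),
    semSeq (liftSeq c d s) ρ = semSeq s fun y => ρ (shiftVar c d y)
  | [], _, _ => rfl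
  | t :: ts, c, ρ => by
    rw [liftSeq, semSeq, semSeq, semBag_lift d t, semSeq_lift d ts]
    simp only [occBag_lift]
end

/-- The context of a lifted term. -/
def Ctx.lift (c d : ℕ) (γ : Ctx) : Ctx :=
  fun y => if y < c then γ y else if y < c + d then [] else γ (y - d)

theorem Ctx.lift_tensor (c d : ℕ) (γ δ : Ctx) :
    (γ.tensor δ).lift c d = (γ.lift c d).tensor (δ.lift c d) := by
  funext y; simp only [Ctx.lift, Ctx.tensor]; split_ifs <;> rfl

theorem Ctx.lift_empty (c d : ℕ) : Ctx.empty.lift c d = Ctx.empty := by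
  funext y; simp only [Ctx.lift, Ctx.empty]; split_ifs <;> rfl

theorem Ctx.lift_single (c d x : ℕ) (a) :
    (Ctx.single x a).lift c d = Ctx.single (shiftVar c d x) a := by
  funext y; simp only [Ctx.lift, Ctx.single, shiftVar]; split_ifs <;> first | rfl | omega

theorem Ctx.lift_cons (c d : ℕ) (b) (γ : Ctx) (n : ℕ) (hn : b.length = n) :
    (Ctx.cons b γ).lift (c + n) d = Ctx.cons b (γ.lift c d) := by
  subst hn
  funext y
  refine ext_cases (P := fun y => (Ctx.cons b γ).lift (c + b.length) d y =
    Ctx.cons b (γ.lift c d) y) b.length (fun y hy => ?_) (fun y => ?_) y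
  · rw [Ctx.cons_lt hy, Ctx.lift, if_pos (by omega), Ctx.cons_lt hy]
  · rw [Ctx.cons_add, Ctx.lift, Ctx.lift]
    rcases lt_or_ge y c with h | h
    · rw [if_pos (by omega), if_pos h, Ctx.cons_add]
    · rw [if_neg (show ¬ y + b.length < c + b.length by omega), if_neg (not_lt.2 h)]
      rcases lt_or_ge y (c + d) with h' | h'
      · rw [if_pos (by omega), if_pos h']
      · rw [if_neg (by omega), if_neg (by omega), show y + b.length - d = (y - d) + b.length by omega, Ctx.cons_add]

mutual
/-- Lifting is well-typed. -/
theorem HasType.lift (d : ℕ) : ∀ {γ s a}, HasType γ s a → ∀ c,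
    HasType (γ.lift c d) (lift c d s) a
  | _, _, _, .var h, c => by
    rw [ResourceCalculus.lift, Ctx.lift_tensor, Ctx.lift_single]
    exact .var (SeqHasType.lift d h c)
  | _, _, _, .lam hne hf h, c => by
    rw [ResourceCalculus.lift]
    refine .lam hne hf ?_
    rw [← Ctx.lift_cons _ _ _ _ _ hf.length_tgt.symm]
    exact HasType.lift d h _
  | _, _, _, .redex h hq, c => by
    rw [ResourceCalculus.lift, Ctx.lift_tensor]
    have := HasType.lift d h c
    rw [ResourceCalculus.lift] at this
    exact .redex this (SeqHasType.lift d hq c)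
theorem BagHasType.lift (d : ℕ) : ∀ {γ s a}, BagHasType γ s a → ∀ c,
    BagHasType (γ.lift c d) (liftBag c d s) a
  | _, _, _, .nil, c => by rw [liftBag, Ctx.lift_empty]; exact .nil
  | _, _, _, .cons h h', c => by
    rw [liftBag, Ctx.lift_tensor]
    exact .cons (HasType.lift d h c) (BagHasType.lift d h' c)
theorem SeqHasType.lift (d : ℕ) : ∀ {γ s a}, SeqHasType γ s a → ∀ c,
    SeqHasType (γ.lift c d) (liftSeq c d s) a
  | _, _, _, .nil, c => by rw [liftSeq, Ctx.lift_empty]; exact .nil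
  | _, _, _, .cons h h', c => by
    rw [liftSeq, Ctx.lift_tensor]
    exact .cons (BagHasType.lift d h c) (SeqHasType.lift d h' c)
end

theorem liftBag_eq_map (c d : ℕ) (q : List Tm) : liftBag c d q = q.map (lift c d) := by
  induction q with
  | nil => rfl
  | cons t ts ih => rw [liftBag, ih, List.map_cons]

theorem liftSeq_eq_map (c d : ℕ) (q : List (List Tm)) :
    liftSeq c d q = q.map fun b => b.map (lift c d) := by
  induction q with
  | nil => rfl
  | cons t ts ih => rw [liftSeq, ih, List.map_cons, liftBag_eq_map]

theorem Deg.lift {n s} (h : Deg n s) (c d : ℕ) : Deg n (lift c d s) := by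
  induction h generalizing c with
  | var h ih =>
    rw [ResourceCalculus.lift, Deg.var_iff, liftSeq_eq_map]
    simp only [List.mem_map]
    rintro _ ⟨b, hb, rfl⟩ t ht
    obtain ⟨t, ht', rfl⟩ := List.mem_map.1 ht
    exact ih _ hb _ ht' _
  | lam h ih => rw [ResourceCalculus.lift, Deg.lam_iff]; exact ih _
  | redex h1 h2 h3 i2 i3 =>
    rw [ResourceCalculus.lift, liftSeq_eq_map]
    refine .redex h1 (i2 _) ?_
    simp only [List.mem_map]
    rintro _ ⟨b, hb, rfl⟩ t ht
    obtain ⟨t, ht', rfl⟩ := List.mem_map.1 ht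
    exact i3 _ hb _ ht' _

/-! ### Linear substitution -/

/-- `ArgOK ζ g c`: in the context `ζ`, the substitute `g` is well-typed with type `c`. -/
def ArgOK (ζ : Ctx) : Arg → Ty → Prop
  | .keep y i, c => (ζ y)[i]? = some c
  | .put t τ, c => HasType (ζ.sel τ) t c ∧ ∀ y, ∀ j ∈ τ y, j < (ζ y).length

/-- The denotation of a substitute. -/
noncomputable def argV (ρ : ℕ → List Val) : Arg → Val
  | .keep y i => (ρ y).getD i default
  | .put t τ => sem t fun y => sel (ρ y) (τ y)

/-- A bound on the depth of the redexes in a substitute and of those that it creates. -/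
def ArgDeg (d : ℕ) : Arg → Prop
  | .keep _ _ => True
  | .put t _ => Deg d t ∧ ∀ f s, t = .lam f s → DepthLE d (.arr (f.map Prod.fst))

/-- Substitutions that provide a substitute, typed in `ζ`, for every entry of `γ`. -/
def ArgCtx (ζ : Ctx) (e : ℕ → List Arg) (γ : Ctx) : Prop :=
  ∀ x, List.Forall₂ (ArgOK ζ) (e x) (γ x)

theorem ArgCtx.length {ζ γ : Ctx} {e} (h : ArgCtx ζ e γ) (x) : (e x).length = (γ x).length :=
  (h x).length_eq

theorem ArgCtx.split {ζ γ γ' : Ctx} {e} (h : ArgCtx ζ e (γ.tensor γ')) :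
    ∃ e1 e2, e = (fun x => e1 x ++ e2 x) ∧ ArgCtx ζ e1 γ ∧ ArgCtx ζ e2 γ' :=
  ⟨fun x => (e x).take (γ x).length, fun x => (e x).drop (γ x).length, by funext x; simp,
    fun x => by simpa [Ctx.tensor] using List.forall₂_take (γ x).length (h x),
    fun x => by simpa [Ctx.tensor] using List.forall₂_drop (γ x).length (h x)⟩

theorem ArgCtx.var_split {ζ γ : Ctx} {x a e} (h : ArgCtx ζ e ((Ctx.single x a).tensor γ)) :
    ∃ g e', e = (fun y => (if y = x then [g] else []) ++ e' y) ∧ ArgOK ζ g a ∧ ArgCtx ζ e' γ := by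
  obtain ⟨e1, e2, rfl, h1, h2⟩ := h.split
  have hx := h1 x
  simp only [Ctx.single, ↓reduceIte] at hx
  generalize he : e1 x = es at hx
  cases hx with
  | @cons g _ es _ hg hn =>
    cases hn
    refine ⟨g, e2, ?_, hg, h2⟩
    funext y
    by_cases hy : y = x
    · subst hy; simp [he]
    · have := h1.length y
      simp only [Ctx.single, hy, ↓reduceIte, List.length_nil, List.length_eq_zero_iff] at this
      simp [hy, this]

theorem substBag_append {t ts} {e1 e2 : ℕ → List Arg} (h : ∀ x, (e1 x).length = occ x t) :
    substBag (t :: ts) (fun x => e1 x ++ e2 x) = ((subst t e1).1 :: (substBag ts e2).1,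
      fun x => (subst t e1).2 x ++ (substBag ts e2).2 x) := by
  simp [substBag, ← h]

theorem substSeq_append {q qs} {e1 e2 : ℕ → List Arg} (h : ∀ x, (e1 x).length = occBag x q) :
    substSeq (q :: qs) (fun x => e1 x ++ e2 x) = ((substBag q e1).1 :: (substSeq qs e2).1,
      fun x => (substBag q e1).2 x ++ (substSeq qs e2).2 x) := by
  simp [substSeq, ← h]

theorem subst_redex_append {f s q} {e1 e2 : ℕ → List Arg}
    (h : ∀ x, (e1 x).length = occ (x + f.length) s) :
    ∃ f' s' ν, subst (.lam f s) e1 = (.lam f' s', ν) ∧ subst (.redex f s q) (fun x => e1 x ++ e2 x) =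
      (.redex f' s' (substSeq q e2).1, fun x => ν x ++ (substSeq q e2).2 x) := by
  refine ⟨_, _, _, by rw [subst], ?_⟩
  simp [subst, ← h]

theorem update_append_single {A : Type} {x : ℕ} {g : A} {e : ℕ → List A} :
    Function.update (fun y => (if y = x then [g] else []) ++ e y) x (e x) = e := by
  funext y
  by_cases h : y = x
  · subst h; simp
  · simp [h]

theorem subst_var_keep {x q y i} {e : ℕ → List Arg} :
    subst (.var x q) (fun z => (if z = x then [.keep y i] else []) ++ e z) =
      (.var y (substSeq q e).1, fun z => (if z = y then [i] else []) ++ (substSeq q e).2 z) := by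
  rw [subst]
  simp only [↓reduceIte, List.singleton_append, update_append_single]

theorem subst_var_put {x q t τ} {e : ℕ → List Arg} :
    subst (.var x q) (fun z => (if z = x then [.put t τ] else []) ++ e z) =
      (t.app (substSeq q e).1, fun z => τ z ++ (substSeq q e).2 z) := by
  rw [subst]
  simp only [↓reduceIte, List.singleton_append, update_append_single]

theorem SeqHasType.nil_inv {γ q} (h : SeqHasType γ q []) : γ = .empty ∧ q = [] := by
  cases h; exact ⟨rfl, rfl⟩

theorem HasType.app {γ δ t q a} (h : HasType γ t (.arr a)) (hq : SeqHasType δ q a) :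
    HasType (γ.tensor δ) (t.app q) .o := by
  have key : a = [] → HasType (γ.tensor δ) t .o := by
    rintro rfl
    obtain ⟨rfl, rfl⟩ := hq.nil_inv
    have : γ.tensor .empty = γ := by funext y; simp [Ctx.tensor, Ctx.empty]
    rwa [this]
  cases t with
  | var x p => exact key (by cases h; rfl)
  | redex f s p => exact key (by cases h; rfl)
  | lam f s => exact .redex h hq

theorem sem_app {γ δ t q a} (h : HasType γ t (.arr a)) (hq : SeqHasType δ q a) {ρ1 ρ2}
    (h1 : Env γ ρ1) (h2 : Env δ ρ2) : sem (t.app q) (fun x => ρ1 x ++ ρ2 x) =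
      base (app (sem t ρ1) (semSeq q ρ2)) := by
  have key : a = [] → sem t (fun x => ρ1 x ++ ρ2 x) = base (app (sem t ρ1) (semSeq q ρ2)) := by
    rintro rfl
    obtain ⟨rfl, rfl⟩ := hq.nil_inv
    have : (fun x => ρ1 x ++ ρ2 x) = ρ1 := by
      funext y
      have := h2.length y
      simp only [Ctx.empty, List.length_nil, List.length_eq_zero_iff] at this
      simp [this]
    rw [this]
    exact (base_force (sem_fst h h1)).symm
  cases t with
  | var x p => exact key (by cases h; rfl)
  | redex f s p => exact key (by cases h; rfl)
  | lam f s => exact sem_redex_append fun x => by rw [h1.length, occ_body_eq h]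

theorem Deg.app {d t q} (h : Deg d t) (h' : ∀ f s, t = .lam f s → DepthLE d (.arr (f.map Prod.fst)))
    (hq : ∀ b ∈ q, ∀ t ∈ b, Deg d t) : Deg d (t.app q) := by
  cases t with
  | var x p => exact h
  | redex f s p => exact h
  | lam f s => exact .redex (h' f s rfl) (Deg.lam_iff.1 h) hq

theorem Ctx.sel_single {ζ : Ctx} {y i a} (h : (ζ y)[i]? = some a) :
    ζ.sel (fun z => if z = y then [i] else []) = Ctx.single y a := by
  funext z
  by_cases hz : z = y
  · subst hz; simp [Ctx.sel, Ctx.single, ResourceCalculus.sel, h]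
  · simp [Ctx.sel, Ctx.single, ResourceCalculus.sel, hz]

theorem ArgOK.lift {ζ : Ctx} {g c} (h : ArgOK ζ g c) (b : List (List Ty)) (n : ℕ)
    (hn : b.length = n) : ArgOK (.cons b ζ) (g.lift n) c := by
  subst hn
  cases g with
  | keep y i => simpa [ArgOK, Arg.lift, Ctx.cons_add] using h
  | put t τ =>
    obtain ⟨h1, h2⟩ := h
    refine ⟨?_, ?_⟩
    · have := h1.lift b.length 0
      convert this using 1
      funext y
      simp only [Ctx.sel, Ctx.lift, Nat.not_lt_zero, ↓reduceIte, Nat.zero_add]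
      split_ifs with h
      · rfl
      · congr 1
        conv_lhs => rw [show y = y - b.length + b.length by omega]
        rw [Ctx.cons_add]
    · intro y j hj
      rcases lt_or_ge y b.length with h | h
      · simp [h] at hj
      · simp only [not_lt.2 h, ↓reduceIte] at hj
        have := h2 _ _ hj
        rw [show y = y - b.length + b.length by omega]
        rwa [Ctx.cons_add]

theorem argV_lift (g : Arg) {Q : List (List Val)} {n : ℕ} (hn : Q.length = n) (ρ : ℕ → List Val) :
    argV (ext Q ρ) (g.lift n) = argV ρ g := by
  subst hn
  cases g with
  | keep y i => simp [argV, Arg.lift]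
  | put t τ =>
    simp only [argV, Arg.lift]
    rw [sem_lift]
    congr 1
    funext y
    simp [shiftVar]

theorem ArgDeg.lift {d g} (h : ArgDeg d g) (n : ℕ) : ArgDeg d (g.lift n) := by
  cases g with
  | keep y i => trivial
  | put t τ =>
    refine ⟨h.1.lift _ _, fun f s hs => ?_⟩
    cases t with
    | var => simp [ResourceCalculus.lift] at hs
    | redex => simp [ResourceCalculus.lift] at hs
    | lam f' s' =>
      simp only [ResourceCalculus.lift, Tm.lam.injEq] at hs
      rw [← hs.1]
      exact h.2 _ _ rfl

theorem ArgCtx.underBinder {ζ γ : Ctx} {e b s a n} (h : ArgCtx ζ e γ)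
    (hs : HasType (.cons b γ) s a) (hn : b.length = n) :
    ArgCtx (.cons b ζ) (underBinder n s e) (.cons b γ) := by
  subst hn
  refine ext_cases b.length (fun x hx => ?_) (fun x => ?_)
  · rw [ResourceCalculus.underBinder, ext_lt _ _ (by simpa [keepBound] using hx), Ctx.cons_lt hx]
    simp only [keepBound, List.getElem_map, List.getElem_range, occ_eq hs, Ctx.cons_lt hx]
    rw [List.forall₂_iff_get]
    refine ⟨by simp, fun i h1 h2 => ?_⟩
    simp only [List.get_eq_getElem, List.getElem_map, List.getElem_range, ArgOK, Ctx.cons_lt hx]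
    exact List.getElem?_eq_getElem h2
  · rw [ResourceCalculus.underBinder, ext_add' _ _ _ _ (by simp [keepBound]), Ctx.cons_add,
      List.forall₂_map_left_iff]
    exact (h x).imp fun g c hg => hg.lift b _ rfl

theorem argV_underBinder {γ : Ctx} {b s a n} (hs : HasType (.cons b γ) s a)
    (hn : b.length = n) (e : ℕ → List Arg) {Q : List (List Val)} (hQ : SeqEnv b Q)
    (ρ : ℕ → List Val) : (fun x => (underBinder n s e x).map (argV (ext Q ρ))) =
      ext Q fun x => (e x).map (argV ρ) := by
  subst hn
  have hl : Q.length = b.length := by rw [← hQ, List.length_map]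
  funext x
  refine ext_cases (P := fun x => (underBinder b.length s e x).map (argV (ext Q ρ)) =
      ext Q (fun x => (e x).map (argV ρ)) x) b.length (fun x hx => ?_) (fun x => ?_) x
  · rw [ResourceCalculus.underBinder, ext_lt _ _ (by simpa [keepBound] using hx),
      ext_lt _ _ (hl ▸ hx)]
    simp only [keepBound, List.getElem_map, List.getElem_range, occ_eq hs, Ctx.cons_lt hx,
      List.map_map]
    have hb : b[x].length = (Q[x]'(hl ▸ hx)).length := by subst hQ; simp
    have := sel_range (Q[x]'(hl ▸ hx))
    rw [hb]
    conv_rhs => rw [← this]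
    rw [sel]
    refine List.map_congr_left fun i _ => ?_
    simp only [Function.comp_apply, argV]
    rw [ext_lt _ _ (hl ▸ hx)]
  · rw [ResourceCalculus.underBinder, ext_add' _ _ _ _ (by simp [keepBound]),
      ext_add' _ _ _ _ hl, List.map_map]
    exact List.map_congr_left fun g _ => argV_lift g hl ρ

/-- The properties of a substitution in a term. All redexes that it creates are applications of the
substituted terms, which is why `ArgDeg` refers to the types of these. -/
structure SubstTm (ζ : Ctx) (e : ℕ → List Arg) (s : Tm) (a : Ty) : Prop where
  typed : HasType (ζ.sel (subst s e).2) (subst s e).1 a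
  lt : ∀ x, ∀ i ∈ (subst s e).2 x, i < (ζ x).length
  sem_eq : ∀ ρ, Env ζ ρ → sem (subst s e).1 (fun x => sel (ρ x) ((subst s e).2 x)) =
    sem s (fun x => (e x).map (argV ρ))
  deg : ∀ d, (∀ x, ∀ g ∈ e x, ArgDeg d g) → Deg d s → Deg d (subst s e).1

/-- The properties of a substitution in a bag. -/
structure SubstBag (ζ : Ctx) (e : ℕ → List Arg) (q : List Tm) (a : List Ty) : Prop where
  typed : BagHasType (ζ.sel (substBag q e).2) (substBag q e).1 a
  lt : ∀ x, ∀ i ∈ (substBag q e).2 x, i < (ζ x).length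
  sem_eq : ∀ ρ, Env ζ ρ → semBag (substBag q e).1 (fun x => sel (ρ x) ((substBag q e).2 x)) =
    semBag q (fun x => (e x).map (argV ρ))
  deg : ∀ d, (∀ x, ∀ g ∈ e x, ArgDeg d g) → (∀ t ∈ q, Deg d t) →
    ∀ t ∈ (substBag q e).1, Deg d t

/-- The properties of a substitution in a sequence of bags. -/
structure SubstSeq (ζ : Ctx) (e : ℕ → List Arg) (q : List (List Tm)) (a : List (List Ty)) :
    Prop where
  typed : SeqHasType (ζ.sel (substSeq q e).2) (substSeq q e).1 a
  lt : ∀ x, ∀ i ∈ (substSeq q e).2 x, i < (ζ x).length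
  sem_eq : ∀ ρ, Env ζ ρ → semSeq (substSeq q e).1 (fun x => sel (ρ x) ((substSeq q e).2 x)) =
    semSeq q (fun x => (e x).map (argV ρ))
  deg : ∀ d, (∀ x, ∀ g ∈ e x, ArgDeg d g) → (∀ b ∈ q, ∀ t ∈ b, Deg d t) →
    ∀ b ∈ (substSeq q e).1, ∀ t ∈ b, Deg d t

theorem subst_ok_var {γ : Ctx} {x q a} (ih : ∀ ζ e, ArgCtx ζ e γ → SubstSeq ζ e q a) {ζ e}
    (he : ArgCtx ζ e ((Ctx.single x (.arr a)).tensor γ)) : SubstTm ζ e (.var x q) .o := by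
  obtain ⟨g, e, rfl, hg, he⟩ := he.var_split
  have IH := ih ζ e he
  have e2 : ∀ ρ, (fun y => ((if y = x then [g] else []) ++ e y).map (argV ρ)) =
      fun y => (if y = x then [argV ρ g] else []) ++ (e y).map (argV ρ) := by
    intro ρ
    funext y
    by_cases h : y = x
    · subst h; simp
    · simp [h]
  cases g with
  | keep y i =>
    constructor
    · rw [subst_var_keep, Ctx.sel_append, Ctx.sel_single hg]
      exact .var IH.typed
    · rw [subst_var_keep]
      intro z j hj
      rcases List.mem_append.1 hj with hj | hj
      · by_cases h : z = y
        · subst h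
          simp at hj
          subst hj
          exact (List.getElem?_eq_some_iff.1 hg).1
        · simp [h] at hj
      · exact IH.lt z j hj
    · intro ρ hρ
      rw [subst_var_keep, e2, sem_var_cons, ← IH.sem_eq ρ hρ]
      have : (fun z => sel (ρ z) ((if z = y then [i] else []) ++ (substSeq q e).2 z)) =
          fun z => (if z = y then [argV ρ (.keep y i)] else []) ++
            sel (ρ z) ((substSeq q e).2 z) := by
        funext z
        rw [sel_append]
        by_cases h : z = y
        · subst h; simp [sel, argV]
        · simp [h]
      rw [this, sem_var_cons]
    · intro d h1 h2
      rw [subst_var_keep, Deg.var_iff]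
      refine IH.deg d (fun z g hg => h1 z g ?_) (Deg.var_iff.1 h2)
      simp [hg]
  | put t τ =>
    constructor
    · rw [subst_var_put, Ctx.sel_append]
      exact hg.1.app IH.typed
    · rw [subst_var_put]
      intro z j hj
      rcases List.mem_append.1 hj with hj | hj
      exacts [hg.2 z j hj, IH.lt z j hj]
    · intro ρ hρ
      rw [subst_var_put, e2, sem_var_cons, ← IH.sem_eq ρ hρ]
      simp only [sel_append]
      exact sem_app hg.1 IH.typed (hρ.sel _) (hρ.sel _)
    · intro d h1 h2
      rw [subst_var_put]
      have h3 := h1 x (.put t τ) (by simp)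
      refine h3.1.app h3.2 (IH.deg d (fun z g hg => h1 z g ?_) (Deg.var_iff.1 h2))
      simp [hg]

theorem subst_ok_lam {γ : Ctx} {f s a b} (hne : f ≠ []) (hf : SeqIsHom f a b)
    (hs : HasType (.cons b γ) s .o)
    (ih : ∀ ζ e, ArgCtx ζ e (.cons b γ) → SubstTm ζ e s .o) {ζ e}
    (he : ArgCtx ζ e γ) : SubstTm ζ e (.lam f s) (.arr a) := by
  have hb := hf.length_tgt
  have IH := ih _ _ (he.underBinder hs hb.symm)
  obtain ⟨l1, l2⟩ := Env.lt_cons IH.lt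
  constructor
  · rw [subst]
    refine .lam (fun h => ?_) (reindexSeq_isHom hf l1) ?_
    · have := congrArg List.length h
      rw [reindexSeq, List.length_mapIdx] at this
      exact hne (List.length_eq_zero_iff.1 this)
    · have := IH.typed
      rwa [Ctx.sel_cons _ _ _ _ hb.symm] at this
  · rw [subst]
    rw [← hb] at l2
    exact l2
  · intro ρ hρ
    rw [subst, sem, sem, reindexSeq_map_fst]
    refine lamV_congr fun Q hQ => ?_
    rw [hf.src_eq] at hQ
    have hQ' := seqEnv_coactSeqV hf hQ
    rw [coactSeqV_reindexSeq hf l1 hQ, ext_mapIdx_sel _ _ _ _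
      ((length_coactSeqV hf hQ).trans hb.symm), IH.sem_eq _ (hρ.ext hQ'),
      argV_underBinder hs hb.symm e hQ' ρ]
  · intro d h1 h
    rw [Deg.lam_iff] at h
    rw [subst]
    refine .lam (IH.deg d (ext_cases f.length (fun x hx => ?_) (fun x => ?_)) h)
    · rw [underBinder, ext_lt _ _ (by simpa [keepBound] using hx)]
      intro g hg
      simp only [keepBound, List.getElem_map, List.mem_map] at hg
      obtain ⟨i, _, rfl⟩ := hg
      trivial
    · rw [underBinder, ext_add' _ _ _ _ (by simp [keepBound])]
      intro g hg
      obtain ⟨g, hg', rfl⟩ := List.mem_map.1 hg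
      exact (h1 x g hg').lift _

theorem subst_ok_redex {γ γ' : Ctx} {f s q a} (ht : HasType γ (.lam f s) (.arr a))
    (ih : ∀ ζ e, ArgCtx ζ e γ → SubstTm ζ e (.lam f s) (.arr a))
    (ihq : ∀ ζ e, ArgCtx ζ e γ' → SubstSeq ζ e q a) {ζ e}
    (he : ArgCtx ζ e (γ.tensor γ')) : SubstTm ζ e (.redex f s q) .o := by
  obtain ⟨e1, e2, rfl, h1, h2⟩ := he.split
  have I1 := ih _ _ h1
  have I2 := ihq _ _ h2
  obtain ⟨f', s', ν, q1, q2⟩ := subst_redex_append (f := f) (s := s) (q := q) (e1 := e1) (e2 := e2)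
    (fun x => by rw [h1.length, occ_body_eq ht])
  have T1 := I1.typed
  rw [q1] at T1
  constructor
  · rw [q2, Ctx.sel_append]
    exact .redex T1 I2.typed
  · have := I1.lt
    rw [q1] at this
    rw [q2]
    intro x i hi
    rcases List.mem_append.1 hi with hi | hi
    exacts [this x i hi, I2.lt x i hi]
  · intro ρ hρ
    have i1 := I1.sem_eq ρ hρ
    rw [q1] at i1
    rw [q2]
    simp only [sel_append, List.map_append]
    rw [sem_redex_append, sem_redex_append, i1, I2.sem_eq ρ hρ]
    · intro x
      rw [List.length_map, h1.length, occ_body_eq ht]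
    · intro x
      rw [occ_body_eq T1]
      simp [Ctx.sel]
  · intro d hd h
    have := I1.deg d fun x g hg => hd x g (by simp [hg])
    rw [q1] at this
    rw [q2]
    cases h with
    | redex d1 d2 d3 =>
      have h3 : f'.map Prod.fst = f.map Prod.fst := by
        have := congrArg Prod.fst q1
        rw [subst] at this
        simp only [Tm.lam.injEq] at this
        rw [← this.1, reindexSeq_map_fst]
      exact .redex (h3 ▸ d1) (Deg.lam_iff.1 (this (.lam d2)))
        (I2.deg d (fun x g hg => hd x g (by simp [hg])) d3)

mutual
/-- Substitution is well-typed, and it denotes the substitution of values. -/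
theorem subst_ok : ∀ {γ s a}, HasType γ s a → ∀ ζ e, ArgCtx ζ e γ → SubstTm ζ e s a
  | _, _, _, .var h, _, _, he => subst_ok_var (substSeq_ok h) he
  | _, _, _, .lam hne hf h, _, _, he => subst_ok_lam hne hf h (subst_ok h) he
  | _, _, _, .redex h hq, _, _, he => subst_ok_redex h (subst_ok h) (substSeq_ok hq) he
theorem substBag_ok : ∀ {γ q a}, BagHasType γ q a → ∀ ζ e, ArgCtx ζ e γ → SubstBag ζ e q a
  | _, _, _, .nil, _, _, _ => ⟨.nil, fun _ _ h => by simp [substBag] at h, fun _ _ => rfl,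
      fun _ _ _ _ h => by simp [substBag] at h⟩
  | _, _, _, .cons h h', ζ, e, he => by
    obtain ⟨e1, e2, rfl, h1, h2⟩ := he.split
    have I1 := subst_ok h ζ e1 h1
    have I2 := substBag_ok h' ζ e2 h2
    have e := fun ts => substBag_append (ts := ts) (e2 := e2) (fun x => by rw [h1.length, occ_eq h])
    constructor
    · rw [e, Ctx.sel_append]; exact .cons I1.typed I2.typed
    · rw [e]
      intro x i hi
      rcases List.mem_append.1 hi with hi | hi
      exacts [I1.lt x i hi, I2.lt x i hi]
    · intro ρ hρ
      simp only [e, sel_append, List.map_append]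
      rw [semBag_append (ρ1 := fun x => sel (ρ x) ((subst _ e1).2 x)), semBag_append,
        I1.sem_eq ρ hρ, I2.sem_eq ρ hρ]
      · intro x
        rw [List.length_map, h1.length, occ_eq h]
      · intro x
        rw [occ_eq I1.typed, length_sel, Ctx.sel, length_sel]
    · intro d hg hd
      rw [e]
      simp only [List.mem_cons, forall_eq_or_imp] at hd ⊢
      exact ⟨I1.deg d (fun x g h => hg x g (by simp [h])) hd.1,
        I2.deg d (fun x g h => hg x g (by simp [h])) hd.2⟩
theorem substSeq_ok : ∀ {γ q a}, SeqHasType γ q a → ∀ ζ e, ArgCtx ζ e γ → SubstSeq ζ e q a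
  | _, _, _, .nil, _, _, _ => ⟨.nil, fun _ _ h => by simp [substSeq] at h, fun _ _ => rfl,
      fun _ _ _ _ h => by simp [substSeq] at h⟩
  | _, _, _, .cons h h', ζ, e, he => by
    obtain ⟨e1, e2, rfl, h1, h2⟩ := he.split
    have I1 := substBag_ok h ζ e1 h1
    have I2 := substSeq_ok h' ζ e2 h2
    have e := fun ts => substSeq_append (qs := ts) (e2 := e2)
      (fun x => by rw [h1.length, occBag_eq h])
    constructor
    · rw [e, Ctx.sel_append]; exact .cons I1.typed I2.typed
    · rw [e]
      intro x i hi
      rcases List.mem_append.1 hi with hi | hi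
      exacts [I1.lt x i hi, I2.lt x i hi]
    · intro ρ hρ
      simp only [e, sel_append, List.map_append]
      rw [semSeq_append (ρ1 := fun x => sel (ρ x) ((substBag _ e1).2 x)), semSeq_append,
        I1.sem_eq ρ hρ, I2.sem_eq ρ hρ]
      · intro x
        rw [List.length_map, h1.length, occBag_eq h]
      · intro x
        rw [occBag_eq I1.typed, length_sel, Ctx.sel, length_sel]
    · intro d hg hd
      rw [e]
      simp only [List.mem_cons, forall_eq_or_imp] at hd ⊢
      exact ⟨I1.deg d (fun x g h => hg x g (by simp [h])) hd.1,
        I2.deg d (fun x g h => hg x g (by simp [h])) hd.2⟩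
end

/-- The terms of a bag, tagged with the positions of their free variables, are well-typed
substitutes. Here `π` and `r` are the parts of the context before and after the bag. -/
theorem tagBag_ok {δ q a} (h : BagHasType δ q a) (π r : ℕ → List Ty) :
    List.Forall₂ (ArgOK fun y => π y ++ (δ y ++ r y)) (tagBag (fun y => (π y).length) q) a := by
  induction q generalizing δ a π with
  | nil => cases h; exact .nil
  | cons t ts ih =>
    cases h with
    | @cons γ _ a δ _ as h1 h2 =>
      rw [tagBag]
      refine .cons ⟨?_, ?_⟩ ?_
      · convert h1 using 1
        funext y
        simp only [Ctx.sel, Ctx.tensor, List.append_assoc, occ_eq h1, sel_range']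
      · intro y j hj
        simp only [List.mem_range'_1, occ_eq h1] at hj
        simp only [Ctx.tensor, List.length_append]
        omega
      · have := ih h2 fun y => π y ++ γ y
        simpa only [List.length_append, List.append_assoc, occ_eq h1, Ctx.tensor] using this

theorem argV_tagBag {δ q a} (h : BagHasType δ q a) (π r : ℕ → List Val) {ρ} (hρ : Env δ ρ) :
    (tagBag (fun y => (π y).length) q).map (argV fun y => π y ++ (ρ y ++ r y)) =
      semBag q ρ := by
  induction q generalizing δ a π ρ with
  | nil => rw [tagBag, semBag, List.map_nil]
  | cons t ts ih =>
    cases h with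
    | @cons γ _ a δ _ as h1 h2 =>
      obtain ⟨ρ1, ρ2, rfl, e1, e2⟩ := hρ.split
      have o1 := fun y => occ_eq h1 y
      simp only [← e1.length] at o1
      rw [tagBag, semBag_append (fun x => (o1 x).symm), List.map_cons]
      have := ih h2 (fun y => π y ++ ρ1 y) e2
      simp only [List.length_append, List.append_assoc, ← o1] at this
      simp only [List.append_assoc, this]
      congr 1
      simp only [argV, o1, sel_range']

theorem tagSeq_ok {δ q a} (h : SeqHasType δ q a) (π r : ℕ → List Ty) :
    List.Forall₂ (List.Forall₂ (ArgOK fun y => π y ++ (δ y ++ r y)))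
      (tagSeq (fun y => (π y).length) q) a := by
  induction q generalizing δ a π with
  | nil => cases h; exact .nil
  | cons t ts ih =>
    cases h with
    | @cons γ _ a δ _ as h1 h2 =>
      rw [tagSeq]
      refine .cons ?_ ?_
      · have := tagBag_ok h1 π fun y => δ y ++ r y
        simpa only [List.append_assoc, Ctx.tensor] using this
      · have := ih h2 fun y => π y ++ γ y
        simpa only [List.length_append, List.append_assoc, occBag_eq h1, Ctx.tensor] using this

theorem argV_tagSeq {δ q a} (h : SeqHasType δ q a) (π r : ℕ → List Val) {ρ} (hρ : Env δ ρ) :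
    (tagSeq (fun y => (π y).length) q).map
      (fun l => l.map (argV fun y => π y ++ (ρ y ++ r y))) = semSeq q ρ := by
  induction q generalizing δ a π ρ with
  | nil => rw [tagSeq, semSeq, List.map_nil]
  | cons t ts ih =>
    cases h with
    | @cons γ _ a δ _ as h1 h2 =>
      obtain ⟨ρ1, ρ2, rfl, e1, e2⟩ := hρ.split
      have o1 := fun y => occBag_eq h1 y
      simp only [← e1.length] at o1
      rw [tagSeq, semSeq_append (fun x => (o1 x).symm), List.map_cons]
      have := ih h2 (fun y => π y ++ ρ1 y) e2
      simp only [List.length_append, List.append_assoc, ← o1] at this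
      simp only [List.append_assoc, this]
      congr 1
      exact argV_tagBag h1 π _ e1

theorem HasType.lam_inv {γ f s c} (h : HasType γ (.lam f s) c) :
    ∃ a b, c = .arr a ∧ f ≠ [] ∧ SeqIsHom f a b ∧ HasType (.cons b γ) s .o := by
  cases h with
  | lam h1 h2 h3 => exact ⟨_, _, rfl, h1, h2, h3⟩

theorem tagBag_deg {d δ q a} (h : BagHasType δ q a) (k : ℕ → ℕ) (hq : ∀ t ∈ q, Deg d t)
    (ha : ∀ c ∈ a, DepthLE d c) : ∀ g ∈ tagBag k q, ArgDeg d g := by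
  induction q generalizing δ a k with
  | nil => simp [tagBag]
  | cons t ts ih =>
    cases h with
    | @cons γ _ a δ _ as h1 h2 =>
      simp only [List.mem_cons, forall_eq_or_imp] at hq ha
      rw [tagBag]
      simp only [List.mem_cons, forall_eq_or_imp]
      refine ⟨⟨hq.1, ?_⟩, ih h2 _ hq.2 ha.2⟩
      rintro f s rfl
      obtain ⟨a, b, rfl, _, hf, _⟩ := h1.lam_inv
      rw [hf.src_eq]
      exact ha.1

theorem tagSeq_deg {d δ q a} (h : SeqHasType δ q a) (k : ℕ → ℕ) (hq : ∀ b ∈ q, ∀ t ∈ b, Deg d t)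
    (ha : ∀ b ∈ a, ∀ c ∈ b, DepthLE d c) : ∀ l ∈ tagSeq k q, ∀ g ∈ l, ArgDeg d g := by
  induction q generalizing δ a k with
  | nil => simp [tagSeq]
  | cons t ts ih =>
    cases h with
    | @cons γ _ a δ _ as h1 h2 =>
      simp only [List.mem_cons, forall_eq_or_imp] at hq ha
      rw [tagSeq]
      simp only [List.mem_cons, forall_eq_or_imp]
      exact ⟨tagBag_deg h1 k hq.1 ha.1, ih h2 _ hq.2 ha.2⟩

theorem SeqHasType.length {γ q a} (h : SeqHasType γ q a) : q.length = a.length := by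
  induction q generalizing γ a with
  | nil => cases h; rfl
  | cons t ts ih =>
    cases h with
    | cons h1 h2 => simp [ih h2]

/-- The properties of a linear substitution: it denotes the extension of the environment by the
values of the arguments, and it creates redexes of smaller type only. -/
structure LinOK (γ δ : Ctx) (a : List (List Ty)) (s : Tm) (q : List (List Tm)) : Prop where
  typed : HasType ((γ.tensor δ).sel (linSubst s q).2) (linSubst s q).1 .o
  lt : ∀ x, ∀ i ∈ (linSubst s q).2 x, i < (γ.tensor δ x).length
  sem_eq : ∀ ρ1 ρ2, Env γ ρ1 → Env δ ρ2 →
    sem (linSubst s q).1 (fun x => sel (ρ1 x ++ ρ2 x) ((linSubst s q).2 x)) =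
      sem s (ext (semSeq q ρ2) ρ1)
  deg : ∀ d, Deg d s → (∀ b ∈ q, ∀ t ∈ b, Deg d t) → DepthLE (d + 1) (.arr a) →
    Deg d (linSubst s q).1

theorem length_tagSeq (k) (q : List (List Tm)) : (tagSeq k q).length = q.length := by
  induction q generalizing k with
  | nil => rfl
  | cons t ts ih => simp [tagSeq, ih]

theorem linSubst_ok {γ δ : Ctx} {a s q} (hs : HasType (.cons a γ) s .o) (hq : SeqHasType δ q a) :
    LinOK γ δ a s q := by
  have hl := hq.length
  have ho : (fun x => occ (x + q.length) s) = fun x => (γ x).length := by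
    funext x; rw [occ_eq hs, hl, Ctx.cons_add]
  have ht := length_tagSeq (fun x => (γ x).length) q
  have hsub : linSubst s q = subst s (ext (tagSeq (fun x => (γ x).length) q)
      fun x => (List.range (γ x).length).map fun i => .keep x i) := by
    rw [linSubst, ho]
    congr 2
    funext x
    rw [congrFun ho x]
  -- The occurrences of the free variables are kept, at the positions in front of those of `q`.
  have hA : ArgCtx (γ.tensor δ) (ext (tagSeq (fun x => (γ x).length) q)
      fun x => (List.range (γ x).length).map fun i => .keep x i) (.cons a γ) := by
    refine ext_cases a.length (fun x hx => ?_) (fun x => ?_)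
    · rw [ext_lt _ _ (by omega), Ctx.cons_lt hx]
      have := (List.forall₂_iff_get.1 (tagSeq_ok hq γ fun _ => [])).2 x (by omega) hx
      simp only [List.append_nil] at this
      exact this
    · rw [ext_add' _ _ _ _ (by omega), Ctx.cons_add, List.forall₂_iff_get]
      refine ⟨by simp, fun i h1 h2 => ?_⟩
      simp only [List.get_eq_getElem, List.getElem_map, List.getElem_range, ArgOK, Ctx.tensor]
      rw [List.getElem?_append_left h2]
      exact List.getElem?_eq_getElem h2
  have H := subst_ok hs _ _ hA
  constructor
  · rw [hsub]; exact H.typed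
  · rw [hsub]; exact H.lt
  · intro ρ1 ρ2 h1 h2
    rw [hsub, H.sem_eq _ (h1.append h2)]
    congr 1
    have hv := argV_tagSeq hq ρ1 (fun _ => []) h2
    have hk : (fun y => (ρ1 y).length) = fun y => (γ y).length := by
      funext y; exact h1.length y
    rw [hk] at hv
    simp only [List.append_nil] at hv
    have hvl := congrArg List.length hv
    rw [List.length_map] at hvl
    funext x
    refine ext_cases (P := fun x => (ext (tagSeq (fun x => (γ x).length) q) (fun x =>
      (List.range (γ x).length).map fun i => Arg.keep x i) x).map (argV fun x => ρ1 x ++ ρ2 x) =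
      ext (semSeq q ρ2) ρ1 x) a.length (fun x hx => ?_) (fun x => ?_) x
    · rw [ext_lt _ _ (by omega), ext_lt _ _ (by omega)]
      simp only [← hv, List.getElem_map]
    · rw [ext_add' _ _ _ _ (by omega), ext_add' _ _ _ _ (by omega), List.map_map, ← h1.length]
      conv_rhs => rw [← sel_range (ρ1 x)]
      rw [sel]
      refine List.map_congr_left fun i hi => ?_
      simp only [List.mem_range] at hi
      simp [argV, List.getElem?_append, hi]
  · intro d h1 h2 h3
    rw [hsub]
    refine H.deg d (ext_cases a.length (fun x hx => ?_) (fun x => ?_)) h1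
    · rw [ext_lt _ _ (by omega)]
      exact tagSeq_deg hq _ h2 h3 _ (List.getElem_mem _)
    · rw [ext_add' _ _ _ _ (by omega)]
      intro g hg
      obtain ⟨i, _, rfl⟩ := List.mem_map.1 hg
      trivial

/-! ### The labels of reductions -/

/-- Type morphisms `f ⊸ o` where `f` consists of ground morphisms. The type labels of reductions are
of this form: this bounds the depth of the types that arise in a reduction, and it permits to
recover the label of a reduction of an abstraction from the selected positions. -/
def TMild (m : Mor) : Prop := ∃ fs, m = .arr fs ∧ ∀ f ∈ fs, ∃ α, f = ground α f.1

/-- Morphisms `⟨id; f₁, …, fₗ⟩` of intersection types where every `fⱼ` is `TMild`. -/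
inductive BMild : BMor → Prop
  | nil : BMild ([], [])
  | cons {a m h} : TMild m → BMild h → BMild (BMor.tensor ([a], [(0, m)]) h)

/-- Sequences of `BMild` morphisms. -/
def SMild (h : List BMor) : Prop := ∀ f ∈ h, BMild f

/-- Context morphisms all of whose entries are `f ⊸ o` for an `SMild` sequence `f`. -/
def CMild (θ : CtxMor) : Prop := ∀ x, ∀ e ∈ (θ x).2, ∃ h, e.2 = .arr h ∧ SMild h

theorem TMild.id (a : Ty) : TMild a.id := by
  obtain ⟨as⟩ := a
  refine ⟨_, by rw [Ty.id], fun f hf => ?_⟩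
  rw [idSeq_eq_map] at hf
  obtain ⟨b, _, rfl⟩ := List.mem_map.1 hf
  exact ⟨_, idBag_eq_ground b⟩

theorem BMild.id : ∀ a : List Ty, BMild (idBag a)
  | [] => .nil
  | a :: as => by
    have := idBag_append [a] as
    rw [List.singleton_append] at this
    rw [this]
    exact .cons (.id a) (BMild.id as)

theorem SMild.id (a : List (List Ty)) : SMild (idSeq a) := fun f hf => by
  rw [idSeq_eq_map] at hf
  obtain ⟨b, _, rfl⟩ := List.mem_map.1 hf
  exact .id b

theorem CMild.ground (α : ℕ → List ℕ) (γ : Ctx) : CMild (.ground α γ) := by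
  intro x e he
  simp only [CtxMor.ground, ResourceCalculus.ground, List.mem_map] at he
  obtain ⟨i, _, rfl⟩ := he
  rcases (γ x).getD i .o with ⟨as⟩
  exact ⟨idSeq as, by rw [Ty.id], .id as⟩

theorem CtxMor.id_eq_ground (γ : Ctx) :
    CtxMor.id γ = .ground (fun x => List.range (γ x).length) γ := by
  funext x; exact idBag_eq_ground _

theorem CMild.id (γ : Ctx) : CMild (.id γ) := CtxMor.id_eq_ground γ ▸ .ground _ _

theorem CMild.tensor {θ η} (h : CMild θ) (h' : CMild η) : CMild (θ.tensor η) := by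
  intro x e he
  simp only [CtxMor.tensor, BMor.tensor, List.mem_append, List.mem_map] at he
  rcases he with he | ⟨e, he, rfl⟩
  exacts [h x e he, h' x e he]

theorem entriesIsHom_shift_one {a c es b}
    (h : EntriesIsHom (c :: a) (es.map fun e : ℕ × Mor => (1 + e.1, e.2)) b) :
    EntriesIsHom a es b := by
  rw [entriesIsHom_iff] at *
  rw [List.forall₂_map_left_iff] at h
  refine h.imp fun e d => ?_
  rintro ⟨x, h1, h2⟩
  exact ⟨x, by simpa [Nat.add_comm 1] using h1, h2⟩

theorem BMor.IsHom.cons_inv {x m h a b} (H : (BMor.tensor ([x], [(0, m)]) h).IsHom a b) :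
    ∃ a' y b', a = x :: a' ∧ b = y :: b' ∧ Mor.IsHom m x y ∧ h.IsHom a' b' := by
  rw [BMor.isHom_iff] at H
  obtain ⟨rfl, H⟩ := H
  simp only [BMor.tensor, List.singleton_append, List.length_singleton] at H ⊢
  cases H with
  | cons h1 h2 h3 =>
    simp at h1
    subst h1
    exact ⟨_, _, _, rfl, rfl, h2, BMor.isHom_iff.2 ⟨rfl, entriesIsHom_shift_one h3⟩⟩

theorem BMor.isHom_single {m x y} (h : Mor.IsHom m x y) : BMor.IsHom ([x], [(0, m)]) [x] [y] :=
  .mk (.cons (by rfl) h .nil)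

theorem TMild.comp {f g : Mor} {a b c} (hf : f.IsHom a b) (hg : g.IsHom b c) (h : TMild f)
    (h' : TMild g) : TMild (g.comp f) := by
  obtain ⟨fs, rfl, h⟩ := h
  obtain ⟨gs, rfl, h'⟩ := h'
  refine ⟨_, Mor.comp_arr gs fs, ?_⟩
  cases hf with
  | @arr fs a b hf =>
  cases hg with
  | @arr gs b c hg =>
  induction fs generalizing gs a b c with
  | nil => cases hf; cases hg; simp [seqComp]
  | cons f fs ih =>
    cases hf with
    | @cons _ b a _ bs as hf hfs =>
    cases hg with
    | @cons g c _ gs cs _ hg hgs =>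
    simp only [List.mem_cons, forall_eq_or_imp] at h h'
    rw [seqComp, List.zipWith_cons_cons]
    simp only [List.mem_cons, forall_eq_or_imp]
    refine ⟨?_, ih h.2 gs h'.2 hfs hgs⟩
    obtain ⟨α, h1⟩ := h.1
    obtain ⟨β, h2⟩ := h'.1
    rw [BMor.isHom_iff] at hf hg
    have hα : ∀ i ∈ α, i < f.1.length := by
      intro i hi
      have : (i, (f.1.getD i .o).id) ∈ f.2 := by
        rw [h1]; exact List.mem_map.2 ⟨i, hi, rfl⟩
      exact hf.1 ▸ hf.2.lt this
    have hβ : ∀ i ∈ β, i < g.1.length := by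
      intro i hi
      have : (i, (g.1.getD i .o).id) ∈ g.2 := by
        rw [h2]; exact List.mem_map.2 ⟨i, hi, rfl⟩
      exact hg.1 ▸ hg.2.lt this
    have hb : b = sel g.1 β := by
      have := hg.2.tgt_eq
      rw [← hg.1] at this
      rw [← this, ← ground_tgt, ← h2]
    refine ⟨sel β α, ?_⟩
    have hf1 : f = ground α (sel g.1 β) := by rw [h1, hf.1, hb]
    rw [hf1, h2]
    refine ground_comp_ground hβ fun i hi => ?_
    have := hα i hi
    rwa [hf.1, hb, length_sel] at this

theorem BMild.comp {f g : BMor} {a b c} (hf : f.IsHom a b) (hg : g.IsHom b c) (h : BMild f)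
    (h' : BMild g) : BMild (g.comp f) := by
  induction h generalizing a b c g with
  | nil =>
    cases hf with
    | mk hf => cases hf; cases hg with
      | mk hg =>
        cases hg with
        | nil => exact .nil
        | cons h1 => simp at h1
  | @cons x m h hm hh ih =>
    obtain ⟨a, y, b, rfl, rfl, h1, h2⟩ := hf.cons_inv
    cases h' with
    | nil => have := hg.src_eq; simp at this
    | @cons y' m' h' hm' hh' =>
      obtain ⟨a, z, c, e, rfl, h3, h4⟩ := hg.cons_inv
      simp only [List.cons.injEq] at e
      obtain ⟨rfl, rfl⟩ := e
      rw [BMor.tensor_comp (BMor.isHom_single h1) (BMor.isHom_single h3) h2 h4]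
      exact .cons (hm.comp h1 h3 hm') (ih h2 h4 hh')

theorem SMild.comp {f g a b c} (hf : SeqIsHom f a b) (hg : SeqIsHom g b c) (h : SMild f)
    (h' : SMild g) : SMild (seqComp g f) := by
  induction f generalizing g a b c with
  | nil => cases hf; cases hg; simp [seqComp, SMild]
  | cons f fs ih =>
    cases hf with
    | cons hf hfs =>
    cases hg with
    | cons hg hgs =>
    simp only [SMild, List.mem_cons, forall_eq_or_imp] at h h'
    rw [seqComp, List.zipWith_cons_cons]
    simp only [SMild, List.mem_cons, forall_eq_or_imp]
    exact ⟨h.1.comp hf hg h'.1, ih hfs hgs h.2 h'.2⟩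

theorem CMild.comp {θ η : CtxMor} {γ δ ζ : Ctx} (hθ : ∀ x, (θ x).IsHom (γ x) (δ x))
    (hη : ∀ x, (η x).IsHom (δ x) (ζ x)) (h : CMild θ) (h' : CMild η) :
    CMild fun x => (η x).comp (θ x) := by
  intro x e he
  have h1 := BMor.isHom_iff.1 (hθ x)
  have h2 := BMor.isHom_iff.1 (hη x)
  rw [BMor.comp_snd_eq h1.2 h2.2] at he
  obtain ⟨e, he', rfl⟩ := List.mem_map.1 he
  replace he := he'
  have h3 := h2.2.lt he
  rw [← h1.2.length] at h3
  obtain ⟨_, h4⟩ := h1.2.getD h3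
  obtain ⟨d, h5⟩ := h2.2.mem he
  obtain ⟨k, e1, m1⟩ := h' x e he
  obtain ⟨l, e2, m2⟩ := h x ((θ x).2.getD e.1 default) (by
    rw [List.getD_eq_getElem _ _ h3]; exact List.getElem_mem _)
  rw [e1] at h5 ⊢
  rw [e2] at h4 ⊢
  refine ⟨_, Mor.comp_arr _ _, ?_⟩
  obtain ⟨u, v, _, e3, h6⟩ := h4.arr_inv
  obtain ⟨v', w, e4, _, h7⟩ := h5.arr_inv
  rw [e3] at e4
  simp only [Ty.arr.injEq] at e4
  subst e4
  exact m1.comp h7 h6 m2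

/-- Ground morphisms only duplicate, erase and permute the entries, so that the depth does not grow.
-/
theorem TMild.depth {m : Mor} {a b n} (hm : m.IsHom a b) (h : TMild m) (hb : DepthLE n b) :
    DepthLE n a := by
  obtain ⟨fs, rfl, h⟩ := h
  obtain ⟨as, bs, rfl, rfl, hf⟩ := hm.arr_inv
  cases n with
  | zero => exact hb
  | succ n =>
    simp only [DepthLE] at hb ⊢
    clear hm
    induction fs generalizing as bs with
    | nil => cases hf; simp
    | cons f fs ih =>
      cases hf with
      | cons h1 h2 =>
        simp only [List.mem_cons, forall_eq_or_imp] at h hb ⊢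
        refine ⟨fun c hc => ?_, ih h.2 _ _ h2 hb.2⟩
        obtain ⟨α, hα⟩ := h.1
        rw [BMor.isHom_iff] at h1
        rw [← h1.2.tgt_eq, ← h1.1] at hc
        change c ∈ BMor.tgt f at hc
        rw [hα, ground_tgt] at hc
        refine hb.1 c (h1.1 ▸ mem_sel (fun i hi => ?_) hc)
        have : (i, (f.1.getD i .o).id) ∈ f.2 := by
          rw [hα]; exact List.mem_map.2 ⟨i, hi, rfl⟩
        exact h1.1 ▸ h1.2.lt this

theorem BMild.depth {h : BMor} {a b n} (hh : h.IsHom a b) (hm : BMild h)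
    (hb : ∀ c ∈ b, DepthLE n c) : ∀ c ∈ a, DepthLE n c := by
  induction hm generalizing a b with
  | nil => have := hh.src_eq; simp [← this]
  | cons h1 h2 ih =>
    obtain ⟨a, y, b, rfl, rfl, h3, h4⟩ := hh.cons_inv
    simp only [List.mem_cons, forall_eq_or_imp] at hb ⊢
    exact ⟨h1.depth h3 hb.1, ih h4 hb.2⟩

theorem SMild.depth {h a b n} (hh : SeqIsHom h a b) (hm : SMild h)
    (hb : DepthLE n (.arr b)) : DepthLE n (.arr a) := by
  cases n with
  | zero => exact hb
  | succ n =>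
    simp only [DepthLE] at hb ⊢
    induction h generalizing a b with
    | nil => cases hh; simp
    | cons f fs ih =>
      cases hh with
      | cons h1 h2 =>
        simp only [SMild, List.mem_cons, forall_eq_or_imp] at hm hb ⊢
        exact ⟨hm.1.depth h1 hb.1, ih h2 hm.2 hb.2⟩

/-! ### Soundness of the reduction -/

/-- Morphisms of contexts. -/
def CtxHom (θ : CtxMor) (γ δ : Ctx) : Prop := ∀ x, (θ x).IsHom (γ x) (δ x)

/-- The action of a context morphism on environments. -/
noncomputable def CtxMor.actEnv (θ : CtxMor) (ρ : ℕ → List Val) : ℕ → List Val :=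
  fun x => coactEnt (θ x).2 (ρ x)

theorem CtxHom.id (γ : Ctx) : CtxHom (.id γ) γ γ := fun x => idBag_isHom (γ x)

theorem CtxHom.comp {θ η γ δ ζ} (h : CtxHom θ γ δ) (h' : CtxHom η δ ζ) :
    CtxHom (fun x => (η x).comp (θ x)) γ ζ := fun x => (h x).comp (h' x)

theorem CtxHom.tensor {θ η γ δ γ' δ'} (h : CtxHom θ γ δ) (h' : CtxHom η γ' δ') :
    CtxHom (θ.tensor η) (γ.tensor γ') (δ.tensor δ') := fun x => (h x).tensor (h' x)

theorem CtxHom.ground {α : ℕ → List ℕ} {γ : Ctx} (h : ∀ x, ∀ i ∈ α x, i < (γ x).length) :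
    CtxHom (.ground α γ) γ (γ.sel α) := fun x => ground_isHom (h x)

theorem CtxMor.tgt_ground (α : ℕ → List ℕ) (γ : Ctx) : (CtxMor.ground α γ).tgt = γ.sel α := by
  funext x; exact ground_tgt _ _

theorem CtxHom.env {θ γ δ} (h : CtxHom θ γ δ) (ρ) : Env δ (θ.actEnv ρ) := fun x =>
  coactEnt_fst (BMor.isHom_iff.1 (h x)).2 _

theorem CtxMor.actEnv_id {γ : Ctx} {ρ} (h : Env γ ρ) : (CtxMor.id γ).actEnv ρ = ρ := by
  funext x; exact coactEnt_idBag (h x)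

theorem CtxMor.actEnv_comp {θ η γ δ ζ} (h : CtxHom θ γ δ) (h' : CtxHom η δ ζ) {ρ} (hρ : Env γ ρ) :
    CtxMor.actEnv (fun x => (η x).comp (θ x)) ρ = η.actEnv (θ.actEnv ρ) := by
  funext x; exact coactEnt_comp (h x) (h' x) (hρ x)

theorem CtxMor.actEnv_tensor {θ η γ δ} (h : CtxHom θ γ δ) {ρ1 ρ2} (hρ : Env γ ρ1) :
    (θ.tensor η).actEnv (fun x => ρ1 x ++ ρ2 x) = fun x => θ.actEnv ρ1 x ++ η.actEnv ρ2 x := by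
  funext x; exact coactEnt_tensor (h x) (hρ x)

theorem CtxMor.actEnv_ground {γ : Ctx} (α : ℕ → List ℕ) {ρ} (h : Env γ ρ) :
    (CtxMor.ground α γ).actEnv ρ = fun x => sel (ρ x) (α x) := by
  funext x; exact coactEnt_ground _ (h x)

/-- What holds for all steps on terms: the label `(θ; f)` has the right domain and codomain and is
mild, and the denotation of `s` is that of `s'` up to the action of the label. -/
structure StepOK (γ : Ctx) (s : Tm) (a : Ty) (θ : CtxMor) (f : Mor) (γ' : Ctx) (s' : Tm)
    (a' : Ty) : Prop where
  src : HasType γ s a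
  tgt : HasType γ' s' a'
  ctx : CtxHom θ γ γ'
  ty : f.IsHom a' a
  cmild : CMild θ
  mild : TMild f
  sem_eq : ∀ ρ, Env γ ρ → sem s ρ = coactV f (sem s' (θ.actEnv ρ))

/-- The analogue of `StepOK` for bags. -/
structure BagStepOK (γ : Ctx) (s : List Tm) (a : List Ty) (θ : CtxMor) (f : BMor) (γ' : Ctx)
    (s' : List Tm) (a' : List Ty) : Prop where
  src : BagHasType γ s a
  tgt : BagHasType γ' s' a'
  ctx : CtxHom θ γ γ'
  ty : f.IsHom a' a
  cmild : CMild θ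
  mild : BMild f
  sem_eq : ∀ ρ, Env γ ρ → semBag s ρ = coactEnt f.2 (semBag s' (θ.actEnv ρ))

/-- The analogue of `StepOK` for sequences of bags. -/
structure SeqStepOK (γ : Ctx) (s : List (List Tm)) (a : List (List Ty)) (θ : CtxMor)
    (f : List BMor) (γ' : Ctx) (s' : List (List Tm)) (a' : List (List Ty)) : Prop where
  src : SeqHasType γ s a
  tgt : SeqHasType γ' s' a'
  ctx : CtxHom θ γ γ'
  ty : SeqIsHom f a' a
  cmild : CMild θ
  mild : SMild f
  sem_eq : ∀ ρ, Env γ ρ → semSeq s ρ = coactSeqV f (semSeq s' (θ.actEnv ρ))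

theorem reindexSeq_idSeq {b : List (List Ty)} {ν : ℕ → List ℕ}
    (hν : ∀ k (_ : k < b.length), ∀ i ∈ ν k, i < b[k].length) :
    reindexSeq ν (idSeq b) = b.mapIdx fun k c => ground (ν k) c := by
  induction b generalizing ν with
  | nil => rfl
  | cons c b ih =>
    have := ih (ν := fun k => ν (k + 1)) fun k hk => hν (k + 1) (by simpa using hk)
    rw [reindexSeq] at this ⊢
    rw [idSeq, List.mapIdx_cons, List.mapIdx_cons, this]
    congr 1
    have h0 : ∀ i ∈ ν 0, i < c.length := hν 0 (by simp)
    exact (ground_comp (idBag_isHom c) h0).symm.trans (ground_isHom h0).comp_id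

theorem idSeq_map_snd (b : List (List Ty)) : (idSeq b).map Prod.snd = b.map (idEntries 0) := by
  rw [idSeq_eq_map, List.map_map]; rfl

theorem ExpGround.stepOK {γ s a θ f γ' s' a'} (h : ExpGround γ s a θ f γ' s' a') :
    StepOK γ s a θ f γ' s' a' := by
  obtain ⟨hs, hf, hne, rfl, rfl, rfl⟩ := h
  rename_i a b f s
  have hcx : EntCtx γ (fun x => idEntries 0 (γ x)) γ := fun x => idEntries_isHom' _
  have H := act_ok hs _ _ (hcx.ext hf)
  set p := act s (ext (f.map Prod.snd) fun x => idEntries 0 (γ x)) with hp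
  obtain ⟨l1, l2⟩ := Env.lt_cons H.lt
  have hfl := hf.length_src
  rw [← hfl] at l2
  have hν := reindexSeq_isHom (idSeq_isHom b) l1
  rw [reindexSeq_idSeq l1] at hν
  have hid : (((b.mapIdx fun k c => ground (p.2 k) c).map fun g => idBag g.tgt)) =
      idSeq (b.mapIdx fun k c => sel c (p.2 k)) := by
    rw [← hν.tgt_eq, idSeq_eq_map, List.map_map]; rfl
  have hne' : f ≠ [] := by
    rintro rfl
    cases hf
    exact hne rfl
  have hT := H.typed
  rw [Ctx.sel_cons _ _ _ _ hfl.symm] at hT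
  have htgt : HasType (γ.sel fun x => p.2 (x + f.length))
      (.lam (idSeq (b.mapIdx fun k c => sel c (p.2 k))) p.1)
      (.arr (b.mapIdx fun k c => sel c (p.2 k))) := by
    refine .lam (fun h => ?_) (idSeq_isHom _) hT
    rw [idSeq_eq_map, List.map_eq_nil_iff, List.mapIdx_eq_nil_iff] at h
    exact hne' (List.length_eq_zero_iff.1 (by rw [hfl, h]; rfl))
  rw [hid, hν.tgt_eq, CtxMor.tgt_ground]
  refine ⟨.lam hne' hf hs, htgt, CtxHom.ground l2, .arr hν, .ground _ _,
    ⟨_, rfl, ?_⟩, ?_⟩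
  · intro g hg
    obtain ⟨k, hk, rfl⟩ := List.mem_mapIdx.1 hg
    exact ⟨_, rfl⟩
  · intro ρ hρ
    rw [CtxMor.actEnv_ground _ hρ, sem, coactV, hf.src_eq, hν.src_eq]
    refine lamV_congr fun Q hQ => ?_
    have hQ' := seqEnv_coactSeqV hν hQ
    rw [sem, app_lamV (by rw [idSeq_map_fst]; exact hQ'), coactSeqV_id _ hQ',
      ← reindexSeq_idSeq l1, coactSeqV_reindexSeq (idSeq_isHom b) l1 hQ, coactSeqV_id _ hQ,
      ext_mapIdx_sel _ _ _ _ (by rw [hfl, ← hQ, List.length_map]), H.sem_eq _ (hρ.ext hQ),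
      coactEnt_ext hf _ hQ]
    congr 3
    funext x
    exact (coactEnt_idBag (hρ x)).symm

theorem coactV_o {v : Val} (h : v.1 = .o) : coactV (.arr []) v = v := coactV_id .o h

theorem isHom_o : Mor.IsHom (.arr []) .o .o := .arr .nil

theorem TMild.o : TMild (.arr []) := ⟨_, rfl, by simp⟩

theorem CtxHom.mu {δ q a} (hq : SeqHasType δ q a) (f : List BMor) :
    CtxHom (.mu f q δ) δ (δ.sel fun y => muSeq y 0 f q) :=
  .ground fun _ _ hi => muSeq_lt hq hi

theorem LinGround.stepOK {γ s a θ f γ' s' a'} (h : LinGround γ s a θ f γ' s' a') :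
    StepOK γ s a θ f γ' s' a' := by
  obtain ⟨hs, hne, hf, hperm, hq, rfl, rfl, rfl⟩ := h
  rename_i γ δ a b f s q
  have hq' := coactSeq_hasType hq hf
  have hm := CtxHom.mu hq f
  have ht : (CtxMor.mu f q δ).tgt = δ.sel fun y => muSeq y 0 f q := CtxMor.tgt_ground _ _
  change SeqHasType (δ.sel fun y => muSeq y 0 f q) (coactSeq f q) a at hq'
  rw [ht]
  have H := linSubst_ok hs hq'
  have h1 := (CtxHom.id γ).tensor hm
  have h2 := CtxHom.ground H.lt
  rw [CtxMor.tgt_ground]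
  refine ⟨.redex (.lam hne hf hs) hq, H.typed, h1.comp h2, isHom_o,
    .comp h1 h2 ((CMild.id γ).tensor (.ground _ _)) (.ground _ _), .o, ?_⟩
  intro ρ hρ
  rw [CtxMor.actEnv_comp h1 h2 hρ, coactV_o (sem_fst H.typed (h2.env _)),
    CtxMor.actEnv_ground _ (h1.env ρ)]
  obtain ⟨ρ1, ρ2, rfl, e1, e2⟩ := hρ.split
  rw [CtxMor.actEnv_tensor (.id γ) e1, CtxMor.actEnv_id e1, CtxMor.mu, CtxMor.actEnv_ground _ e2,
    H.sem_eq _ _ e1 (e2.sel _), semSeq_coactSeq hq hf e2,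
    sem_redex_append (fun x => by rw [e1.length, occ_eq hs, hf.length_tgt, Ctx.cons_add]), sem]
  have hQ := semSeq_seqEnv hq e2
  rw [app_lamV (by rw [hf.src_eq]; exact hQ)]
  exact base_force (sem_fst hs (e1.ext (seqEnv_coactSeqV hf hQ)))

theorem actEnv_cons {θ : CtxMor} {a : List (List Ty)}
    {n : ℕ} (hn : a.length = n) {Q : List (List Val)}
    (hQ : SeqEnv a Q) (ρ : ℕ → List Val) :
    θ.actEnv (ext Q ρ) = ext (coactSeqV ((List.range n).map θ) Q)
      (CtxMor.actEnv (fun x => θ (x + n)) ρ) := by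
  subst hn
  have hl : Q.length = a.length := by rw [← hQ, List.length_map]
  funext x
  refine ext_cases (P := fun x => θ.actEnv (ext Q ρ) x = ext (coactSeqV ((List.range a.length).map θ) Q)
      (CtxMor.actEnv (fun x => θ (x + a.length)) ρ) x) a.length (fun x hx => ?_) (fun x => ?_) x
  · rw [ext_lt _ _ (by simp [coactSeqV_eq_zipWith, hl, hx]), CtxMor.actEnv, ext_lt _ _ (hl ▸ hx)]
    simp [coactSeqV_eq_zipWith]
  · rw [ext_add' _ _ _ _ (by simp [coactSeqV_eq_zipWith, hl]), CtxMor.actEnv,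
      ext_add' _ _ _ _ hl]
    rfl

theorem mapIdx_comp_eq {θ : CtxMor} {g : List BMor} {n : ℕ} (hn : g.length = n) :
    (g.mapIdx fun k h => (θ k).comp h) = seqComp ((List.range n).map θ) g := by
  subst hn
  rw [seqComp]
  apply List.ext_getElem <;> simp

theorem eq_ext {A : Type} (g : ℕ → A) (n : ℕ) :
    g = ext ((List.range n).map g) fun x => g (x + n) := by
  funext x
  refine ext_cases (P := fun x => g x = ext ((List.range n).map g) (fun x => g (x + n)) x) n
    (fun x hx => ?_) (fun x => ?_) x
  · rw [ext_lt _ _ (by simpa using hx)]; simp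
  · rw [ext_add' _ _ _ _ (by simp)]

theorem map_range_ext {A : Type} (l : List A) (g : ℕ → A) :
    (List.range l.length).map (ext l g) = l := by
  refine List.ext_getElem (by simp) fun i h1 h2 => ?_
  rw [List.getElem_map, List.getElem_range, ext_lt _ _ h2]

/-- A context is determined by the part of the bound variables and the remaining part. -/
theorem Ctx.eq_cons (γ : Ctx) (n : ℕ) :
    γ = .cons ((List.range n).map γ) fun x => γ (x + n) := eq_ext γ n

theorem CtxHom.seqIsHom {θ : CtxMor} {γ γ' : Ctx} {a : List (List Ty)}
    (h : CtxHom θ (.cons a γ) γ') {n : ℕ} (hn : a.length = n) :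
    SeqIsHom ((List.range n).map θ) a ((List.range n).map γ') := by
  subst hn
  have e : (List.range a.length).map (Ctx.cons a γ) = a := map_range_ext a γ
  have key : ∀ l : List ℕ, SeqIsHom (l.map θ) (l.map (Ctx.cons a γ)) (l.map γ') := by
    intro l
    induction l with
    | nil => exact .nil
    | cons i l ih => exact .cons (h i) ih
  have := key (List.range a.length)
  rwa [e] at this

theorem CtxHom.tail {θ : CtxMor} {γ γ' : Ctx} {a : List (List Ty)}
    (h : CtxHom θ (.cons a γ) γ') {n : ℕ} (hn : a.length = n) :
    CtxHom (fun x => θ (x + n)) γ fun x => γ' (x + n) := by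
  subst hn
  intro x
  have := h (x + a.length)
  rwa [Ctx.cons_add] at this

theorem StepOK.lam {γ γ' : Ctx} {a b : List (List Ty)} {g : List BMor} {s s' : Tm} {θ : CtxMor}
    (hne : g ≠ []) (hg : SeqIsHom g b a) (h : StepOK (.cons a γ) s .o θ (.arr []) γ' s' .o) :
    StepOK γ (.lam g s) (.arr b) (fun x => θ (x + g.length)) (Ty.id (.arr b))
      (fun x => γ' (x + g.length)) (.lam (g.mapIdx fun k h => (θ k).comp h) s') (.arr b) := by
  have hn := hg.length_tgt.symm
  have h1 := h.ctx.seqIsHom hn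
  have ht := h.tgt
  rw [γ'.eq_cons g.length] at ht
  rw [mapIdx_comp_eq rfl]
  have hty : HasType (fun x => γ' (x + g.length))
      (.lam (seqComp ((List.range g.length).map θ) g) s') (.arr b) := by
    refine .lam (fun e => ?_) (hg.comp h1) ht
    have := congrArg List.length e
    simp only [seqComp, List.length_zipWith, List.length_map, List.length_range, min_self,
      List.length_nil] at this
    exact hne (List.length_eq_zero_iff.1 this)
  refine ⟨.lam hne hg h.src, hty, h.ctx.tail hn, Ty.id_isHom _,
    fun x => h.cmild _, .id _, fun ρ hρ => ?_⟩
  rw [coactV_id _ (sem_fst hty ((h.ctx.tail hn).env ρ)), sem, sem,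
    seqComp_map_fst (by simp)]
  refine lamV_congr fun Q hQ => ?_
  rw [hg.src_eq] at hQ
  have hQ' := seqEnv_coactSeqV hg hQ
  have he := hρ.ext hQ'
  rw [h.sem_eq _ he, coactV_o (sem_fst h.tgt (h.ctx.env _)), actEnv_cons hn hQ',
    coactSeqV_comp hg h1 hQ]

theorem StepOK.fn {γ γ' δ : Ctx} {f f' h s s' a a' θ q}
    (H : StepOK γ (.lam f s) (.arr a) θ (.arr h) γ' (.lam f' s') (.arr a'))
    (hq : SeqHasType δ q a) :
    StepOK (γ.tensor δ) (.redex f s q) .o (θ.tensor (.mu h q δ)) (.arr [])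
        (γ'.tensor (CtxMor.mu h q δ).tgt) (.redex f' s' (coactSeq h q)) .o := by
  have hh := Mor.isHom_arr_iff.1 H.ty
  have hq' := coactSeq_hasType hq hh
  change SeqHasType (δ.sel fun y => muSeq y 0 h q) (coactSeq h q) a' at hq'
  have hm := CtxHom.mu hq h
  have ht : (CtxMor.mu h q δ).tgt = δ.sel fun y => muSeq y 0 h q := CtxMor.tgt_ground _ _
  rw [ht]
  refine ⟨.redex H.src hq, .redex H.tgt hq', H.ctx.tensor hm, isHom_o,
    H.cmild.tensor (.ground _ _), .o, fun ρ hρ => ?_⟩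
  obtain ⟨ρ1, ρ2, rfl, e1, e2⟩ := hρ.split
  have e3 := H.ctx.env ρ1
  rw [coactV_o (sem_fst (.redex H.tgt hq') ((H.ctx.tensor hm).env _)),
    CtxMor.actEnv_tensor H.ctx e1, CtxMor.mu, CtxMor.actEnv_ground _ e2,
    sem_redex_append (fun x => by rw [e1.length, occ_body_eq H.src]),
    sem_redex_append (fun x => by rw [e3.length, occ_body_eq H.tgt]), H.sem_eq _ e1,
    app_coactV (by rw [hh.src_eq]; exact semSeq_seqEnv hq e2), semSeq_coactSeq hq hh e2]

theorem StepOK.arg {γ δ δ' : Ctx} {f h s a a' θ q q'} (hs : HasType γ (.lam f s) (.arr a))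
    (H : SeqStepOK δ q a θ h δ' q' a') :
    StepOK (γ.tensor δ) (.redex f s q) .o ((CtxMor.id γ).tensor θ) (.arr [])
        (γ.tensor δ') (.redex (seqComp f h) s q') .o := by
  obtain ⟨_, b, e, hne, hf, hb⟩ := hs.lam_inv
  simp only [Ty.arr.injEq] at e
  subst e
  have hc := H.ty.comp hf
  have hs' : HasType γ (.lam (seqComp f h) s) (.arr a') := by
    refine .lam (fun e => ?_) hc hb
    have := congrArg List.length e
    rw [hc.length_tgt, ← hf.length_tgt] at this
    exact hne (List.length_eq_zero_iff.1 this)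
  have hx := (CtxHom.id γ).tensor H.ctx
  refine ⟨.redex hs H.src, .redex hs' H.tgt, hx, isHom_o, (CMild.id γ).tensor H.cmild, .o,
    fun ρ hρ => ?_⟩
  rw [coactV_o (sem_fst (.redex hs' H.tgt) (hx.env _))]
  obtain ⟨ρ1, ρ2, rfl, e1, e2⟩ := hρ.split
  rw [CtxMor.actEnv_tensor (.id γ) e1, CtxMor.actEnv_id e1,
    sem_redex_append (fun x => by rw [e1.length, occ_body_eq hs]),
    sem_redex_append (fun x => by rw [e1.length, occ_body_eq hs'])]
  have hQ := semSeq_seqEnv H.tgt (H.ctx.env ρ2)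
  rw [sem, sem, app_lamV (by rw [hf.src_eq]; exact semSeq_seqEnv H.src e2),
    app_lamV (by rw [hc.src_eq]; exact hQ), H.sem_eq _ e2, coactSeqV_comp H.ty hf hQ]

theorem CtxHom.single {x a b h} (hh : SeqIsHom h b a) :
    CtxHom (.single x (.arr a) (.arr h)) (.single x (.arr a)) (.single x (.arr b)) := by
  intro y
  by_cases hy : y = x
  · simp only [CtxMor.single, Ctx.single, hy, ↓reduceIte]
    exact BMor.isHom_single (.arr hh)
  · simp only [CtxMor.single, Ctx.single, hy, ↓reduceIte]
    exact .mk .nil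

theorem StepOK.varArg {γ γ' : Ctx} {x h a a' θ q q'} (H : SeqStepOK γ q a θ h γ' q' a') :
    StepOK ((Ctx.single x (.arr a)).tensor γ) (.var x q) .o
        ((CtxMor.single x (.arr a) (.arr h)).tensor θ) (.arr [])
        ((Ctx.single x (.arr a')).tensor γ') (.var x q') .o := by
  have h1 : CtxHom (.single x (.arr a) (.arr h)) (.single x (.arr a)) (.single x (.arr a')) :=
    .single H.ty
  have hx := h1.tensor H.ctx
  refine ⟨.var H.src, .var H.tgt, hx, isHom_o, CMild.tensor ?_ H.cmild, .o, fun ρ hρ => ?_⟩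
  · intro y e he
    by_cases hy : y = x
    · simp only [CtxMor.single, hy, ↓reduceIte, List.mem_singleton] at he
      subst he
      exact ⟨h, rfl, H.mild⟩
    · simp [CtxMor.single, hy] at he
  · rw [coactV_o (sem_fst (.var H.tgt) (hx.env _))]
    obtain ⟨v, ρ, rfl, hv, e⟩ := hρ.var_split
    have e1 : Env (Ctx.single x (.arr a)) fun y => if y = x then [v] else [] := by
      intro y
      by_cases hy : y = x <;> simp [Ctx.single, hy, hv]
    have e2 : CtxMor.actEnv (.single x (.arr a) (.arr h)) (fun y => if y = x then [v] else []) =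
        fun y => if y = x then [coactV (.arr h) v] else [] := by
      funext y
      by_cases hy : y = x <;> simp [CtxMor.actEnv, CtxMor.single, hy, coactEnt]
    rw [CtxMor.actEnv_tensor h1 e1, e2, sem_var_cons, sem_var_cons, H.sem_eq _ e,
      app_coactV (by rw [H.ty.src_eq]; exact semSeq_seqEnv H.tgt (H.ctx.env _))]

theorem BagStepOK.head {γ γ' δ : Ctx} {t t' a a' θ f ts b} (H : StepOK γ t a θ f γ' t' a')
    (hs : BagHasType δ ts b) : BagStepOK (γ.tensor δ) (t :: ts) (a :: b) (θ.tensor (.id δ))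
        (BMor.tensor ([a'], [(0, f)]) (idBag b)) (γ'.tensor δ) (t' :: ts) (a' :: b) := by
  have h1 : BMor.IsHom ([a'], [(0, f)]) [a'] [a] := BMor.isHom_single H.ty
  refine ⟨.cons H.src hs, .cons H.tgt hs, H.ctx.tensor (.id δ), h1.tensor (idBag_isHom b),
    H.cmild.tensor (.id δ), .cons H.mild (.id b), fun ρ hρ => ?_⟩
  obtain ⟨ρ1, ρ2, rfl, e1, e2⟩ := hρ.split
  have e3 := H.ctx.env ρ1
  have := coactEnt_tensor (g := idBag b) h1 (u := [sem t' (θ.actEnv ρ1)]) (w := semBag ts ρ2)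
    (by simp [sem_fst H.tgt e3])
  rw [List.singleton_append] at this
  rw [semBag_append (fun x => by rw [e1.length, occ_eq H.src]), CtxMor.actEnv_tensor H.ctx e1,
    CtxMor.actEnv_id e2, semBag_append (fun x => by rw [e3.length, occ_eq H.tgt]), this,
    coactEnt_idBag (semBag_map_fst hs e2), H.sem_eq _ e1]
  simp [coactEnt]

theorem BagStepOK.tail {γ γ' δ : Ctx} {t a b b' θ f ts ts'} (ht : HasType δ t a)
    (H : BagStepOK γ ts b θ f γ' ts' b') :
    BagStepOK (δ.tensor γ) (t :: ts) (a :: b) ((CtxMor.id δ).tensor θ)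
        (BMor.tensor (idBag [a]) f) (δ.tensor γ') (t :: ts') (a :: b') := by
  have h1 := idBag_isHom [a]
  refine ⟨.cons ht H.src, .cons ht H.tgt, (CtxHom.id δ).tensor H.ctx, h1.tensor H.ty,
    (CMild.id δ).tensor H.cmild, .cons (.id a) H.mild, fun ρ hρ => ?_⟩
  obtain ⟨ρ1, ρ2, rfl, e1, e2⟩ := hρ.split
  have ha := sem_fst ht e1
  have := coactEnt_tensor (g := f) h1 (u := [sem t ρ1]) (w := semBag ts' (θ.actEnv ρ2))
    (by simp [ha])
  rw [List.singleton_append] at this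
  rw [semBag_append (fun x => by rw [e1.length, occ_eq ht]), CtxMor.actEnv_tensor (.id δ) e1,
    CtxMor.actEnv_id e1, semBag_append (fun x => by rw [e1.length, occ_eq ht]), this,
    H.sem_eq _ e2, coactEnt_idBag (by simp [ha])]
  simp

theorem SeqStepOK.head {γ γ' δ : Ctx} {q q' a a' θ f qs b} (H : BagStepOK γ q a θ f γ' q' a')
    (hs : SeqHasType δ qs b) : SeqStepOK (γ.tensor δ) (q :: qs) (a :: b) (θ.tensor (.id δ))
        (f :: idSeq b) (γ'.tensor δ) (q' :: qs) (a' :: b) := by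
  refine ⟨.cons H.src hs, .cons H.tgt hs, H.ctx.tensor (.id δ), .cons H.ty (idSeq_isHom b),
    H.cmild.tensor (.id δ), ?_, fun ρ hρ => ?_⟩
  · intro g hg
    rcases List.mem_cons.1 hg with rfl | hg
    exacts [H.mild, SMild.id b g hg]
  obtain ⟨ρ1, ρ2, rfl, e1, e2⟩ := hρ.split
  have e3 := H.ctx.env ρ1
  rw [semSeq_append (fun x => by rw [e1.length, occBag_eq H.src]), CtxMor.actEnv_tensor H.ctx e1,
    CtxMor.actEnv_id e2, semSeq_append (fun x => by rw [e3.length, occBag_eq H.tgt]),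
    coactSeqV_cons, coactSeqV_id b (semSeq_seqEnv hs e2), H.sem_eq _ e1]

theorem SeqStepOK.tail {γ γ' δ : Ctx} {q a b b' θ f qs qs'} (hq : BagHasType δ q a)
    (H : SeqStepOK γ qs b θ f γ' qs' b') :
    SeqStepOK (δ.tensor γ) (q :: qs) (a :: b) ((CtxMor.id δ).tensor θ)
        (idBag a :: f) (δ.tensor γ') (q :: qs') (a :: b') := by
  refine ⟨.cons hq H.src, .cons hq H.tgt, (CtxHom.id δ).tensor H.ctx, .cons (idBag_isHom a) H.ty,
    (CMild.id δ).tensor H.cmild, ?_, fun ρ hρ => ?_⟩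
  · intro g hg
    rcases List.mem_cons.1 hg with rfl | hg
    exacts [.id a, H.mild g hg]
  obtain ⟨ρ1, ρ2, rfl, e1, e2⟩ := hρ.split
  rw [semSeq_append (fun x => by rw [e1.length, occBag_eq hq]), CtxMor.actEnv_tensor (.id δ) e1,
    CtxMor.actEnv_id e1, semSeq_append (fun x => by rw [e1.length, occBag_eq hq]),
    coactSeqV_cons, coactEnt_idBag (semBag_map_fst hq e1), H.sem_eq _ e2]

mutual
theorem Closure.stepOK {R : LabelledRel}
    (hR : ∀ {γ s a θ f γ' s' a'}, R γ s a θ f γ' s' a' → StepOK γ s a θ f γ' s' a') :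
    ∀ {γ s a θ f γ' s' a'}, Closure R γ s a θ f γ' s' a' →
    StepOK γ s a θ f γ' s' a'
  | _, _, _, _, _, _, _, _, .ground h => hR h
  | _, _, _, _, _, _, _, _, .lam hne hg h => (Closure.stepOK @hR h).lam hne hg
  | _, _, _, _, _, _, _, _, .fn h hq => (Closure.stepOK @hR h).fn hq
  | _, _, _, _, _, _, _, _, .arg hs h => .arg hs (SeqClosure.stepOK @hR h)
  | _, _, _, _, _, _, _, _, .varArg h => .varArg (SeqClosure.stepOK @hR h)
theorem BagClosure.stepOK {R : LabelledRel}
    (hR : ∀ {γ s a θ f γ' s' a'}, R γ s a θ f γ' s' a' → StepOK γ s a θ f γ' s' a') :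
    ∀ {γ s a θ f γ' s' a'}, BagClosure R γ s a θ f γ' s' a' →
    BagStepOK γ s a θ f γ' s' a'
  | _, _, _, _, _, _, _, _, .head h hs => .head (Closure.stepOK @hR h) hs
  | _, _, _, _, _, _, _, _, .tail hs h => .tail hs (BagClosure.stepOK @hR h)
theorem SeqClosure.stepOK {R : LabelledRel}
    (hR : ∀ {γ s a θ f γ' s' a'}, R γ s a θ f γ' s' a' → StepOK γ s a θ f γ' s' a') :
    ∀ {γ s a θ f γ' s' a'}, SeqClosure R γ s a θ f γ' s' a' →
    SeqStepOK γ s a θ f γ' s' a'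
  | _, _, _, _, _, _, _, _, .head h hs => .head (BagClosure.stepOK @hR h) hs
  | _, _, _, _, _, _, _, _, .tail hs h => .tail hs (SeqClosure.stepOK @hR h)
end

/-! ### Composition of steps -/

/-- The composite `η ∘ θ` of context morphisms. -/
abbrev CtxMor.comp (η θ : CtxMor) : CtxMor := fun x => (η x).comp (θ x)

theorem CtxHom.id_comp {θ γ δ} (h : CtxHom θ γ δ) : (CtxMor.id δ).comp θ = θ :=
  funext fun x => (h x).id_comp

theorem CtxHom.comp_id {θ γ δ} (h : CtxHom θ γ δ) : θ.comp (.id γ) = θ :=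
  funext fun x => (h x).comp_id

theorem CtxHom.assoc {θ η ζ γ δ γ' δ'} (h : CtxHom θ γ δ) (h' : CtxHom η δ γ')
    (h'' : CtxHom ζ γ' δ') : (ζ.comp η).comp θ = ζ.comp (η.comp θ) :=
  funext fun x => (h x).assoc (h' x) (h'' x)

theorem CtxMor.tensor_comp {θ η θ' η' γ δ ζ γ' δ' ζ'} (h : CtxHom θ γ δ) (h' : CtxHom η δ ζ)
    (k : CtxHom θ' γ' δ') (k' : CtxHom η' δ' ζ') :
    (η.tensor η').comp (θ.tensor θ') = (η.comp θ).tensor (η'.comp θ') :=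
  funext fun x => BMor.tensor_comp (h x) (h' x) (k x) (k' x)

theorem CtxMor.id_tensor (γ δ : Ctx) : CtxMor.id (γ.tensor δ) = (CtxMor.id γ).tensor (.id δ) :=
  funext fun _ => idBag_append _ _

theorem StepOK.refl {γ s a} (h : HasType γ s a) : StepOK γ s a (.id γ) a.id γ s a where
  src := h
  tgt := h
  ctx := .id γ
  ty := a.id_isHom
  cmild := .id γ
  mild := .id a
  sem_eq ρ hρ := by rw [CtxMor.actEnv_id hρ, coactV_id _ (sem_fst h hρ)]

theorem BagStepOK.refl {γ s a} (h : BagHasType γ s a) :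
    BagStepOK γ s a (.id γ) (idBag a) γ s a where
  src := h
  tgt := h
  ctx := .id γ
  ty := idBag_isHom a
  cmild := .id γ
  mild := .id a
  sem_eq ρ hρ := by rw [CtxMor.actEnv_id hρ, coactEnt_idBag (semBag_map_fst h hρ)]

theorem SeqStepOK.refl {γ s a} (h : SeqHasType γ s a) :
    SeqStepOK γ s a (.id γ) (idSeq a) γ s a where
  src := h
  tgt := h
  ctx := .id γ
  ty := idSeq_isHom a
  cmild := .id γ
  mild := .id a
  sem_eq ρ hρ := by rw [CtxMor.actEnv_id hρ, coactSeqV_id _ (semSeq_seqEnv h hρ)]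

theorem StepOK.trans {γ s a θ f γ' s' a' θ' f' γ'' s'' a''} (h : StepOK γ s a θ f γ' s' a')
    (h' : StepOK γ' s' a' θ' f' γ'' s'' a'') :
    StepOK γ s a (θ'.comp θ) (f.comp f') γ'' s'' a'' where
  src := h.src
  tgt := h'.tgt
  ctx := h.ctx.comp h'.ctx
  ty := h'.ty.comp h.ty
  cmild := .comp h.ctx h'.ctx h.cmild h'.cmild
  mild := .comp h'.ty h.ty h'.mild h.mild
  sem_eq ρ hρ := by
    have e := h.ctx.env ρ
    rw [CtxMor.actEnv_comp h.ctx h'.ctx hρ, h.sem_eq _ hρ, h'.sem_eq _ e,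
      coactV_comp h'.ty h.ty (sem_fst h'.tgt (h'.ctx.env _))]

theorem BagStepOK.trans {γ s a θ f γ' s' a' θ' f' γ'' s'' a''} (h : BagStepOK γ s a θ f γ' s' a')
    (h' : BagStepOK γ' s' a' θ' f' γ'' s'' a'') :
    BagStepOK γ s a (θ'.comp θ) (f.comp f') γ'' s'' a'' where
  src := h.src
  tgt := h'.tgt
  ctx := h.ctx.comp h'.ctx
  ty := h'.ty.comp h.ty
  cmild := .comp h.ctx h'.ctx h.cmild h'.cmild
  mild := .comp h'.ty h.ty h'.mild h.mild
  sem_eq ρ hρ := by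
    have e := h.ctx.env ρ
    rw [CtxMor.actEnv_comp h.ctx h'.ctx hρ, h.sem_eq _ hρ, h'.sem_eq _ e,
      coactEnt_comp h'.ty h.ty (semBag_map_fst h'.tgt (h'.ctx.env _))]

theorem SeqStepOK.trans {γ s a θ f γ' s' a' θ' f' γ'' s'' a''} (h : SeqStepOK γ s a θ f γ' s' a')
    (h' : SeqStepOK γ' s' a' θ' f' γ'' s'' a'') :
    SeqStepOK γ s a (θ'.comp θ) (seqComp f f') γ'' s'' a'' where
  src := h.src
  tgt := h'.tgt
  ctx := h.ctx.comp h'.ctx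
  ty := h'.ty.comp h.ty
  cmild := .comp h.ctx h'.ctx h.cmild h'.cmild
  mild := .comp h'.ty h.ty h'.mild h.mild
  sem_eq ρ hρ := by
    have e := h.ctx.env ρ
    rw [CtxMor.actEnv_comp h.ctx h'.ctx hρ, h.sem_eq _ hρ, h'.sem_eq _ e,
      coactSeqV_comp h'.ty h.ty (semSeq_seqEnv h'.tgt (h'.ctx.env _))]

/-! ### Reduction sequences on terms, bags and sequences of bags -/

/-- Structural reduction of bags. -/
def BagStructural (γ : Ctx) (s : List Tm) (a : List Ty) (θ : CtxMor) (f : BMor) (γ' : Ctx)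
    (s' : List Tm) (a' : List Ty) : Prop :=
  BagClosure ExpGround γ s a θ f γ' s' a' ∨ BagClosure LinGround γ s a θ f γ' s' a'

/-- Structural reduction of sequences of bags. -/
def SeqStructural (γ : Ctx) (s : List (List Tm)) (a : List (List Ty)) (θ : CtxMor) (f : List BMor)
    (γ' : Ctx) (s' : List (List Tm)) (a' : List (List Ty)) : Prop :=
  SeqClosure ExpGround γ s a θ f γ' s' a' ∨ SeqClosure LinGround γ s a θ f γ' s' a'

theorem Structural.stepOK {γ s a θ f γ' s' a'} (h : Structural γ s a θ f γ' s' a') :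
    StepOK γ s a θ f γ' s' a' :=
  h.elim (Closure.stepOK ExpGround.stepOK) (Closure.stepOK LinGround.stepOK)

theorem BagStructural.stepOK {γ s a θ f γ' s' a'} (h : BagStructural γ s a θ f γ' s' a') :
    BagStepOK γ s a θ f γ' s' a' :=
  h.elim (BagClosure.stepOK ExpGround.stepOK) (BagClosure.stepOK LinGround.stepOK)

theorem SeqStructural.stepOK {γ s a θ f γ' s' a'} (h : SeqStructural γ s a θ f γ' s' a') :
    SeqStepOK γ s a θ f γ' s' a' :=
  h.elim (SeqClosure.stepOK ExpGround.stepOK) (SeqClosure.stepOK LinGround.stepOK)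

/-- Reduction sequences between typed terms, with the composite of the labels. -/
inductive LStar : LabelledRel
  | refl {γ s a} : HasType γ s a → LStar γ s a (.id γ) a.id γ s a
  | head {γ s a θ f γ' s' a' θ' f' γ'' s'' a''} : Structural γ s a θ f γ' s' a' →
      LStar γ' s' a' θ' f' γ'' s'' a'' → LStar γ s a (θ'.comp θ) (f.comp f') γ'' s'' a''

/-- Reduction sequences between typed bags. -/
inductive BagStar : Ctx → List Tm → List Ty → CtxMor → BMor → Ctx → List Tm → List Ty → Prop
  | refl {γ s a} : BagHasType γ s a → BagStar γ s a (.id γ) (idBag a) γ s a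
  | head {γ s a θ f γ' s' a' θ' f' γ'' s'' a''} : BagStructural γ s a θ f γ' s' a' →
      BagStar γ' s' a' θ' f' γ'' s'' a'' → BagStar γ s a (θ'.comp θ) (f.comp f') γ'' s'' a''

/-- Reduction sequences between typed sequences of bags. -/
inductive SeqStar : Ctx → List (List Tm) → List (List Ty) → CtxMor → List BMor → Ctx →
    List (List Tm) → List (List Ty) → Prop
  | refl {γ s a} : SeqHasType γ s a → SeqStar γ s a (.id γ) (idSeq a) γ s a
  | head {γ s a θ f γ' s' a' θ' f' γ'' s'' a''} : SeqStructural γ s a θ f γ' s' a' →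
      SeqStar γ' s' a' θ' f' γ'' s'' a'' → SeqStar γ s a (θ'.comp θ) (seqComp f f') γ'' s'' a''

theorem LStar.ok {γ s a θ f γ' s' a'} (h : LStar γ s a θ f γ' s' a') :
    StepOK γ s a θ f γ' s' a' := by
  induction h with
  | refl h => exact .refl h
  | head h _ ih => exact h.stepOK.trans ih

theorem BagStar.ok {γ s a θ f γ' s' a'} (h : BagStar γ s a θ f γ' s' a') :
    BagStepOK γ s a θ f γ' s' a' := by
  induction h with
  | refl h => exact .refl h
  | head h _ ih => exact h.stepOK.trans ih

theorem SeqStar.ok {γ s a θ f γ' s' a'} (h : SeqStar γ s a θ f γ' s' a') :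
    SeqStepOK γ s a θ f γ' s' a' := by
  induction h with
  | refl h => exact .refl h
  | head h _ ih => exact h.stepOK.trans ih

theorem LStar.single {γ s a θ f γ' s' a'} (h : Structural γ s a θ f γ' s' a') :
    LStar γ s a θ f γ' s' a' := by
  have := LStar.head h (.refl h.stepOK.tgt)
  rwa [h.stepOK.ctx.id_comp, h.stepOK.ty.comp_id] at this

theorem LStar.trans {γ s a θ f γ' s' a' θ' f' γ'' s'' a''} (h : LStar γ s a θ f γ' s' a')
    (h' : LStar γ' s' a' θ' f' γ'' s'' a'') : LStar γ s a (θ'.comp θ) (f.comp f') γ'' s'' a'' := by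
  induction h with
  | refl h => rwa [h'.ok.ctx.comp_id, h'.ok.ty.id_comp]
  | head h hs ih =>
    rw [← h.stepOK.ctx.assoc hs.ok.ctx h'.ok.ctx, h'.ok.ty.assoc hs.ok.ty h.stepOK.ty]
    exact .head h (ih h')

theorem BagStar.trans {γ s a θ f γ' s' a' θ' f' γ'' s'' a''} (h : BagStar γ s a θ f γ' s' a')
    (h' : BagStar γ' s' a' θ' f' γ'' s'' a'') :
    BagStar γ s a (θ'.comp θ) (f.comp f') γ'' s'' a'' := by
  induction h with
  | refl h => rwa [h'.ok.ctx.comp_id, h'.ok.ty.id_comp]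
  | head h hs ih =>
    rw [← h.stepOK.ctx.assoc hs.ok.ctx h'.ok.ctx, h'.ok.ty.assoc hs.ok.ty h.stepOK.ty]
    exact .head h (ih h')

theorem SeqStar.trans {γ s a θ f γ' s' a' θ' f' γ'' s'' a''} (h : SeqStar γ s a θ f γ' s' a')
    (h' : SeqStar γ' s' a' θ' f' γ'' s'' a'') :
    SeqStar γ s a (θ'.comp θ) (seqComp f f') γ'' s'' a'' := by
  induction h with
  | refl h => rwa [h'.ok.ctx.comp_id, h'.ok.ty.id_comp]
  | head h hs ih =>
    rw [← h.stepOK.ctx.assoc hs.ok.ctx h'.ok.ctx, h'.ok.ty.assoc hs.ok.ty h.stepOK.ty]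
    exact .head h (ih h')

/-! ### Closure of reduction sequences under the term formers -/

theorem BagStructural.head {γ γ' δ : Ctx} {t t' a a' θ f ts b}
    (h : Structural γ t a θ f γ' t' a') (hs : BagHasType δ ts b) :
    BagStructural (γ.tensor δ) (t :: ts) (a :: b) (θ.tensor (.id δ))
      (BMor.tensor ([a'], [(0, f)]) (idBag b)) (γ'.tensor δ) (t' :: ts) (a' :: b) :=
  h.imp (.head · hs) (.head · hs)

theorem BagStructural.tail {γ γ' δ : Ctx} {t a b b' θ f ts ts'} (ht : HasType δ t a)
    (h : BagStructural γ ts b θ f γ' ts' b') :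
    BagStructural (δ.tensor γ) (t :: ts) (a :: b) ((CtxMor.id δ).tensor θ)
      (BMor.tensor (idBag [a]) f) (δ.tensor γ') (t :: ts') (a :: b') :=
  h.imp (.tail ht ·) (.tail ht ·)

theorem SeqStructural.head {γ γ' δ : Ctx} {q q' a a' θ f qs b}
    (h : BagStructural γ q a θ f γ' q' a') (hs : SeqHasType δ qs b) :
    SeqStructural (γ.tensor δ) (q :: qs) (a :: b) (θ.tensor (.id δ))
      (f :: idSeq b) (γ'.tensor δ) (q' :: qs) (a' :: b) :=
  h.imp (.head · hs) (.head · hs)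

theorem SeqStructural.tail {γ γ' δ : Ctx} {q a b b' θ f qs qs'} (hq : BagHasType δ q a)
    (h : SeqStructural γ qs b θ f γ' qs' b') :
    SeqStructural (δ.tensor γ) (q :: qs) (a :: b) ((CtxMor.id δ).tensor θ)
      (idBag a :: f) (δ.tensor γ') (q :: qs') (a :: b') :=
  h.imp (.tail hq ·) (.tail hq ·)

theorem BMor.single_comp {m m' : Mor} {a b : Ty} :
    BMor.comp ([b], [(0, m)]) ([a], [(0, m')]) = ([a], [(0, m.comp m')]) := rfl

theorem BagStar.head_lift {γ γ' δ : Ctx} {t t' a a' θ f ts b} (h : LStar γ t a θ f γ' t' a')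
    (hs : BagHasType δ ts b) :
    BagStar (γ.tensor δ) (t :: ts) (a :: b) (θ.tensor (.id δ))
      (BMor.tensor ([a'], [(0, f)]) (idBag b)) (γ'.tensor δ) (t' :: ts) (a' :: b) := by
  induction h with
  | @refl γ s a h =>
    have := BagStar.refl (.cons h hs)
    rw [CtxMor.id_tensor, show a :: b = [a] ++ b from rfl, idBag_append] at this
    exact this
  | @head γ s a θ f γ' s' a' θ' f' γ'' s'' a'' h h' ih =>
    have := BagStar.head (.head h hs) ih
    rwa [CtxMor.tensor_comp h.stepOK.ctx h'.ok.ctx (.id δ) (.id δ), (CtxHom.id δ).id_comp,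
      BMor.tensor_comp (BMor.isHom_single h'.ok.ty) (BMor.isHom_single h.stepOK.ty) (idBag_isHom b)
        (idBag_isHom b), (idBag_isHom b).id_comp] at this

theorem BagStar.tail_lift {γ γ' δ : Ctx} {t a b b' θ f ts ts'} (ht : HasType δ t a)
    (h : BagStar γ ts b θ f γ' ts' b') :
    BagStar (δ.tensor γ) (t :: ts) (a :: b) ((CtxMor.id δ).tensor θ)
      (BMor.tensor (idBag [a]) f) (δ.tensor γ') (t :: ts') (a :: b') := by
  have h1 := idBag_isHom [a]
  induction h with
  | @refl γ s b h =>
    have := BagStar.refl (.cons ht h)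
    rw [CtxMor.id_tensor, show a :: b = [a] ++ b from rfl, idBag_append] at this
    exact this
  | @head γ s b θ f γ' s' a' θ' f' γ'' s'' a'' h h' ih =>
    have := BagStar.head (.tail ht h) ih
    rwa [CtxMor.tensor_comp (.id δ) (.id δ) h.stepOK.ctx h'.ok.ctx, (CtxHom.id δ).id_comp,
      BMor.tensor_comp h1 h1 h'.ok.ty h.stepOK.ty, h1.id_comp] at this

/-- Reductions of the head and of the tail of a bag are carried out one after the other. -/
theorem BagStar.cons {γ γ' δ δ' : Ctx} {t t' a a' θ f ts ts' b b' η k}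
    (h : LStar γ t a θ f γ' t' a') (hs : BagStar δ ts b η k δ' ts' b') :
    BagStar (γ.tensor δ) (t :: ts) (a :: b) (θ.tensor η)
      (BMor.tensor ([a'], [(0, f)]) k) (γ'.tensor δ') (t' :: ts') (a' :: b') := by
  have := (BagStar.head_lift h hs.ok.src).trans (.tail_lift h.ok.tgt hs)
  rwa [CtxMor.tensor_comp h.ok.ctx (.id _) (.id _) hs.ok.ctx, h.ok.ctx.id_comp, hs.ok.ctx.comp_id,
    BMor.tensor_comp (idBag_isHom _) (BMor.isHom_single h.ok.ty) hs.ok.ty (idBag_isHom _),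
    (BMor.isHom_single h.ok.ty).comp_id, hs.ok.ty.id_comp] at this

theorem SeqStar.head_lift {γ γ' δ : Ctx} {q q' a a' θ f qs b} (h : BagStar γ q a θ f γ' q' a')
    (hs : SeqHasType δ qs b) :
    SeqStar (γ.tensor δ) (q :: qs) (a :: b) (θ.tensor (.id δ))
      (f :: idSeq b) (γ'.tensor δ) (q' :: qs) (a' :: b) := by
  have h1 := (idSeq_isHom b).id_comp
  rw [seqComp] at h1
  induction h with
  | @refl γ s a h =>
    have := SeqStar.refl (.cons h hs)
    rwa [CtxMor.id_tensor] at this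
  | @head γ s a θ f γ' s' a' θ' f' γ'' s'' a'' h h' ih =>
    have := SeqStar.head (.head h hs) ih
    rwa [CtxMor.tensor_comp h.stepOK.ctx h'.ok.ctx (.id δ) (.id δ), (CtxHom.id δ).id_comp,
      seqComp, List.zipWith_cons_cons, h1] at this

theorem SeqStar.tail_lift {γ γ' δ : Ctx} {q a b b' θ f qs qs'} (hq : BagHasType δ q a)
    (h : SeqStar γ qs b θ f γ' qs' b') :
    SeqStar (δ.tensor γ) (q :: qs) (a :: b) ((CtxMor.id δ).tensor θ)
      (idBag a :: f) (δ.tensor γ') (q :: qs') (a :: b') := by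
  induction h with
  | @refl γ s b h =>
    have := SeqStar.refl (.cons hq h)
    rwa [CtxMor.id_tensor] at this
  | @head γ s b θ f γ' s' a' θ' f' γ'' s'' a'' h h' ih =>
    have := SeqStar.head (.tail hq h) ih
    rwa [CtxMor.tensor_comp (.id δ) (.id δ) h.stepOK.ctx h'.ok.ctx, (CtxHom.id δ).id_comp,
      seqComp, List.zipWith_cons_cons, (idBag_isHom a).id_comp] at this

theorem SeqStar.cons {γ γ' δ δ' : Ctx} {q q' a a' θ f qs qs' b b' η k}
    (h : BagStar γ q a θ f γ' q' a') (hs : SeqStar δ qs b η k δ' qs' b') :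
    SeqStar (γ.tensor δ) (q :: qs) (a :: b) (θ.tensor η)
      (f :: k) (γ'.tensor δ') (q' :: qs') (a' :: b') := by
  have := (SeqStar.head_lift h hs.ok.src).trans (.tail_lift h.ok.tgt hs)
  have h1 := hs.ok.ty.id_comp
  rw [seqComp] at h1
  rwa [CtxMor.tensor_comp h.ok.ctx (.id _) (.id _) hs.ok.ctx, h.ok.ctx.id_comp, hs.ok.ctx.comp_id,
    seqComp, List.zipWith_cons_cons, h.ok.ty.comp_id, h1] at this

theorem CtxMor.id_single (x : ℕ) (a : Ty) : CtxMor.id (.single x a) = .single x a a.id := by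
  funext y
  by_cases hy : y = x <;> simp [CtxMor.id, CtxMor.single, Ctx.single, hy, idBag, idEntries]

theorem CtxMor.single_comp {x : ℕ} {a b : Ty} {f g : Mor} :
    (CtxMor.single x b g).comp (.single x a f) = .single x a (g.comp f) := by
  funext y
  by_cases hy : y = x
  · simp only [CtxMor.comp, CtxMor.single, hy, ↓reduceIte]; rfl
  · simp only [CtxMor.comp, CtxMor.single, hy, ↓reduceIte]; rfl

theorem o_comp : Mor.comp (.arr []) (.arr []) = .arr [] := by rw [Mor.comp_arr]; rfl

theorem LStar.varArg {γ γ' : Ctx} {x h a a' θ q q'} (H : SeqStar γ q a θ h γ' q' a') :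
    LStar ((Ctx.single x (.arr a)).tensor γ) (.var x q) .o
      ((CtxMor.single x (.arr a) (.arr h)).tensor θ) (.arr [])
      ((Ctx.single x (.arr a')).tensor γ') (.var x q') .o := by
  induction H with
  | @refl γ q a hq =>
    have := LStar.refl (HasType.var (x := x) hq)
    rwa [CtxMor.id_tensor, CtxMor.id_single, Ty.id] at this
  | @head γ q a θ h γ' q' a' θ' h' γ'' q'' a'' H H' ih =>
    have := LStar.head (H.imp (Closure.varArg (x := x)) .varArg) ih
    rwa [CtxMor.tensor_comp (.single H.stepOK.ty) (.single H'.ok.ty) H.stepOK.ctx H'.ok.ctx,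
      CtxMor.single_comp, o_comp, Mor.comp_arr] at this

theorem LStar.redexArg {γ δ δ' : Ctx} {f h s a a' θ q q'} (hs : HasType γ (.lam f s) (.arr a))
    (H : SeqStar δ q a θ h δ' q' a') :
    LStar (γ.tensor δ) (.redex f s q) .o ((CtxMor.id γ).tensor θ) (.arr [])
      (γ.tensor δ') (.redex (seqComp f h) s q') .o := by
  induction H generalizing f with
  | @refl δ q a hq =>
    have := LStar.refl (hs.redex hq)
    obtain ⟨_, b, e, hne, hf, hb⟩ := hs.lam_inv
    cases e
    rw [hf.comp_id]
    rwa [CtxMor.id_tensor] at this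
  | @head δ q a θ h δ' q' a' θ' h' δ'' q'' a'' H H' ih =>
    have h1 : Structural _ _ _ _ _ _ _ _ := H.imp (Closure.arg hs) (.arg hs)
    have h2 := hs.coact (.arr H.stepOK.ty)
    have := LStar.head h1 (ih h2)
    obtain ⟨_, b, e, hne, hf, hb⟩ := hs.lam_inv
    cases e
    rwa [CtxMor.tensor_comp (.id γ) (.id γ) H.stepOK.ctx H'.ok.ctx, (CtxHom.id γ).id_comp,
      SeqIsHom.assoc H'.ok.ty H.stepOK.ty hf, o_comp] at this

theorem isHom_o_inv {f a} (h : Mor.IsHom f a .o) : a = .o ∧ f = .arr [] := by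
  cases h with
  | arr h => cases h; exact ⟨rfl, rfl⟩

theorem HasType.coact_id {γ t a} (h : HasType γ t a) : ResourceCalculus.coact a.id t = t := by
  cases h with
  | lam _ hf _ => rw [Ty.id, ResourceCalculus.coact, hf.comp_id]
  | var _ => rfl
  | redex _ _ => rfl

theorem BagHasType.mem {γ q a} (h : BagHasType γ q a) {i : ℕ} (hi : i < a.length) :
    ∃ δ, HasType δ (q.getD i default) (a.getD i default) :=
  ⟨_, h.block (fun _ => []) (fun _ => []) hi⟩

theorem coactBag_id {γ q a} (h : BagHasType γ q a) : coactBag (idBag a) q = q := by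
  rw [coactBag, idBag, idEntries_eq_map, List.map_map, ← h.length]
  refine List.ext_getElem (by simp) fun i h1 h2 => ?_
  obtain ⟨δ, ht⟩ := h.mem (i := i) (h.length ▸ h2)
  simpa [h2] using ht.coact_id

theorem coactSeq_id {γ q a} (h : SeqHasType γ q a) : coactSeq (idSeq a) q = q := by
  induction q generalizing γ a with
  | nil => cases h; rfl
  | cons t ts ih =>
    cases h with
    | cons h1 h2 =>
      rw [idSeq, coactSeq, List.zipWith_cons_cons, ← coactSeq, ih h2]
      exact congrArg (· :: ts) (coactBag_id h1)

theorem flatten_blocks (y k : ℕ) (q : List Tm) :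
    (blocks y k q).flatten = List.range' k (occBag y q) := by
  induction q generalizing k with
  | nil => rfl
  | cons t ts ih =>
    rw [blocks, List.flatten_cons, ih, occBag, List.range'_append_1]

theorem length_blocks (y k : ℕ) (q : List Tm) : (blocks y k q).length = q.length := by
  induction q generalizing k with
  | nil => rfl
  | cons t ts ih => rw [blocks, List.length_cons, ih, List.length_cons]

theorem muSeq_id {γ q a} (h : SeqHasType γ q a) (y k : ℕ) :
    muSeq y k (idSeq a) q = List.range' k (occSeq y q) := by
  induction q generalizing γ a k with
  | nil => cases h; rfl
  | cons t ts ih =>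
    cases h with
    | @cons _ _ c _ _ as h1 h2 =>
      rw [idSeq, muSeq, ih h2, occSeq, ← List.range'_append_1, ← flatten_blocks]
      congr 1
      rw [idEntries_eq_map, List.flatMap_map, ← h1.length, ← length_blocks y k]
      simp only [Nat.zero_add, List.flatMap]
      congr 1
      exact List.ext_getElem (by simp) fun i h1 h2 => by simp [h2]

theorem CtxMor.mu_id {δ q a} (h : SeqHasType δ q a) : CtxMor.mu (idSeq a) q δ = .id δ := by
  rw [CtxMor.id_eq_ground, CtxMor.mu]
  congr 1
  funext x
  rw [muSeq_id h, occSeq_eq h, List.range_eq_range']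

theorem map_range_comp (n : ℕ) (θ η : CtxMor) : (List.range n).map (η.comp θ) =
    seqComp ((List.range n).map η) ((List.range n).map θ) := by
  apply List.ext_getElem <;> simp [seqComp]

theorem map_range_id {γ : Ctx} {a : List (List Ty)} {n : ℕ} (hn : a.length = n) :
    (List.range n).map (CtxMor.id (.cons a γ)) = idSeq a := by
  subst hn
  have e : (List.range a.length).map (Ctx.cons a γ) = a := map_range_ext a γ
  rw [idSeq_eq_map]
  conv_rhs => rw [← e]
  exact (List.map_map (f := (Ctx.cons a γ : ℕ → List Ty))).symm

theorem length_map_range {A : Type} (n : ℕ) (g : ℕ → A) : ((List.range n).map g).length = n := by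
  simp

theorem seqComp_ne_nil {g f : List BMor} (h : g.length = f.length) (hf : f ≠ []) :
    seqComp g f ≠ [] := by
  intro e
  have := congrArg List.length e
  simp only [seqComp, List.length_zipWith, h, min_self, List.length_nil] at this
  exact hf (List.length_eq_zero_iff.1 this)

/-- Reductions of the body of an abstraction; the labels for the bound variables accumulate in the
annotation. -/
theorem LStar.lam {γ γ' : Ctx} {a b : List (List Ty)} {g : List BMor} {s s' : Tm} {θ : CtxMor}
    {f : Mor} {c : Ty} (hne : g ≠ []) (hg : SeqIsHom g b a)
    (h : LStar (.cons a γ) s .o θ f γ' s' c) :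
    LStar γ (.lam g s) (.arr b) (fun x => θ (x + g.length)) (Ty.id (.arr b))
      (fun x => γ' (x + g.length)) (.lam (seqComp ((List.range g.length).map θ) g) s') (.arr b) := by
  generalize hΓ : Ctx.cons a γ = Γ at h
  generalize ho : Ty.o = o at h
  induction h generalizing a γ g with
  | @refl Γ s _ h =>
    subst hΓ ho
    rw [map_range_id hg.length_tgt.symm, hg.id_comp]
    have e : (fun x => Ctx.cons a γ (x + g.length)) = γ := by
      funext x; rw [hg.length_tgt, Ctx.cons_add]
    have := LStar.refl (HasType.lam hne hg h)
    rw [e]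
    convert this using 1
    funext x
    rw [CtxMor.id, hg.length_tgt, Ctx.cons_add]; rfl
  | @head Γ s _ θ f Γ' s' d θ' f' γ'' s'' a'' H H' ih =>
    subst hΓ ho
    obtain ⟨rfl, rfl⟩ := isHom_o_inv H.stepOK.ty
    have h1 : Structural γ (.lam g s) (.arr b) (fun x => θ (x + g.length)) (Ty.id (.arr b))
        (fun x => Γ' (x + g.length)) (.lam (g.mapIdx fun k h => (θ k).comp h) s') (.arr b) :=
      H.imp (.lam hne hg ·) (.lam hne hg ·)
    rw [mapIdx_comp_eq rfl] at h1
    have hs := H.stepOK.ctx.seqIsHom hg.length_tgt.symm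
    have hl : (seqComp ((List.range g.length).map θ) g).length = g.length := by simp [seqComp]
    have h2 := ih (seqComp_ne_nil (by simp) hne) (hg.comp hs) (Γ'.eq_cons g.length).symm rfl
    rw [hl] at h2
    have := LStar.head h1 h2
    have hc := H'.ok.ctx
    rw [Γ'.eq_cons g.length] at hc
    rw [map_range_comp, SeqIsHom.assoc hg hs (hc.seqIsHom (length_map_range _ _))]
    rwa [(Ty.id_isHom (.arr b)).comp_id] at this

/-- Reductions of the body of the abstraction in a redex. They do not affect the argument, as the
type of the abstraction is kept. -/
theorem LStar.redexBody {γ γ' δ : Ctx} {a b : List (List Ty)} {g : List BMor} {s s' : Tm}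
    {θ : CtxMor} {f : Mor} {c : Ty} {q : List (List Tm)} (hne : g ≠ []) (hg : SeqIsHom g b a)
    (h : LStar (.cons a γ) s .o θ f γ' s' c) (hq : SeqHasType δ q b) :
    LStar (γ.tensor δ) (.redex g s q) .o (CtxMor.tensor (fun x => θ (x + g.length)) (.id δ))
      (.arr []) (Ctx.tensor (fun x => γ' (x + g.length)) δ)
      (.redex (seqComp ((List.range g.length).map θ) g) s' q) .o := by
  generalize hΓ : Ctx.cons a γ = Γ at h
  generalize ho : Ty.o = o at h
  induction h generalizing a γ g with
  | @refl Γ s _ h =>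
    subst hΓ ho
    rw [map_range_id hg.length_tgt.symm, hg.id_comp]
    have e : (fun x => Ctx.cons a γ (x + g.length)) = γ := by
      funext x; rw [hg.length_tgt, Ctx.cons_add]
    have := LStar.refl ((HasType.lam hne hg h).redex hq)
    rw [e]
    rw [Ty.id, idSeq] at this
    convert this using 1
    rw [CtxMor.id_tensor]
    congr 1
    funext x
    rw [CtxMor.id, hg.length_tgt, Ctx.cons_add]; rfl
  | @head Γ s _ θ f Γ' s' d θ' f' γ'' s'' a'' H H' ih =>
    subst hΓ ho
    obtain ⟨rfl, rfl⟩ := isHom_o_inv H.stepOK.ty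
    have h1 : Structural (γ.tensor δ) (.redex g s q) .o
        (CtxMor.tensor (fun x => θ (x + g.length)) (.mu (idSeq b) q δ)) (.arr [])
        (Ctx.tensor (fun x => Γ' (x + g.length)) (CtxMor.mu (idSeq b) q δ).tgt)
        (.redex (g.mapIdx fun k h => (θ k).comp h) s' (coactSeq (idSeq b) q)) .o := by
      refine H.imp (fun h => .fn (a' := b) ?_ hq) (fun h => .fn (a' := b) ?_ hq)
      · have := Closure.lam hne hg h; rwa [Ty.id] at this
      · have := Closure.lam hne hg h; rwa [Ty.id] at this
    have ht : (CtxMor.id δ).tgt = δ := funext fun x => (idBag_isHom _).tgt_eq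
    rw [mapIdx_comp_eq rfl, coactSeq_id hq, CtxMor.mu_id hq, ht] at h1
    have hs := H.stepOK.ctx.seqIsHom hg.length_tgt.symm
    have hl : (seqComp ((List.range g.length).map θ) g).length = g.length := by simp [seqComp]
    have h2 := ih (seqComp_ne_nil (by simp) hne) (hg.comp hs) (Γ'.eq_cons g.length).symm rfl
    rw [hl] at h2
    have := LStar.head h1 h2
    have hc := H'.ok.ctx
    rw [Γ'.eq_cons g.length] at hc
    rw [map_range_comp, SeqIsHom.assoc hg hs (hc.seqIsHom (length_map_range _ _))]
    rwa [o_comp, CtxMor.tensor_comp (H.stepOK.ctx.tail hg.length_tgt.symm) (hc.tail (length_map_range _ _)) (.id δ)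
      (.id δ), (CtxHom.id δ).id_comp] at this

/-! ### The action of ground morphisms -/

theorem Ctx.sel_split {δ γ γ' : Ctx} {α : ℕ → List ℕ} (h : δ.sel α = γ.tensor γ') :
    ∃ α1 α2, α = (fun x => α1 x ++ α2 x) ∧ δ.sel α1 = γ ∧ δ.sel α2 = γ' := by
  have hx : ∀ x, (α x).map (fun i => (δ x).getD i default) = γ x ++ γ' x := fun x => congrFun h x
  refine ⟨fun x => (α x).take (γ x).length, fun x => (α x).drop (γ x).length, by funext x; simp,
    ?_, ?_⟩
  · funext x
    simp only [Ctx.sel, ResourceCalculus.sel, List.map_take, hx, List.take_left]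
  · funext x
    simp only [Ctx.sel, ResourceCalculus.sel, List.map_drop, hx, List.drop_left]

theorem Ctx.sel_length {δ γ : Ctx} {α : ℕ → List ℕ} (h : δ.sel α = γ) (x : ℕ) :
    (α x).length = (γ x).length := by
  rw [← h, Ctx.sel, length_sel]

/-- The entries of the ground morphism given by `α`. -/
def groundEnt (α : List ℕ) (a : List Ty) : List (ℕ × Mor) := (ground α a).2

theorem length_groundEnt (α a) : (groundEnt α a).length = α.length := by
  simp [groundEnt, ground]

theorem groundEnt_append (α β a) : groundEnt (α ++ β) a = groundEnt α a ++ groundEnt β a := by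
  simp [groundEnt, ground]

theorem ext_groundEnt (b : List (List Ty)) (δ : Ctx) (α : ℕ → List ℕ) :
    ext (b.map (idEntries 0)) (fun x => groundEnt (α x) (δ x)) =
      fun x => groundEnt (ext (b.map fun c => List.range c.length) α x) (Ctx.cons b δ x) := by
  funext x
  refine ext_cases (P := fun x => ext (b.map (idEntries 0)) (fun x => groundEnt (α x) (δ x)) x =
      groundEnt (ext (b.map fun c => List.range c.length) α x) (Ctx.cons b δ x)) b.length
    (fun x hx => ?_) (fun x => ?_) x
  · rw [ext_lt _ _ (by simpa using hx), ext_lt _ _ (by simpa using hx), Ctx.cons_lt hx,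
      List.getElem_map, List.getElem_map]
    exact congrArg Prod.snd (idBag_eq_ground _)
  · rw [ext_add' _ _ _ _ (by simp), ext_add' _ _ _ _ (by simp), Ctx.cons_add]

theorem sel_cons_range (b : List (List Ty)) (δ : Ctx) (α : ℕ → List ℕ) :
    (Ctx.cons b δ).sel (ext (b.map fun c => List.range c.length) α) = .cons b (δ.sel α) := by
  funext x
  refine ext_cases (P := fun x => (Ctx.cons b δ).sel (ext (b.map fun c => List.range c.length) α) x
      = Ctx.cons b (δ.sel α) x) b.length (fun x hx => ?_) (fun x => ?_) x
  · rw [Ctx.sel, ext_lt _ _ (by simpa using hx), Ctx.cons_lt hx, Ctx.cons_lt hx, List.getElem_map,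
      sel_range]
  · rw [Ctx.sel, ext_add' _ _ _ _ (by simp), Ctx.cons_add, Ctx.cons_add]; rfl

theorem reindexSeq_range {f a b} (hf : SeqIsHom f a b) {ν : ℕ → List ℕ}
    (hν : ∀ k (_ : k < b.length), ν k = List.range b[k].length) : reindexSeq ν f = f := by
  refine List.ext_getElem (by simp [reindexSeq]) fun k h1 h2 => ?_
  have hb : k < b.length := hf.length_tgt ▸ h2
  simp only [reindexSeq, List.getElem_mapIdx, reindex, hν k hb]
  have hl : f[k].2.length = b[k].length := by
    have := hf.tgt_eq
    subst this
    simp [BMor.tgt]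
  refine Prod.ext rfl ?_
  rw [← hl]
  exact sel_range _

theorem act_ground_lam {γ δ : Ctx} {f s a b α} (hf : SeqIsHom f a b)
    (ih : ∀ (δ : Ctx) α, δ.sel α = .cons b γ → act s (fun x => groundEnt (α x) (δ x)) = (s, α))
    (h : δ.sel α = γ) : act (.lam f s) (fun x => groundEnt (α x) (δ x)) = (.lam f s, α) := by
  have h2 := hf.length_tgt
  rw [act, map_idEntries_tgt hf, idSeq_map_snd, ext_groundEnt,
    ih _ _ ((sel_cons_range b δ α).trans (by rw [h]))]
  refine Prod.ext ?_ ?_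
  · simp only
    rw [reindexSeq_range hf]
    intro k hk
    rw [ext_lt _ _ (by simpa using hk), List.getElem_map]
  · funext x
    simp only
    rw [ext_add' _ _ _ _ (by simp [h2])]

mutual
/-- A term is unchanged by the action of a ground morphism onto its context. -/
theorem act_ground : ∀ {γ s a}, HasType γ s a → ∀ (δ : Ctx) α, δ.sel α = γ →
    act s (fun x => groundEnt (α x) (δ x)) = (s, α)
  | _, _, _, .var (x := x) (a := a) hq, δ, α, h => by
    obtain ⟨α1, α2, rfl, h1, h2⟩ := Ctx.sel_split h
    obtain ⟨i, hi⟩ : ∃ i, α1 x = [i] := by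
      have := Ctx.sel_length h1 x
      rw [Ctx.single, if_pos rfl] at this
      exact List.length_eq_one_iff.1 this
    have h1' : α1 = fun y => if y = x then [i] else [] := by
      funext y
      by_cases hy : y = x
      · simp only [hy, hi, ↓reduceIte]
      · have := Ctx.sel_length h1 y
        rw [Ctx.single, if_neg hy] at this
        rw [if_neg hy]
        exact List.length_eq_zero_iff.1 this
    subst h1'
    have ha : (δ x).getD i default = .arr a := by
      have := congrFun h1 x
      simpa [Ctx.sel, Ctx.single, ResourceCalculus.sel] using this
    have e : (fun y => groundEnt ((if y = x then [i] else []) ++ α2 y) (δ y)) =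
        fun y => (if y = x then [(i, .arr (idSeq a))] else []) ++ groundEnt (α2 y) (δ y) := by
      funext y
      rw [groundEnt_append]
      by_cases hy : y = x
      · subst hy
        have ha' : (δ y).getD i .o = .arr a := ha
        simp only [↓reduceIte, groundEnt, ground, List.map_cons, List.map_nil, ha', Ty.id]
      · simp only [hy, ↓reduceIte, groundEnt, ground, List.map_nil]
    rw [e, act_var_cons, actSeq_ground hq δ α2 h2, coactSeq_id hq]
    refine Prod.ext rfl ?_
    funext y
    simp only
    rw [muSeq_id hq, occSeq_eq hq, ← Ctx.sel_length h2, ← List.range_eq_range', sel_range]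
  | _, _, _, .lam _ hf hs, _, _, h => act_ground_lam hf (act_ground hs) h
  | _, _, _, .redex hs hq, δ, α, h => by
    obtain ⟨α1, α2, rfl, h1, h2⟩ := Ctx.sel_split h
    simp only [groundEnt_append]
    obtain ⟨f', s', ν, e1, e2⟩ := act_redex_append (q := _)
      (θ1 := fun x => groundEnt (α1 x) (δ x)) (θ2 := fun x => groundEnt (α2 x) (δ x))
      (fun x => by rw [length_groundEnt, Ctx.sel_length h1, occ_body_eq hs])
    rw [e2, actSeq_ground hq δ α2 h2]
    rw [act_ground hs δ α1 h1, Prod.mk.injEq, Tm.lam.injEq] at e1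
    obtain ⟨⟨rfl, rfl⟩, rfl⟩ := e1
    rfl
theorem actBag_ground : ∀ {γ s a}, BagHasType γ s a → ∀ (δ : Ctx) α, δ.sel α = γ →
    actBag s (fun x => groundEnt (α x) (δ x)) = (s, α)
  | _, _, _, .nil, δ, α, h => by
    rw [actBag]
    refine Prod.ext rfl (funext fun x => ?_)
    exact (List.length_eq_zero_iff.1 (Ctx.sel_length h x)).symm
  | _, _, _, .cons hs hq, δ, α, h => by
    obtain ⟨α1, α2, rfl, h1, h2⟩ := Ctx.sel_split h
    simp only [groundEnt_append]
    rw [actBag_append (fun x => by rw [length_groundEnt, Ctx.sel_length h1, occ_eq hs]),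
      act_ground hs δ α1 h1, actBag_ground hq δ α2 h2]
theorem actSeq_ground : ∀ {γ s a}, SeqHasType γ s a → ∀ (δ : Ctx) α, δ.sel α = γ →
    actSeq s (fun x => groundEnt (α x) (δ x)) = (s, α)
  | _, _, _, .nil, δ, α, h => by
    rw [actSeq]
    refine Prod.ext rfl (funext fun x => ?_)
    exact (List.length_eq_zero_iff.1 (Ctx.sel_length h x)).symm
  | _, _, _, .cons hs hq, δ, α, h => by
    obtain ⟨α1, α2, rfl, h1, h2⟩ := Ctx.sel_split h
    simp only [groundEnt_append]
    rw [actSeq_append (fun x => by rw [length_groundEnt, Ctx.sel_length h1, occBag_eq hs]),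
      actBag_ground hs δ α1 h1, actSeq_ground hq δ α2 h2]
end

/-! ### Renaming the positions in a context morphism -/

/-- Entries with the positions renamed by `π`. -/
def remap (π : ℕ → ℕ) (es : List (ℕ × Mor)) : List (ℕ × Mor) := es.map (Prod.map π id)

theorem length_remap (π es) : (remap π es).length = es.length := by simp [remap]

theorem remap_append (π es es') : remap π (es ++ es') = remap π es ++ remap π es' := by
  simp [remap]

theorem ext_remap {n : ℕ} (l : List (List (ℕ × Mor))) (hl : l.length = n)
    (θ : ℕ → List (ℕ × Mor)) (π : ℕ → ℕ → ℕ) :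
    ext l (fun x => remap (π x) (θ x)) =
      fun x => remap (ext (List.replicate n id) π x) (ext l θ x) := by
  subst hl
  funext x
  refine ext_cases (P := fun x => ext l (fun x => remap (π x) (θ x)) x =
      remap (ext (List.replicate l.length id) π x) (ext l θ x)) l.length
    (fun x hx => ?_) (fun x => ?_) x
  · rw [ext_lt _ _ hx, ext_lt _ _ hx, ext_lt _ _ (by simpa using hx)]
    simp [remap]
  · rw [ext_add' _ _ _ _ rfl, ext_add' _ _ _ _ rfl, ext_add' _ _ _ _ (by simp)]

theorem map_sel_of_lt (π : ℕ → ℕ) {l α : List ℕ} (h : ∀ i ∈ α, i < l.length) :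
    sel (l.map π) α = (sel l α).map π := by
  simp only [sel, List.map_map]
  refine List.map_congr_left fun i hi => ?_
  simp [h i hi]

theorem act_remap_lam {γ δ : Ctx} {f s a b θ} (hf : SeqIsHom f a b)
    (ih : ∀ δ θ, EntCtx δ θ (.cons b γ) → ∀ π : ℕ → ℕ → ℕ, act s (fun x => remap (π x) (θ x)) =
      ((act s θ).1, fun x => ((act s θ).2 x).map (π x)))
    (h : EntCtx δ θ γ) (π : ℕ → ℕ → ℕ) : act (.lam f s) (fun x => remap (π x) (θ x)) =
      ((act (.lam f s) θ).1, fun x => ((act (.lam f s) θ).2 x).map (π x)) := by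
  rw [act, ext_remap _ (by simp) (n := f.length), ih _ _ (by
    rw [map_idEntries_tgt hf]; exact h.ext (idSeq_isHom b))]
  refine Prod.ext ?_ ?_
  · simp only [act, Tm.lam.injEq, and_true]
    rw [reindexSeq, reindexSeq]
    refine List.ext_getElem (by simp) fun k h1 h2 => ?_
    rw [List.length_mapIdx] at h1
    rw [List.getElem_mapIdx, List.getElem_mapIdx, ext_lt _ _ (by simpa using h1)]
    simp
  · funext x
    simp only [act]
    rw [ext_add' _ _ _ _ (by simp)]

mutual
/-- The action does not depend on the positions in the domain of the context morphism, except that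
the resulting ground morphism is made of these positions. -/
theorem act_remap : ∀ {γ s a}, HasType γ s a → ∀ δ θ, EntCtx δ θ γ → ∀ π : ℕ → ℕ → ℕ,
    act s (fun x => remap (π x) (θ x)) = ((act s θ).1, fun x => ((act s θ).2 x).map (π x))
  | _, _, _, .var (x := x) hq, δ, θ, h, π => by
    obtain ⟨i, f, c, θ, rfl, hi, hf, hθ⟩ := h.var_split
    have e : (fun y => remap (π y) ((if y = x then [(i, .arr f)] else []) ++ θ y)) =
        fun y => (if y = x then [(π x i, .arr f)] else []) ++ remap (π y) (θ y) := by
      funext y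
      by_cases hy : y = x <;> simp [remap, hy]
    rw [e, act_var_cons, act_var_cons, actSeq_remap hq δ θ hθ]
    refine Prod.ext rfl (funext fun y => ?_)
    simp only
    rw [map_sel_of_lt, List.map_append]
    · by_cases hy : y = x <;> simp [hy]
    · intro i hi
      simpa [Ctx.sel] using muSeq_lt (actSeq_ok hq δ θ hθ).typed hi
  | _, _, _, .lam _ hf hs, _, _, h, π => act_remap_lam hf (act_remap hs) h π
  | _, _, _, .redex hs hq, δ, θ, h, π => by
    obtain ⟨θ1, θ2, rfl, h1, h2⟩ := h.split
    simp only [remap_append]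
    obtain ⟨f', s', ν, e1, e2⟩ := act_redex_append (q := _)
      (θ1 := fun x => remap (π x) (θ1 x)) (θ2 := fun x => remap (π x) (θ2 x))
      (fun x => by rw [length_remap, h1.length, occ_body_eq hs])
    obtain ⟨f'', s'', ν', e3, e4⟩ := act_redex_append (q := _) (θ1 := θ1) (θ2 := θ2)
      (fun x => by rw [h1.length, occ_body_eq hs])
    rw [e2, e4, actSeq_remap hq δ θ2 h2]
    rw [act_remap hs δ θ1 h1, e3, Prod.mk.injEq, Tm.lam.injEq] at e1
    obtain ⟨⟨rfl, rfl⟩, rfl⟩ := e1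
    simp
theorem actBag_remap : ∀ {γ s a}, BagHasType γ s a → ∀ δ θ, EntCtx δ θ γ → ∀ π : ℕ → ℕ → ℕ,
    actBag s (fun x => remap (π x) (θ x)) =
      ((actBag s θ).1, fun x => ((actBag s θ).2 x).map (π x))
  | _, _, _, .nil, _, _, _, _ => rfl
  | _, _, _, .cons hs hq, δ, θ, h, π => by
    obtain ⟨θ1, θ2, rfl, h1, h2⟩ := h.split
    simp only [remap_append]
    rw [actBag_append (fun x => by rw [length_remap, h1.length, occ_eq hs]),
      actBag_append (fun x => by rw [h1.length, occ_eq hs]),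
      act_remap hs δ θ1 h1, actBag_remap hq δ θ2 h2]
    simp
theorem actSeq_remap : ∀ {γ s a}, SeqHasType γ s a → ∀ δ θ, EntCtx δ θ γ → ∀ π : ℕ → ℕ → ℕ,
    actSeq s (fun x => remap (π x) (θ x)) =
      ((actSeq s θ).1, fun x => ((actSeq s θ).2 x).map (π x))
  | _, _, _, .nil, _, _, _, _ => rfl
  | _, _, _, .cons hs hq, δ, θ, h, π => by
    obtain ⟨θ1, θ2, rfl, h1, h2⟩ := h.split
    simp only [remap_append]
    rw [actSeq_append (fun x => by rw [length_remap, h1.length, occBag_eq hs]),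
      actSeq_append (fun x => by rw [h1.length, occBag_eq hs]),
      actBag_remap hs δ θ1 h1, actSeq_remap hq δ θ2 h2]
    simp
end

/-! ### Complete exponential reduction of an abstraction -/

/-- The action on the body of an abstraction with annotation `g`, and free variables `γ`. -/
def expAct (γ : Ctx) (g : List BMor) (s : Tm) : Tm × (ℕ → List ℕ) :=
  act s (ext (g.map Prod.snd) fun x => idEntries 0 (γ x))

/-- An abstraction reduces to one whose annotation is the identity. There is no step if the
annotation is the identity already; the labels are given by the action in any case. -/
theorem LStar.exp {γ : Ctx} {a b : List (List Ty)} {g : List BMor} {s : Tm} (hne : g ≠ [])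
    (hg : SeqIsHom g b a) (hs : HasType (.cons a γ) s .o) {p : Tm × (ℕ → List ℕ)}
    (hp : p = expAct γ g s) :
    LStar γ (.lam g s) (.arr b) (.ground (fun x => p.2 (x + g.length)) γ)
      (.arr (b.mapIdx fun k c => ground (p.2 k) c)) (γ.sel fun x => p.2 (x + g.length))
      (.lam (idSeq (b.mapIdx fun k c => sel c (p.2 k))) p.1)
      (.arr (b.mapIdx fun k c => sel c (p.2 k))) := by
  -- If the annotation is the identity, then the action is that of an identity, so it is trivial.
  by_cases h : g = idSeq b
  · subst h
    have hab : a = b := hg.tgt_eq.symm.trans (idSeq_isHom b).tgt_eq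
    subst hab
    have e : p = (s, ext (a.map fun c => List.range c.length) fun x => List.range (γ x).length) := by
      rw [hp, expAct, idSeq_map_snd]
      have := ext_groundEnt a γ fun x => List.range (γ x).length
      rw [show (fun x => groundEnt (List.range (γ x).length) (γ x)) = fun x => idEntries 0 (γ x) from
        funext fun x => (congrArg Prod.snd (idBag_eq_ground (γ x))).symm] at this
      rw [this]
      refine act_ground hs _ _ ((sel_cons_range a γ _).trans ?_)
      congr 1
      funext x
      exact sel_range _
    have e1 : ∀ x, p.2 (x + (idSeq a).length) = List.range (γ x).length := by
      intro x
      rw [e]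
      simp only
      rw [ext_add' _ _ _ _ (by simp [idSeq_eq_map])]
    have e2 : ∀ k (_ : k < a.length), p.2 k = List.range a[k].length := by
      intro k hk
      rw [e]
      simp only
      rw [ext_lt _ _ (by simpa using hk), List.getElem_map]
    have e3 : (a.mapIdx fun k c => ground (p.2 k) c) = idSeq a := by
      rw [idSeq_eq_map]
      refine List.ext_getElem (by simp) fun k h1 h2 => ?_
      rw [List.length_mapIdx] at h1
      rw [List.getElem_mapIdx, List.getElem_map, e2 k h1, idBag_eq_ground]
    have e4 : (a.mapIdx fun k c => sel c (p.2 k)) = a := by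
      refine List.ext_getElem (by simp) fun k h1 h2 => ?_
      rw [List.getElem_mapIdx, e2 k h2, sel_range]
    have e5 : γ.sel (fun x => p.2 (x + (idSeq a).length)) = γ := by
      funext x
      rw [Ctx.sel, e1, sel_range]
    have e6 : CtxMor.ground (fun x => p.2 (x + (idSeq a).length)) γ = .id γ := by
      rw [CtxMor.id_eq_ground]
      congr 1
      funext x
      exact e1 x
    have e7 : p.1 = s := by rw [e]
    rw [e3, e4, e5, e6, e7]
    have := LStar.refl (HasType.lam hne hg hs)
    rwa [Ty.id] at this
  · have h1 := ExpGround.mk hs hg h hp rfl rfl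
    have h2 := LStar.single (.inl (.ground h1))
    have hid : (((b.mapIdx fun k c => ground (p.2 k) c).map fun g => idBag g.tgt)) =
        idSeq (b.mapIdx fun k c => sel c (p.2 k)) := by
      rw [idSeq_eq_map]
      refine List.ext_getElem (by simp) fun k h1 h2 => ?_
      simp [ground_tgt]
    have htg : (b.mapIdx fun k c => ground (p.2 k) c).map BMor.tgt =
        b.mapIdx fun k c => sel c (p.2 k) := by
      refine List.ext_getElem (by simp) fun k h1 h2 => ?_
      simp [ground_tgt]
    rwa [hid, htg, CtxMor.tgt_ground] at h2

/-! ### Reduction to redex-free terms -/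

theorem depthLE_of_sizeOf : ∀ (n : ℕ) (a : Ty), sizeOf a ≤ n → DepthLE n a
  | 0, .arr bs, h => by simp at h
  | n + 1, .arr bs, h => by
    intro b hb a ha
    have h1 := List.sizeOf_lt_of_mem hb
    have h2 := List.sizeOf_lt_of_mem ha
    simp only [Ty.arr.sizeOf_spec] at h
    exact depthLE_of_sizeOf n a (by omega)

theorem eventually_mem_mem {P : ℕ → Tm → Prop} {q : List (List Tm)}
    (h : ∀ b ∈ q, ∀ t ∈ b, ∀ᶠ d in Filter.atTop, P d t) :
    ∀ᶠ d in Filter.atTop, ∀ b ∈ q, ∀ t ∈ b, P d t :=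
  (Filter.eventually_all_finite (List.finite_toSet q)).2 fun b hb =>
    (Filter.eventually_all_finite (List.finite_toSet b)).2 (h b hb)

/-- Every term satisfies `Deg d` for sufficiently large `d`. -/
theorem Deg.eventually : ∀ s : Tm, ∀ᶠ d in Filter.atTop, Deg d s
  | .var x q => by
    refine (eventually_mem_mem fun b hb t ht => Deg.eventually t).mono fun d h => .var h
  | .lam f s => (Deg.eventually s).mono fun d h => .lam h
  | .redex f s q => by
    filter_upwards [eventually_mem_mem fun b hb t ht => Deg.eventually t, Deg.eventually s,
      Filter.eventually_ge_atTop (sizeOf (Ty.arr (f.map Prod.fst)))] with d h1 h2 h3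
    exact .redex (depthLE_of_sizeOf d _ h3) h2 h1
termination_by s => sizeOf s
decreasing_by
  all_goals first
    | (have h1 := List.sizeOf_lt_of_mem hb
       have h2 := List.sizeOf_lt_of_mem ht
       simp
       omega)
    | (simp <;> omega)

theorem Deg.rf : ∀ (n : ℕ) {s : Tm}, Deg 0 s → sizeOf s ≤ n → RF n s
  | 0, s, _, h => by cases s <;> simp at h
  | n + 1, _, .var hq, h => by
    intro b hb t ht
    have h1 := List.sizeOf_lt_of_mem hb
    have h2 := List.sizeOf_lt_of_mem ht
    simp at h
    exact Deg.rf n (hq b hb t ht) (by omega)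
  | n + 1, _, .lam hs, h => by
    simp at h
    exact Deg.rf n hs (by omega)
  | _ + 1, _, .redex h _ _, _ => h.elim

theorem expAct_ok {γ : Ctx} {a b : List (List Ty)} {g : List BMor} {s : Tm} (hg : SeqIsHom g b a)
    (hs : HasType (.cons a γ) s .o) :
    ActTm (.cons b γ) (ext (g.map Prod.snd) fun x => idEntries 0 (γ x)) s .o :=
  act_ok hs _ _ (EntCtx.ext (fun _ => idEntries_isHom' _) hg)

theorem expAct_lt {γ : Ctx} {a b : List (List Ty)} {g : List BMor} {s : Tm} (hg : SeqIsHom g b a)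
    (hs : HasType (.cons a γ) s .o) :
    (∀ k (_ : k < b.length), ∀ i ∈ (expAct γ g s).2 k, i < b[k].length) ∧
      ∀ x, ∀ i ∈ (expAct γ g s).2 (x + g.length), i < (γ x).length := by
  obtain ⟨h1, h2⟩ := Env.lt_cons (expAct_ok hg hs).lt
  rw [← hg.length_src] at h2
  exact ⟨h1, h2⟩

theorem expAct_typed {γ : Ctx} {a b : List (List Ty)} {g : List BMor} {s : Tm}
    (hg : SeqIsHom g b a) (hs : HasType (.cons a γ) s .o) :
    HasType (.cons (b.mapIdx fun k c => sel c ((expAct γ g s).2 k))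
      (γ.sel fun x => (expAct γ g s).2 (x + g.length))) (expAct γ g s).1 .o := by
  have := (expAct_ok hg hs).typed
  rwa [Ctx.sel_cons _ _ _ _ hg.length_src.symm] at this

/-- Some reduct of the term has the property `P`. -/
def Reach (P : Tm → Prop) (γ : Ctx) (s : Tm) (a : Ty) : Prop :=
  ∃ θ f γ' s' a', LStar γ s a θ f γ' s' a' ∧ P s'

/-- All terms of some reduct of the bag have the property `P`. -/
def BagReach (P : Tm → Prop) (γ : Ctx) (q : List Tm) (a : List Ty) : Prop :=
  ∃ θ f γ' q' a', BagStar γ q a θ f γ' q' a' ∧ ∀ t ∈ q', P t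

/-- All terms of some reduct of the sequence of bags have the property `P`. -/
def SeqReach (P : Tm → Prop) (γ : Ctx) (q : List (List Tm)) (a : List (List Ty)) : Prop :=
  ∃ θ f γ' q' a', SeqStar γ q a θ f γ' q' a' ∧ ∀ b ∈ q', ∀ t ∈ b, P t

theorem Reach.of_star {P γ s a θ f γ' s' a'} (h : LStar γ s a θ f γ' s' a')
    (h' : Reach P γ' s' a') : Reach P γ s a := by
  obtain ⟨_, _, _, _, _, h1, h2⟩ := h'
  exact ⟨_, _, _, _, _, h.trans h1, h2⟩

/-- Firing a redex whose annotation is the identity. -/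
theorem Reach.linear {d : ℕ} {γ δ : Ctx} {a : List (List Ty)} {s : Tm} {q : List (List Tm)}
    (hne : a ≠ []) (hs : HasType (.cons a γ) s .o) (hq : SeqHasType δ q a)
    (ha : DepthLE (d + 1) (.arr a)) (hsd : Deg d s) (hqd : ∀ b ∈ q, ∀ t ∈ b, Deg d t) :
    Reach (Deg d) (γ.tensor δ) (.redex (idSeq a) s q) .o := by
  have hperm : ∀ g ∈ idSeq a, g.IsPerm := by
    intro g hg
    rw [idSeq_eq_map] at hg
    obtain ⟨c, _, rfl⟩ := List.mem_map.1 hg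
    exact ⟨_, .refl _, idBag_eq_ground c⟩
  have hne' : idSeq a ≠ [] := by rwa [idSeq_eq_map, Ne, List.map_eq_nil_iff]
  have h := LinGround.mk hs hne' (idSeq_isHom a) hperm hq rfl rfl rfl
  refine ⟨_, _, _, _, _, .single (.inr (.ground h)), ?_⟩
  rw [coactSeq_id hq]
  exact (linSubst_ok hs hq).deg d hsd hqd ha

/-- Firing a redex: an exponential step, if the annotation is not the identity, is followed by a
linear one. -/
theorem Reach.redex {d : ℕ} {γ δ : Ctx} {a b : List (List Ty)} {f : List BMor} {s : Tm}
    {q : List (List Tm)} (hne : f ≠ []) (hf : SeqIsHom f a b) (hs : HasType (.cons b γ) s .o)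
    (hq : SeqHasType δ q a) (ha : DepthLE (d + 1) (.arr a)) (hsd : Deg d s)
    (hqd : ∀ b ∈ q, ∀ t ∈ b, Deg d t) : Reach (Deg d) (γ.tensor δ) (.redex f s q) .o := by
  have ha0 : a ≠ [] := fun e => hne (List.length_eq_zero_iff.1 (by rw [hf.length_src, e]; rfl))
  by_cases h : f = idSeq a
  · subst h
    have hab : b = a := hf.tgt_eq.symm.trans (idSeq_isHom a).tgt_eq
    subst hab
    exact .linear ha0 hs hq ha hsd hqd
  · have h1 := ExpGround.mk hs hf h (p := expAct γ f s) rfl rfl rfl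
    have hid : ((a.mapIdx fun k c => ground ((expAct γ f s).2 k) c).map fun g => idBag g.tgt) =
        idSeq (a.mapIdx fun k c => sel c ((expAct γ f s).2 k)) := by
      rw [idSeq_eq_map]
      refine List.ext_getElem (by simp) fun k h1 h2 => ?_
      simp [ground_tgt]
    have hν := (Mor.isHom_arr_iff.1 h1.stepOK.ty)
    have htg := hν.tgt_eq
    have h2 : Structural _ _ _ _ _ _ _ _ := .inl (.fn (.ground h1) hq)
    refine .of_star (.single h2) ?_
    have hlt := expAct_lt hf hs
    have hT := expAct_typed hf hs
    have hq' := coactSeq_hasType hq hν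
    have hts : (a.mapIdx fun k c => ground ((expAct γ f s).2 k) c).map BMor.tgt =
        a.mapIdx fun k c => sel c ((expAct γ f s).2 k) := by
      refine List.ext_getElem (by simp) fun k h1 h2 => ?_
      simp [ground_tgt]
    rw [hid, CtxMor.tgt_ground, CtxMor.mu, CtxMor.tgt_ground]
    rw [hts] at hq'
    refine .linear ?_ hT hq' ?_ ?_ ?_
    · rwa [Ne, List.mapIdx_eq_nil_iff]
    · intro b hb c hc
      obtain ⟨k, hk, rfl⟩ := List.mem_mapIdx.1 hb
      -- The exponential step selects entries of `a`, so that the depth does not grow.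
      exact ha _ (List.getElem_mem hk) c (mem_sel (hlt.1 k hk) hc)
    · exact (expAct_ok hf hs).deg d hsd
    · exact forall_coactSeq (fun m t ht => ht.coact m) hqd hq hν

mutual
/-- Firing all redexes, the innermost ones first, lowers the bound on the types of the redexes:
a redex that is created by firing a redex has an argument of the latter as its abstraction. -/
theorem Reach.descend {d : ℕ} : ∀ {γ s a}, HasType γ s a → Deg (d + 1) s → Reach (Deg d) γ s a
  | _, _, _, .var hq, hd => by
    obtain ⟨_, _, _, _, _, h1, h2⟩ := SeqReach.descend hq (Deg.var_iff.1 hd)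
    exact ⟨_, _, _, _, _, .varArg h1, .var h2⟩
  | _, _, _, .lam hne hf hs, hd => by
    obtain ⟨_, _, _, _, _, h1, h2⟩ := Reach.descend hs (Deg.lam_iff.1 hd)
    exact ⟨_, _, _, _, _, .lam hne hf h1, .lam h2⟩
  | _, _, _, .redex (f := f) (.lam hne hf hs) hq, hd => by
    obtain ⟨_, hda, hds, hdq⟩ : _ ∧ _ ∧ _ ∧ _ := by
      cases hd with
      | redex h1 h2 h3 => exact ⟨trivial, h1, h2, h3⟩
    rw [hf.src_eq] at hda
    obtain ⟨η, k, Γ, s', c, h1, h2⟩ := Reach.descend hs hds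
    obtain ⟨θ, h, δ', q', a', h3, h4⟩ := SeqReach.descend hq hdq
    obtain ⟨rfl, rfl⟩ := isHom_o_inv h1.ok.ty
    -- The body and the arguments are reduced before the redex itself is fired.
    refine .of_star (.redexBody hne hf h1 hq) ?_
    have h5 := (LStar.lam hne hf h1).ok.tgt
    refine .of_star (.redexArg h5 h3) ?_
    have hn := hf.length_tgt.symm
    have hη := h1.ok.ctx.seqIsHom hn
    have hs' := h1.ok.tgt
    rw [Γ.eq_cons f.length] at hs'
    have hf1 := hf.comp hη
    refine .redex ?_ (h3.ok.ty.comp hf1) hs' h3.ok.tgt (h3.ok.mild.depth h3.ok.ty hda) h2 h4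
    refine fun e => hne (List.length_eq_zero_iff.1 ?_)
    rw [← length_map_range f.length Γ]
    refine (h3.ok.ty.comp hf1).length_tgt.symm.trans ?_
    rw [e]
    rfl
theorem BagReach.descend {d : ℕ} : ∀ {γ q a}, BagHasType γ q a → (∀ t ∈ q, Deg (d + 1) t) →
    BagReach (Deg d) γ q a
  | _, _, _, .nil, _ => ⟨_, _, _, _, _, .refl .nil, by simp⟩
  | _, _, _, .cons ht hq, hd => by
    rw [List.forall_mem_cons] at hd
    obtain ⟨_, _, _, _, _, h1, h2⟩ := Reach.descend ht hd.1
    obtain ⟨_, _, _, _, _, h3, h4⟩ := BagReach.descend hq hd.2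
    exact ⟨_, _, _, _, _, .cons h1 h3, List.forall_mem_cons.2 ⟨h2, h4⟩⟩
theorem SeqReach.descend {d : ℕ} : ∀ {γ q a}, SeqHasType γ q a →
    (∀ b ∈ q, ∀ t ∈ b, Deg (d + 1) t) → SeqReach (Deg d) γ q a
  | _, _, _, .nil, _ => ⟨_, _, _, _, _, .refl .nil, by simp⟩
  | _, _, _, .cons ht hq, hd => by
    rw [List.forall_mem_cons] at hd
    obtain ⟨_, _, _, _, _, h1, h2⟩ := BagReach.descend ht hd.1
    obtain ⟨_, _, _, _, _, h3, h4⟩ := SeqReach.descend hq hd.2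
    exact ⟨_, _, _, _, _, .cons h1 h3, List.forall_mem_cons.2 ⟨h2, h4⟩⟩
end

/-- Every typed term reduces to a redex-free one. -/
theorem Reach.redexFree {γ s a} (hs : HasType γ s a) : Reach (fun t => ∃ n, RF n t) γ s a := by
  have key : ∀ (d : ℕ) {γ s a}, HasType γ s a → Deg d s → Reach (Deg 0) γ s a := by
    intro d
    induction d with
    | zero => exact fun hs hd => ⟨_, _, _, _, _, .refl hs, hd⟩
    | succ d ih =>
      intro γ s a hs hd
      obtain ⟨_, _, _, _, _, h1, h2⟩ := Reach.descend hs hd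
      exact .of_star h1 (ih h1.ok.tgt h2)
  obtain ⟨d, hd⟩ := (Deg.eventually s).exists
  obtain ⟨_, _, _, _, _, h1, h2⟩ := key d hs hd
  exact ⟨_, _, _, _, _, h1, _, h2.rf _ le_rfl⟩

/-! ### Observing values -/

mutual
/-- The observation of a value of the given type at level `L`, that is, in the presence of `L`
variables. An abstraction of `k` variables is applied to the variables `L + k - 1, …, L`. -/
noncomputable def reify : Ty → Val → Obs
  | .arr b, v => fun L =>
    .lam b (app v (reflectSeq b ((L + b.length : ℕ) - 1 : ℤ)) (L + b.length))
/-- The observation of a bag of values. -/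
noncomputable def reifyBag : List Ty → List Val → ℕ → List Tree
  | [], _, _ => []
  | a :: as, vs, L => reify a (vs.headD default) L :: reifyBag as vs.tail L
/-- The observation of a sequence of bags of values. -/
noncomputable def reifySeq : List (List Ty) → List (List Val) → ℕ → List (List Tree)
  | [], _, _ => []
  | b :: bs, Q, L => reifyBag b (Q.headD default) L :: reifySeq bs Q.tail L
/-- The value of an occurrence of a variable: its name is `n`, and the occurrence corresponds to the
entry `i` of its intersection type. -/
noncomputable def reflect : Ty → ℤ → ℕ → Val
  | .arr b, n, i => lamV b fun Q L => .var n i (reifySeq b Q L)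
/-- The values of the occurrences of the variable `n` from the entry `i` on. -/
noncomputable def reflectBag : List Ty → ℤ → ℕ → List Val
  | [], _, _ => []
  | a :: as, n, i => reflect a n i :: reflectBag as n (i + 1)
/-- The values of the occurrences of a sequence of variables with descending names, from `n` on. -/
noncomputable def reflectSeq : List (List Ty) → ℤ → List (List Val)
  | [], _ => []
  | b :: bs, n => reflectBag b n 0 :: reflectSeq bs (n - 1)
end

theorem reflect_fst : ∀ (a : Ty) (n i), (reflect a n i).1 = a
  | .arr b, n, i => by rw [reflect]; rfl

theorem reflectBag_fst (a : List Ty) (n : ℤ) (i : ℕ) : (reflectBag a n i).map Sigma.fst = a := by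
  induction a generalizing i with
  | nil => simp [reflectBag]
  | cons c a ih => rw [reflectBag, List.map_cons, ih, reflect_fst]

theorem reflectBag_getElem? {a : List Ty} {j : ℕ} {c : Ty} (h : a[j]? = some c) (n : ℤ) (i : ℕ) :
    (reflectBag a n i)[j]? = some (reflect c n (i + j)) := by
  induction a generalizing i j with
  | nil => simp at h
  | cons d a ih =>
    cases j with
    | zero => simp at h; subst h; simp [reflectBag]
    | succ j =>
      rw [reflectBag, List.getElem?_cons_succ, ih (by simpa using h)]
      rw [Nat.add_assoc, Nat.add_comm 1]

theorem reflectSeq_seqEnv (a : List (List Ty)) (n : ℤ) : SeqEnv a (reflectSeq a n) := by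
  induction a generalizing n with
  | nil => simp [SeqEnv, reflectSeq]
  | cons c a ih =>
    have := ih (n - 1)
    rw [SeqEnv] at this ⊢
    rw [reflectSeq, List.map_cons, this, reflectBag_fst]

theorem reflectSeq_getElem {a : List (List Ty)} {k : ℕ} (hk : k < a.length) (n : ℤ)
    (hk' : k < (reflectSeq a n).length) : (reflectSeq a n)[k] = reflectBag a[k] (n - k) 0 := by
  induction a generalizing k n with
  | nil => simp at hk
  | cons c a ih =>
    cases k with
    | zero => simp [reflectSeq]
    | succ k =>
      simp only [reflectSeq, List.getElem_cons_succ]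
      rw [ih (by simpa using hk)]
      congr 1
      push_cast
      ring

/-- The generic environment, which maps the variables to themselves. The name of a variable is its
de Bruijn level, which is negative if it is not among the last `L` variables. -/
noncomputable def levelEnv (δ : Ctx) (L : ℕ) : ℕ → List Val :=
  fun x => reflectBag (δ x) (L - 1 - x : ℤ) 0

theorem levelEnv_env (δ : Ctx) (L : ℕ) : Env δ (levelEnv δ L) := fun _ => reflectBag_fst _ _ _

theorem length_of_seqEnv {a Q} (h : SeqEnv a Q) : Q.length = a.length := by
  rw [← h, List.length_map]

theorem levelEnv_cons (c : List (List Ty)) (δ : Ctx) (L : ℕ) :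
    ext (reflectSeq c ((L + c.length : ℕ) - 1 : ℤ)) (levelEnv δ L) =
      levelEnv (.cons c δ) (L + c.length) := by
  have hl := length_of_seqEnv (reflectSeq_seqEnv c ((L + c.length : ℕ) - 1 : ℤ))
  funext x
  refine ext_cases (P := fun x => ext (reflectSeq c ((L + c.length : ℕ) - 1 : ℤ)) (levelEnv δ L) x =
      levelEnv (.cons c δ) (L + c.length) x) c.length (fun x hx => ?_) (fun x => ?_) x
  · rw [ext_lt _ _ (hl.symm ▸ hx : x < _), reflectSeq_getElem hx, levelEnv, Ctx.cons_lt hx]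
  · rw [ext_add' _ _ _ _ hl, levelEnv, levelEnv, Ctx.cons_add]
    congr 1
    push_cast
    ring

/-! ### Context morphisms into a tensor product -/

/-- The pairing of context morphisms with the same domain. -/
def CtxMor.pair (θ θ' : CtxMor) : CtxMor := fun x => ((θ x).1, (θ x).2 ++ (θ' x).2)

theorem CtxHom.split {θ δ γ γ'} (h : CtxHom θ δ (γ.tensor γ')) :
    ∃ θ1 θ2, θ = CtxMor.pair θ1 θ2 ∧ CtxHom θ1 δ γ ∧ CtxHom θ2 δ γ' := by
  refine ⟨fun x => ((θ x).1, (θ x).2.take (γ x).length),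
    fun x => ((θ x).1, (θ x).2.drop (γ x).length), ?_, fun x => ?_, fun x => ?_⟩
  · funext x
    simp [CtxMor.pair]
  all_goals
    obtain ⟨h1, h2⟩ := BMor.isHom_iff.1 (h x)
    refine BMor.isHom_iff.2 ⟨h1, ?_⟩
  · exact h2.take
  · exact h2.drop

theorem CMild.pair {θ θ'} (h : CMild (.pair θ θ')) : CMild θ ∧ CMild θ' :=
  ⟨fun x e he => h x e (List.mem_append_left _ he), fun x e he => h x e (List.mem_append_right _ he)⟩

theorem CtxMor.actEnv_pair (θ θ' : CtxMor) (ρ) :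
    (CtxMor.pair θ θ').actEnv ρ = fun x => θ.actEnv ρ x ++ θ'.actEnv ρ x := by
  funext x; exact coactEnt_append _ _ _

theorem CtxMor.tensor_comp_pair {θ θ' η η' : CtxMor} {δ γ γ' ζ ζ' : Ctx} (h : CtxHom θ δ γ)
    (h' : CtxHom θ' δ γ') (k : CtxHom η γ ζ) (k' : CtxHom η' γ' ζ') :
    (η.tensor η').comp (.pair θ θ') = .pair (η.comp θ) (η'.comp θ') := by
  funext x
  obtain ⟨h1, h2⟩ := BMor.isHom_iff.1 (h x)
  obtain ⟨h1', h2'⟩ := BMor.isHom_iff.1 (h' x)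
  obtain ⟨k1, k2⟩ := BMor.isHom_iff.1 (k x)
  obtain ⟨k1', k2'⟩ := BMor.isHom_iff.1 (k' x)
  have h3 : EntriesIsHom (δ x) (CtxMor.pair θ θ' x).2 (γ x ++ γ' x) := h2.append h2'
  have k3 := (BMor.isHom_iff.1 ((k x).tensor (k' x))).2
  refine Prod.ext rfl ?_
  refine (BMor.comp_snd_eq h3 k3).trans ?_
  simp only [CtxMor.pair, CtxMor.comp]
  rw [BMor.comp_snd_eq h2 k2, BMor.comp_snd_eq h2' k2']
  simp only [BMor.tensor, List.map_append, List.map_map]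
  congr 1
  · refine List.map_congr_left fun e he => ?_
    have := k2.lt he
    rw [← h2.length] at this
    rw [List.getD_append _ _ _ _ this]
  · refine List.map_congr_left fun e he => ?_
    simp only [Function.comp_apply]
    rw [List.getD_append_right _ _ _ _ (by rw [k1, h2.length]; omega), k1, h2.length,
      Nat.add_sub_cancel_left]

theorem CtxHom.eq_of_empty {θ θ' δ} (h : CtxHom θ δ .empty) (h' : CtxHom θ' δ .empty) : θ = θ' := by
  funext x
  obtain ⟨h1, h2⟩ := BMor.isHom_iff.1 (h x)
  obtain ⟨h1', h2'⟩ := BMor.isHom_iff.1 (h' x)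
  exact Prod.ext (h1.trans h1'.symm) ((List.length_eq_zero_iff.1 h2.length).trans
    (List.length_eq_zero_iff.1 h2'.length).symm)

theorem CtxHom.cons {θ δ γ pos c b} (h : CtxHom θ δ γ) (hp : SeqIsHom pos c b) :
    CtxHom (ext pos θ) (.cons c δ) (.cons b γ) := by
  have h1 := hp.length_src
  have h2 := hp.length_tgt
  intro x
  refine ext_cases (P := fun x => (ext pos θ x).IsHom (Ctx.cons c δ x) (Ctx.cons b γ x)) pos.length
    (fun x hx => ?_) (fun x => ?_) x
  · have hc : x < c.length := h1 ▸ hx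
    have hb : x < b.length := h2 ▸ hx
    rw [ext_lt _ _ hx, Ctx.cons_lt hc, Ctx.cons_lt hb]
    clear h1 h2 h
    induction pos generalizing c b x with
    | nil => simp at hx
    | cons f pos ih =>
      cases hp with
      | cons h1 h2 =>
        cases x with
        | zero => exact h1
        | succ x => exact ih h2 x (by simpa using hx) (by simpa using hc) (by simpa using hb)
  · rw [ext_add' _ _ _ _ rfl, h1, Ctx.cons_add, ← h1, h2, Ctx.cons_add]
    exact h x

/-! ### Joining redex-free terms with the same observation -/

/-- A typed term `γ ⊢ u : a` with mild morphisms to its context and from its type. -/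
structure Side (δ : Ctx) (c : Ty) (γ : Ctx) (u : Tm) (a : Ty) (θ : CtxMor) (m : Mor) : Prop where
  typed : HasType γ u a
  ctx : CtxHom θ δ γ
  cmild : CMild θ
  ty : m.IsHom a c
  mild : TMild m

/-- The analogue of `Side` for bags. -/
structure BagSide (δ : Ctx) (c : List Ty) (γ : Ctx) (u : List Tm) (a : List Ty) (θ : CtxMor)
    (m : BMor) : Prop where
  typed : BagHasType γ u a
  ctx : CtxHom θ δ γ
  cmild : CMild θ
  ty : m.IsHom a c
  mild : BMild m

/-- The analogue of `Side` for sequences of bags. -/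
structure SeqSide (δ : Ctx) (c : List (List Ty)) (γ : Ctx) (u : List (List Tm)) (a : List (List Ty))
    (θ : CtxMor) (m : List BMor) : Prop where
  typed : SeqHasType γ u a
  ctx : CtxHom θ δ γ
  cmild : CMild θ
  ty : SeqIsHom m a c
  mild : SMild m

/-- The value of the term at type `c`, in the generic environment for `δ`. -/
noncomputable def obs (δ : Ctx) (L : ℕ) (u : Tm) (θ : CtxMor) (m : Mor) : Val :=
  coactV m (sem u (θ.actEnv (levelEnv δ L)))

/-- The terms `γ₁ ⊢ u₁ : a₁` and `γ₂ ⊢ u₂ : a₂` have a common reduct, with labels that become equal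
after composition with `θ₁`, `m₁` and `θ₂`, `m₂`, respectively. -/
def Joinable (γ₁ : Ctx) (u₁ : Tm) (a₁ : Ty) (θ₁ : CtxMor) (m₁ : Mor) (γ₂ : Ctx) (u₂ : Tm) (a₂ : Ty)
    (θ₂ : CtxMor) (m₂ : Mor) : Prop :=
  ∃ η₁ k₁ η₂ k₂ γ u a, LStar γ₁ u₁ a₁ η₁ k₁ γ u a ∧ LStar γ₂ u₂ a₂ η₂ k₂ γ u a ∧
    η₁.comp θ₁ = η₂.comp θ₂ ∧ m₁.comp k₁ = m₂.comp k₂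

/-- The analogue of `Joinable` for bags. -/
def BagJoinable (γ₁ : Ctx) (u₁ : List Tm) (a₁ : List Ty) (θ₁ : CtxMor) (m₁ : BMor) (γ₂ : Ctx)
    (u₂ : List Tm) (a₂ : List Ty) (θ₂ : CtxMor) (m₂ : BMor) : Prop :=
  ∃ η₁ k₁ η₂ k₂ γ u a, BagStar γ₁ u₁ a₁ η₁ k₁ γ u a ∧ BagStar γ₂ u₂ a₂ η₂ k₂ γ u a ∧
    η₁.comp θ₁ = η₂.comp θ₂ ∧ m₁.comp k₁ = m₂.comp k₂

/-- The analogue of `Joinable` for sequences of bags. -/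
def SeqJoinable (γ₁ : Ctx) (u₁ : List (List Tm)) (a₁ : List (List Ty)) (θ₁ : CtxMor)
    (m₁ : List BMor) (γ₂ : Ctx) (u₂ : List (List Tm)) (a₂ : List (List Ty)) (θ₂ : CtxMor)
    (m₂ : List BMor) : Prop :=
  ∃ η₁ k₁ η₂ k₂ γ u a, SeqStar γ₁ u₁ a₁ η₁ k₁ γ u a ∧ SeqStar γ₂ u₂ a₂ η₂ k₂ γ u a ∧
    η₁.comp θ₁ = η₂.comp θ₂ ∧ seqComp m₁ k₁ = seqComp m₂ k₂

theorem Side.star {δ c γ u a θ m η k γ' u' a'} (H : Side δ c γ u a θ m)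
    (h : LStar γ u a η k γ' u' a') : Side δ c γ' u' a' (η.comp θ) (m.comp k) where
  typed := h.ok.tgt
  ctx := H.ctx.comp h.ok.ctx
  cmild := .comp H.ctx h.ok.ctx H.cmild h.ok.cmild
  ty := h.ok.ty.comp H.ty
  mild := .comp h.ok.ty H.ty h.ok.mild H.mild

theorem Side.obs_star {δ c γ u a θ m η k γ' u' a'} (H : Side δ c γ u a θ m)
    (h : LStar γ u a η k γ' u' a') (L : ℕ) : obs δ L u θ m = obs δ L u' (η.comp θ) (m.comp k) := by
  have e := H.ctx.env (levelEnv δ L)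
  rw [obs, obs, h.ok.sem_eq _ e, CtxMor.actEnv_comp H.ctx h.ok.ctx (levelEnv_env δ L),
    coactV_comp h.ok.ty H.ty (sem_fst h.ok.tgt (h.ok.ctx.env _))]

theorem Joinable.of_star {δ₁ δ₂ c₁ c₂ γ₁ u₁ a₁ θ₁ m₁ γ₂ u₂ a₂ θ₂ m₂ η₁ k₁ γ₁' u₁' a₁' η₂ k₂ γ₂' u₂' a₂'}
    (H₁ : Side δ₁ c₁ γ₁ u₁ a₁ θ₁ m₁) (H₂ : Side δ₂ c₂ γ₂ u₂ a₂ θ₂ m₂)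
    (h₁ : LStar γ₁ u₁ a₁ η₁ k₁ γ₁' u₁' a₁') (h₂ : LStar γ₂ u₂ a₂ η₂ k₂ γ₂' u₂' a₂')
    (h : Joinable γ₁' u₁' a₁' (η₁.comp θ₁) (m₁.comp k₁) γ₂' u₂' a₂' (η₂.comp θ₂) (m₂.comp k₂)) :
    Joinable γ₁ u₁ a₁ θ₁ m₁ γ₂ u₂ a₂ θ₂ m₂ := by
  obtain ⟨η₁', k₁', η₂', k₂', γ, u, a, g₁, g₂, e₁, e₂⟩ := h
  refine ⟨_, _, _, _, _, _, _, h₁.trans g₁, h₂.trans g₂, ?_, ?_⟩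
  · rw [H₁.ctx.assoc h₁.ok.ctx g₁.ok.ctx, H₂.ctx.assoc h₂.ok.ctx g₂.ok.ctx, e₁]
  · rw [← g₁.ok.ty.assoc h₁.ok.ty H₁.ty, ← g₂.ok.ty.assoc h₂.ok.ty H₂.ty, e₂]

theorem BagSide.cons_inv {δ c γ t ts a θ m} (H : BagSide δ c γ (t :: ts) a θ m) :
    ∃ d c' γ1 γ2 x a' θ1 θ2 f h, c = d :: c' ∧ γ = γ1.tensor γ2 ∧ a = x :: a' ∧
      θ = .pair θ1 θ2 ∧ m = BMor.tensor ([x], [(0, f)]) h ∧ Side δ d γ1 t x θ1 f ∧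
      BagSide δ c' γ2 ts a' θ2 h := by
  obtain ⟨ht, hθ, hc, hm, hm'⟩ := H
  cases ht with
  | @cons γ1 _ x γ2 _ a' h1 h2 =>
    obtain ⟨θ1, θ2, rfl, k1, k2⟩ := hθ.split
    cases hm' with
    | nil => cases hm.src_eq
    | @cons x' f h hf hh =>
      obtain ⟨a'', d, c', e, rfl, e1, e2⟩ := hm.cons_inv
      cases e
      exact ⟨d, c', γ1, γ2, x, a', θ1, θ2, f, h, rfl, rfl, rfl, rfl, rfl,
        ⟨h1, k1, hc.pair.1, e1, hf⟩, ⟨h2, k2, hc.pair.2, e2, hh⟩⟩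

theorem SeqSide.cons_inv {δ c γ t ts a θ m} (H : SeqSide δ c γ (t :: ts) a θ m) :
    ∃ d c' γ1 γ2 x a' θ1 θ2 f h, c = d :: c' ∧ γ = γ1.tensor γ2 ∧ a = x :: a' ∧
      θ = .pair θ1 θ2 ∧ m = f :: h ∧ BagSide δ d γ1 t x θ1 f ∧ SeqSide δ c' γ2 ts a' θ2 h := by
  obtain ⟨ht, hθ, hc, hm, hm'⟩ := H
  cases ht with
  | @cons γ1 _ x γ2 _ a' h1 h2 =>
    obtain ⟨θ1, θ2, rfl, k1, k2⟩ := hθ.split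
    cases hm with
    | @cons f _ d fs _ c' e1 e2 =>
      exact ⟨d, c', γ1, γ2, x, a', θ1, θ2, f, fs, rfl, rfl, rfl, rfl, rfl,
        ⟨h1, k1, hc.pair.1, e1, hm' _ List.mem_cons_self⟩,
        ⟨h2, k2, hc.pair.2, e2, fun g hg => hm' _ (List.mem_cons_of_mem _ hg)⟩⟩

theorem BagSide.nil_inv {δ c γ a θ m} (H : BagSide δ c γ [] a θ m) :
    c = [] ∧ γ = .empty ∧ a = [] ∧ m = ([], []) := by
  obtain ⟨ht, hθ, hc, hm, hm'⟩ := H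
  cases ht
  cases hm' with
  | nil => exact ⟨hm.tgt_eq.symm, rfl, rfl, rfl⟩
  | cons _ _ => cases hm.src_eq

theorem SeqSide.nil_inv {δ c γ a θ m} (H : SeqSide δ c γ [] a θ m) :
    c = [] ∧ γ = .empty ∧ a = [] ∧ m = [] := by
  obtain ⟨ht, hθ, hc, hm, hm'⟩ := H
  cases ht
  cases hm
  exact ⟨rfl, rfl, rfl, rfl⟩

theorem semBag_pair {γ1 : Ctx} {t ts x δ c θ1 θ2 f} (h : Side δ c γ1 t x θ1 f) (ρ) :
    semBag (t :: ts) ((CtxMor.pair θ1 θ2).actEnv ρ) =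
      sem t (θ1.actEnv ρ) :: semBag ts (θ2.actEnv ρ) := by
  rw [CtxMor.actEnv_pair]
  exact semBag_append fun x => by rw [(h.ctx.env ρ).length, occ_eq h.typed]

theorem semSeq_pair {γ1 : Ctx} {t ts x δ c θ1 θ2 f} (h : BagSide δ c γ1 t x θ1 f) (ρ) :
    semSeq (t :: ts) ((CtxMor.pair θ1 θ2).actEnv ρ) =
      semBag t (θ1.actEnv ρ) :: semSeq ts (θ2.actEnv ρ) := by
  rw [CtxMor.actEnv_pair]
  exact semSeq_append fun x => by rw [(h.ctx.env ρ).length, occBag_eq h.typed]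

/-- Redex-free terms, the first of which satisfies `P`, are joinable if they have the same
observation. The level `L` is arbitrary, as it grows under binders. -/
def JoinHyp (P : Tm → Prop) : Prop :=
  ∀ {δ c γ₁ u₁ a₁ θ₁ m₁ γ₂ u₂ a₂ θ₂ m₂} (L : ℕ), P u₁ → (∃ n, RF n u₂) →
    Side δ c γ₁ u₁ a₁ θ₁ m₁ → Side δ c γ₂ u₂ a₂ θ₂ m₂ →
    reify c (obs δ L u₁ θ₁ m₁) L = reify c (obs δ L u₂ θ₂ m₂) L →
    Joinable γ₁ u₁ a₁ θ₁ m₁ γ₂ u₂ a₂ θ₂ m₂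

theorem JoinHyp.bag {P : Tm → Prop} (hP : JoinHyp P) {δ c γ₁ u₁ a₁ θ₁ m₁ γ₂ u₂ a₂ θ₂ m₂} (L : ℕ)
    (h₁ : ∀ t ∈ u₁, P t) (h₂ : ∀ t ∈ u₂, ∃ n, RF n t) (H₁ : BagSide δ c γ₁ u₁ a₁ θ₁ m₁)
    (H₂ : BagSide δ c γ₂ u₂ a₂ θ₂ m₂)
    (h : reifyBag c (coactEnt m₁.2 (semBag u₁ (θ₁.actEnv (levelEnv δ L)))) L =
      reifyBag c (coactEnt m₂.2 (semBag u₂ (θ₂.actEnv (levelEnv δ L)))) L) :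
    BagJoinable γ₁ u₁ a₁ θ₁ m₁ γ₂ u₂ a₂ θ₂ m₂ := by
  induction u₁ generalizing c γ₁ a₁ θ₁ m₁ γ₂ u₂ a₂ θ₂ m₂ with
  | nil =>
    obtain ⟨rfl, rfl, rfl, rfl⟩ := H₁.nil_inv
    cases u₂ with
    | nil =>
      obtain ⟨-, rfl, rfl, rfl⟩ := H₂.nil_inv
      exact ⟨_, _, _, _, _, _, _, .refl .nil, .refl .nil, by rw [H₁.ctx.eq_of_empty H₂.ctx], rfl⟩
    | cons t ts =>
      obtain ⟨_, _, _, _, _, _, _, _, _, _, h, _⟩ := H₂.cons_inv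
      cases h
  | cons t ts ih =>
    obtain ⟨d, c', γ1, γ2, x, a', θ1, θ2, f, g, rfl, rfl, rfl, rfl, rfl, S, B⟩ := H₁.cons_inv
    cases u₂ with
    | nil =>
      obtain ⟨h, _⟩ := H₂.nil_inv
      cases h
    | cons t' ts' =>
      obtain ⟨_, _, γ1', γ2', x', a'', θ1', θ2', f', g', e, rfl, rfl, rfl, rfl, S', B'⟩ :=
        H₂.cons_inv
      cases e
      rw [List.forall_mem_cons] at h₁ h₂
      have key : ∀ {γ t ts x γ' a θ θ' f g} , Side δ d γ t x θ f → BagSide δ c' γ' ts a θ' g →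
          coactEnt (BMor.tensor ([x], [(0, f)]) g).2
            (semBag (t :: ts) ((CtxMor.pair θ θ').actEnv (levelEnv δ L))) =
          obs δ L t θ f :: coactEnt g.2 (semBag ts (θ'.actEnv (levelEnv δ L))) := by
        intro γ t ts x γ' a θ θ' f g S B
        have := coactEnt_tensor (g := g) (BMor.isHom_single S.ty)
          (u := [sem t (θ.actEnv (levelEnv δ L))]) (w := semBag ts (θ'.actEnv (levelEnv δ L)))
          (by simp [sem_fst S.typed (S.ctx.env _)])
        rw [semBag_pair S, ← List.singleton_append (l := semBag _ _), this]
        simp [coactEnt, obs]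
      rw [key S B, key S' B', reifyBag, reifyBag] at h
      simp only [List.headD_cons, List.tail_cons, List.cons.injEq] at h
      obtain ⟨_, _, _, _, _, _, _, s1, s2, e1, e2⟩ := hP L h₁.1 h₂.1 S S' h.1
      obtain ⟨_, _, _, _, _, _, _, r1, r2, e3, e4⟩ := ih h₁.2 h₂.2 B B' h.2
      refine ⟨_, _, _, _, _, _, _, .cons s1 r1, .cons s2 r2, ?_, ?_⟩
      · rw [CtxMor.tensor_comp_pair S.ctx B.ctx s1.ok.ctx r1.ok.ctx,
          CtxMor.tensor_comp_pair S'.ctx B'.ctx s2.ok.ctx r2.ok.ctx, e1, e3]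
      · rw [BMor.tensor_comp (BMor.isHom_single s1.ok.ty) (BMor.isHom_single S.ty) r1.ok.ty B.ty,
          BMor.tensor_comp (BMor.isHom_single s2.ok.ty) (BMor.isHom_single S'.ty) r2.ok.ty B'.ty,
          BMor.single_comp, BMor.single_comp, e2, e4]

theorem JoinHyp.seq {P : Tm → Prop} (hP : JoinHyp P) {δ c γ₁ u₁ a₁ θ₁ m₁ γ₂ u₂ a₂ θ₂ m₂} (L : ℕ)
    (h₁ : ∀ b ∈ u₁, ∀ t ∈ b, P t) (h₂ : ∀ b ∈ u₂, ∀ t ∈ b, ∃ n, RF n t)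
    (H₁ : SeqSide δ c γ₁ u₁ a₁ θ₁ m₁) (H₂ : SeqSide δ c γ₂ u₂ a₂ θ₂ m₂)
    (h : reifySeq c (coactSeqV m₁ (semSeq u₁ (θ₁.actEnv (levelEnv δ L)))) L =
      reifySeq c (coactSeqV m₂ (semSeq u₂ (θ₂.actEnv (levelEnv δ L)))) L) :
    SeqJoinable γ₁ u₁ a₁ θ₁ m₁ γ₂ u₂ a₂ θ₂ m₂ := by
  induction u₁ generalizing c γ₁ a₁ θ₁ m₁ γ₂ u₂ a₂ θ₂ m₂ with
  | nil =>
    obtain ⟨rfl, rfl, rfl, rfl⟩ := H₁.nil_inv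
    cases u₂ with
    | nil =>
      obtain ⟨-, rfl, rfl, rfl⟩ := H₂.nil_inv
      exact ⟨_, _, _, _, _, _, _, .refl .nil, .refl .nil, by rw [H₁.ctx.eq_of_empty H₂.ctx], rfl⟩
    | cons t ts =>
      obtain ⟨_, _, _, _, _, _, _, _, _, _, h, _⟩ := H₂.cons_inv
      cases h
  | cons t ts ih =>
    obtain ⟨d, c', γ1, γ2, x, a', θ1, θ2, f, g, rfl, rfl, rfl, rfl, rfl, S, B⟩ := H₁.cons_inv
    cases u₂ with
    | nil =>
      obtain ⟨h, _⟩ := H₂.nil_inv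
      cases h
    | cons t' ts' =>
      obtain ⟨_, _, γ1', γ2', x', a'', θ1', θ2', f', g', e, rfl, rfl, rfl, rfl, S', B'⟩ :=
        H₂.cons_inv
      cases e
      rw [List.forall_mem_cons] at h₁ h₂
      rw [semSeq_pair S, semSeq_pair S', coactSeqV_cons, coactSeqV_cons, reifySeq, reifySeq] at h
      simp only [List.headD_cons, List.tail_cons, List.cons.injEq] at h
      obtain ⟨_, _, _, _, _, _, _, s1, s2, e1, e2⟩ := hP.bag L h₁.1 h₂.1 S S' h.1
      obtain ⟨_, _, _, _, _, _, _, r1, r2, e3, e4⟩ := ih h₁.2 h₂.2 B B' h.2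
      refine ⟨_, _, _, _, _, _, _, .cons s1 r1, .cons s2 r2, ?_, ?_⟩
      · rw [CtxMor.tensor_comp_pair S.ctx B.ctx s1.ok.ctx r1.ok.ctx,
          CtxMor.tensor_comp_pair S'.ctx B'.ctx s2.ok.ctx r2.ok.ctx, e1, e3]
      · rw [seqComp] at e4 ⊢
        rw [seqComp] at e4 ⊢
        rw [List.zipWith_cons_cons, List.zipWith_cons_cons, e2, e4]

/-! ### Joining applied variables -/

theorem isHom_of_o {f a} (h : Mor.IsHom f .o a) : a = .o ∧ f = .arr [] := by
  cases h with
  | arr h => cases h; exact ⟨rfl, rfl⟩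

theorem Side.var_inv {δ c γ x q a θ m} (H : Side δ c γ (.var x q) a θ m) :
    ∃ i h d b γ' θ', c = .o ∧ a = .o ∧ m = .arr [] ∧ γ = (Ctx.single x (.arr b)).tensor γ' ∧
      θ = CtxMor.pair (fun y => (δ y, if y = x then [(i, .arr h)] else [])) θ' ∧
      (δ x)[i]? = some (.arr d) ∧ SeqIsHom h b d ∧ SeqSide δ d γ' q b θ' h := by
  obtain ⟨ht, hθ, hc, hm, hm'⟩ := H
  cases ht with
  | @var _ b γ' _ hq =>
    obtain ⟨rfl, rfl⟩ := isHom_of_o hm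
    obtain ⟨θ1, θ2, rfl, h1, h2⟩ := hθ.split
    have hx := h1 x
    rw [Ctx.single, if_pos rfl] at hx
    obtain ⟨e1, e2⟩ := BMor.isHom_iff.1 hx
    generalize he : (θ1 x).2 = es at e2
    cases e2 with
    | @cons _ i f d _ es _ k1 k2 k3 =>
      cases k3
      cases k2 with
      | @arr h d _ k2 =>
        have : θ1 = fun y => (δ y, if y = x then [(i, .arr h)] else []) := by
          funext y
          obtain ⟨g1, g2⟩ := BMor.isHom_iff.1 (h1 y)
          refine Prod.ext g1 ?_
          by_cases hy : y = x
          · subst hy; simpa using he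
          · rw [Ctx.single, if_neg hy] at g2
            simpa [hy] using g2.length
        refine ⟨i, h, d, b, γ', θ2, rfl, rfl, rfl, rfl, by rw [this], k1, k2, hq, h2, hc.pair.2, k2,
          ?_⟩
        obtain ⟨h', e, hh⟩ := hc.pair.1 x (i, .arr h) (by rw [he]; exact List.mem_singleton_self _)
        cases e
        exact hh

theorem reify_o (v : Val) (L : ℕ) : reify .o v L = .lam [] (force v L) := by
  rw [reify]; simp only [reflectSeq]; rfl

/-- The observation of an applied variable shows the variable, the entry `i` of its intersection
type from which the context morphism obtains the occurrence, and the observation of the arguments.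
-/
theorem obs_var {δ : Ctx} {x i h d b γ' θ' q} (L : ℕ) (hi : (δ x)[i]? = some (.arr d))
    (hh : SeqIsHom h b d) (H : SeqSide δ d γ' q b θ' h) :
    force (obs δ L (.var x q)
      (.pair (fun y => (δ y, if y = x then [(i, .arr h)] else [])) θ') (.arr [])) L =
    .var (L - 1 - x) i (reifySeq d (coactSeqV h (semSeq q (θ'.actEnv (levelEnv δ L)))) L) := by
  have e : CtxMor.actEnv (fun y => (δ y, if y = x then [(i, .arr h)] else [])) (levelEnv δ L) =
      fun y => if y = x then [coactV (.arr h) ((levelEnv δ L x).getD i default)] else [] := by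
    funext y
    by_cases hy : y = x <;> simp [CtxMor.actEnv, hy, coactEnt]
  have hQ := semSeq_seqEnv H.typed (H.ctx.env (levelEnv δ L))
  have hv : (levelEnv δ L x).getD i default = reflect (.arr d) (L - 1 - x) i := by
    rw [levelEnv, List.getD_eq_getElem?_getD, reflectBag_getElem? hi, Nat.zero_add]; rfl
  rw [obs, CtxMor.actEnv_pair, e, sem_var_cons, coactV_o (by rfl), force_base,
    app_coactV (by rw [hh.src_eq]; exact hQ), hv, reflect, app_lamV (seqEnv_coactSeqV hh hQ)]

theorem CtxMor.single_comp_entry {δ : Ctx} {x i b h k} :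
    (CtxMor.single x (.arr b) (.arr k)).comp (fun y => (δ y, if y = x then [(i, .arr h)] else [])) =
      fun y => (δ y, if y = x then [(i, .arr (seqComp h k))] else []) := by
  funext y
  by_cases hy : y = x
  · simp [CtxMor.comp, CtxMor.single, BMor.comp, hy, Mor.comp_arr]
  · simp [CtxMor.comp, CtxMor.single, BMor.comp, hy]

/-- Equal observations of applied variables come from the same entry of the intersection type of the
same variable, and from arguments that are joinable. -/
theorem JoinHyp.var {P : Tm → Prop} (hP : JoinHyp P) {δ c γ₁ x₁ q₁ a₁ θ₁ m₁ γ₂ x₂ q₂ a₂ θ₂ m₂}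
    (L : ℕ) (h₁ : ∀ b ∈ q₁, ∀ t ∈ b, P t) (h₂ : ∀ b ∈ q₂, ∀ t ∈ b, ∃ n, RF n t)
    (H₁ : Side δ c γ₁ (.var x₁ q₁) a₁ θ₁ m₁) (H₂ : Side δ c γ₂ (.var x₂ q₂) a₂ θ₂ m₂)
    (h : reify c (obs δ L (.var x₁ q₁) θ₁ m₁) L = reify c (obs δ L (.var x₂ q₂) θ₂ m₂) L) :
    Joinable γ₁ (.var x₁ q₁) a₁ θ₁ m₁ γ₂ (.var x₂ q₂) a₂ θ₂ m₂ := by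
  obtain ⟨i, f, d, b, γ, θ, rfl, rfl, rfl, rfl, rfl, hi, hf, S⟩ := H₁.var_inv
  obtain ⟨i', f', d', b', γ', θ', -, rfl, rfl, rfl, rfl, hi', hf', S'⟩ := H₂.var_inv
  rw [reify_o, reify_o, obs_var L hi hf S, obs_var L hi' hf' S'] at h
  simp only [Tree.lam.injEq, Tree.var.injEq, true_and] at h
  obtain ⟨hx, rfl, h⟩ := h
  -- Variables with the same level have the same index.
  obtain rfl : x₁ = x₂ := by omega
  rw [hi] at hi'
  cases hi'
  obtain ⟨_, _, _, _, _, _, _, s1, s2, e1, e2⟩ := hP.seq L h₁ h₂ S S' h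
  have hs : ∀ {b h}, SeqIsHom h b d →
      CtxHom (fun y => (δ y, if y = x₁ then [(i, .arr h)] else [])) δ (.single x₁ (.arr b)) := by
    intro b h hh y
    by_cases hy : y = x₁
    · subst hy
      simp only [↓reduceIte, Ctx.single]
      exact .mk (.cons hi (.arr hh) .nil)
    · simp only [hy, ↓reduceIte, Ctx.single]
      exact .mk .nil
  refine ⟨_, _, _, _, _, _, _, .varArg s1, .varArg s2, ?_, rfl⟩
  rw [CtxMor.tensor_comp_pair (hs hf) S.ctx (.single s1.ok.ty) s1.ok.ctx,
    CtxMor.tensor_comp_pair (hs hf') S'.ctx (.single s2.ok.ty) s2.ok.ctx,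
    CtxMor.single_comp_entry, CtxMor.single_comp_entry, e1, e2]

/-! ### Joining abstractions -/

theorem SeqIsHom.getElem {f a b} (h : SeqIsHom f a b) {k : ℕ} (hf : k < f.length)
    (ha : k < a.length) (hb : k < b.length) : f[k].IsHom a[k] b[k] := by
  induction f generalizing a b k with
  | nil => simp at hf
  | cons g f ih =>
    cases h with
    | cons h1 h2 =>
      cases k with
      | zero => exact h1
      | succ k => exact ih h2 (by simpa using hf) (by simpa using ha) (by simpa using hb)

/-- A sequence of ground morphisms is given by lists of positions. -/
theorem exists_ground_seq {pos cs b} (h : SeqIsHom pos cs b) (hm : TMild (.arr pos)) :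
    ∃ α : ℕ → List ℕ, pos = cs.mapIdx (fun k c => ground (α k) c) ∧
      b = cs.mapIdx (fun k c => sel c (α k)) ∧
      ∀ k (_ : k < cs.length), ∀ i ∈ α k, i < cs[k].length := by
  obtain ⟨_, e, hm⟩ := hm
  cases e
  have hl := h.length_src
  have hpos : pos = cs.mapIdx fun k c => ground ((pos.getD k default).2.map Prod.fst) c := by
    refine List.ext_getElem (by simp [hl]) fun k h1 h2 => ?_
    have hc : k < cs.length := hl ▸ h1
    obtain ⟨β, hβ⟩ := hm _ (List.getElem_mem h1)
    have hs : (pos[k]).1 = cs[k] := by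
      have := h.src_eq
      subst this
      rw [List.getElem_map]
    rw [hs] at hβ
    have : ((pos.getD k default).2.map Prod.fst) = β := by
      rw [List.getD_eq_getElem _ _ h1, hβ]
      simp [ground, Function.comp_def]
    rw [List.getElem_mapIdx, this, ← hβ]
  refine ⟨_, hpos, ?_, ?_⟩
  · conv_lhs => rw [← h.tgt_eq, hpos]
    refine List.ext_getElem (by simp) fun k h1 h2 => ?_
    simp [ground_tgt]
  · intro k hk i hi
    have h1 : k < pos.length := hl ▸ hk
    rw [List.getD_eq_getElem _ _ h1] at hi
    obtain ⟨e, he, rfl⟩ := List.mem_map.1 hi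
    exact (BMor.isHom_iff.1 (h.getElem h1 hk (h.length_tgt ▸ h1))).2.lt he

/-- Precomposition with a ground morphism renames positions. -/
theorem comp_ground {α : List ℕ} {a b : List Ty} {f : BMor} (hα : ∀ i ∈ α, i < a.length)
    (hf : f.IsHom (sel a α) b) : f.comp (ground α a) = (a, remap (fun j => α.getD j 0) f.2) := by
  have h1 := (BMor.isHom_iff.1 (ground_isHom hα)).2
  have h2 := (BMor.isHom_iff.1 hf).2
  refine Prod.ext rfl ?_
  rw [BMor.comp_snd_eq h1 h2, remap]
  refine List.map_congr_left fun e he => ?_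
  have hlt : e.1 < α.length := by simpa using h2.lt he
  obtain ⟨d, hd⟩ := h2.mem he
  rw [getD_sel _ _ hlt] at hd
  have : (ground α a).2.getD e.1 default = (α.getD e.1 0, (a.getD (α.getD e.1 0) .o).id) :=
    getD_map_of_lt _ _ hlt _ _
  rw [this]
  exact Prod.ext rfl hd.comp_id

/-- The complete exponential reduction of an abstraction, where the domain of the annotation `κ` is
the codomain of a sequence of ground morphisms: up to composition with the latter, the result
depends only on the composite of the annotation with it. -/
theorem LStar.exp_comp {Γ : Ctx} {cs b e : List (List Ty)} {α : ℕ → List ℕ} {κ : List BMor} {r : Tm}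
    (hα : ∀ k (_ : k < cs.length), ∀ i ∈ α k, i < cs[k].length)
    (hb : b = cs.mapIdx fun k c => sel c (α k)) (hne : κ ≠ []) (hκ : SeqIsHom κ b e)
    (hr : HasType (.cons e Γ) r .o) {q : Tm × (ℕ → List ℕ)}
    (hq : q = expAct Γ (seqComp κ (cs.mapIdx fun k c => ground (α k) c)) r) :
    ∃ ν, LStar Γ (.lam κ r) (.arr b) (.ground (fun x => q.2 (x + cs.length)) Γ) (.arr ν)
        (Γ.sel fun x => q.2 (x + cs.length))
        (.lam (idSeq (cs.mapIdx fun k c => sel c (q.2 k))) q.1)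
        (.arr (cs.mapIdx fun k c => sel c (q.2 k))) ∧
      seqComp ν (cs.mapIdx fun k c => ground (α k) c) = cs.mapIdx fun k c => ground (q.2 k) c := by
  have hbl : b.length = cs.length := by rw [hb, List.length_mapIdx]
  have hκl : κ.length = cs.length := hκ.length_src.trans hbl
  set p := expAct Γ κ r with hp
  -- The composite annotation is `κ` with the positions at the bound variables renamed along `α`.
  set π : ℕ → ℕ → ℕ := fun x => if x < cs.length then fun j => (α x).getD j 0 else id with hπ
  have hq' : q = (p.1, fun x => (p.2 x).map (π x)) := by
    have h1 : ext ((seqComp κ (cs.mapIdx fun k c => ground (α k) c)).map Prod.snd)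
        (fun x => idEntries 0 (Γ x)) =
        fun x => remap (π x) (ext (κ.map Prod.snd) (fun x => idEntries 0 (Γ x)) x) := by
      funext x
      refine ext_cases (P := fun x => ext ((seqComp κ (cs.mapIdx fun k c => ground (α k) c)).map
        Prod.snd) (fun x => idEntries 0 (Γ x)) x =
        remap (π x) (ext (κ.map Prod.snd) (fun x => idEntries 0 (Γ x)) x)) cs.length
        (fun x hx => ?_) (fun x => ?_) x
      · have h1 : x < κ.length := hκl ▸ hx
        have h2 : x < b.length := hbl ▸ hx
        have h3 := hκ.getElem h1 h2 (hκ.length_tgt ▸ h1)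
        have h4 : b[x] = sel cs[x] (α x) := by subst hb; rw [List.getElem_mapIdx]
        rw [h4] at h3
        rw [ext_lt _ _ (by simp [seqComp, hκl, hx]), ext_lt _ _ (by simpa using h1)]
        simp only [seqComp, List.getElem_map, List.getElem_zipWith, List.getElem_mapIdx]
        rw [comp_ground (hα x hx) h3, hπ]
        simp only [hx, ↓reduceIte]
      · rw [ext_add' _ _ _ _ (by simp [seqComp, hκl]), ext_add' _ _ _ _ (by simp [hκl])]
        simp [hπ, remap]
    rw [hq, expAct, h1, hp]
    exact act_remap hr _ _ (EntCtx.ext (fun _ => idEntries_isHom' _) hκ) π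
  obtain ⟨hlt, -⟩ := expAct_lt hκ hr
  have h0 := LStar.exp hne hκ hr hp
  have ep : ∀ x, q.2 (x + cs.length) = p.2 (x + κ.length) := by
    intro x
    rw [hq', hκl]
    simp [hπ]
  have ek : ∀ k (_ : k < cs.length), q.2 k = sel (α k) (p.2 k) := by
    intro k hk
    rw [hq']
    simp only [hπ, hk, ↓reduceIte]
    rfl
  have hlt' : ∀ k (_ : k < cs.length), ∀ i ∈ p.2 k, i < (α k).length := by
    intro k hk i hi
    have := hlt k (hbl ▸ hk) i hi
    subst hb
    rw [List.getElem_mapIdx] at this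
    simpa using this
  have eb : (b.mapIdx fun k c => sel c (p.2 k)) = cs.mapIdx fun k c => sel c (q.2 k) := by
    subst hb
    refine List.ext_getElem (by simp) fun k h1 h2 => ?_
    rw [List.length_mapIdx] at h2
    simp only [List.getElem_mapIdx]
    rw [ek k h2, sel_sel _ _ (hlt' k h2)]
  have e1 : p.1 = q.1 := by rw [hq']
  simp only [← ep] at h0
  rw [eb, e1] at h0
  refine ⟨_, h0, ?_⟩
  subst hb
  refine List.ext_getElem (by simp [seqComp]) fun k h1 h2 => ?_
  rw [List.length_mapIdx] at h2
  simp only [seqComp, List.getElem_zipWith, List.getElem_mapIdx]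
  rw [ground_comp_ground (hα k h2) (hlt' k h2), ek k h2]

theorem CMild.ext {pos : List BMor} {θ : CtxMor} (h : TMild (.arr pos)) (hθ : CMild θ) :
    CMild (ext pos θ) := by
  obtain ⟨_, e, h⟩ := h
  cases e
  intro x
  refine ext_cases (P := fun x => ∀ e ∈ (ResourceCalculus.ext pos θ x).2,
    ∃ h, e.2 = .arr h ∧ SMild h) pos.length (fun x hx => ?_) (fun x => ?_) x
  · rw [ext_lt _ _ hx]
    obtain ⟨β, hβ⟩ := h _ (List.getElem_mem hx)
    rw [hβ]
    exact CMild.ground (fun _ => β) (fun _ => pos[x].1) 0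
  · rw [ext_add' _ _ _ _ rfl]
    exact hθ x

theorem Side.body {δ cs γ b s θ pos} (H : Side δ (.arr cs) γ (.lam (idSeq b) s) (.arr b) θ (.arr pos)) :
    Side (.cons cs δ) .o (.cons b γ) s .o (ext pos θ) (.arr []) where
  typed := by
    obtain ⟨a, d, e, _, hf, hs⟩ := H.typed.lam_inv
    cases e
    rwa [← hf.tgt_eq.symm.trans (idSeq_isHom b).tgt_eq]
  ctx := H.ctx.cons (Mor.isHom_arr_iff.1 H.ty)
  cmild := .ext H.mild H.cmild
  ty := isHom_o
  mild := .o

/-- The observation of an abstraction is that of its body, with the type label as the part of the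
context morphism at the bound variables. -/
theorem Side.obs_lam {δ cs γ b s θ pos}
    (H : Side δ (.arr cs) γ (.lam (idSeq b) s) (.arr b) θ (.arr pos)) (L : ℕ) :
    reify (.arr cs) (obs δ L (.lam (idSeq b) s) θ (.arr pos)) L =
      .lam cs (force (obs (.cons cs δ) (L + cs.length) s (ext pos θ) (.arr [])) (L + cs.length)) := by
  have hp := Mor.isHom_arr_iff.1 H.ty
  have hR := reflectSeq_seqEnv cs ((L + cs.length : ℕ) - 1 : ℤ)
  have hR' := seqEnv_coactSeqV hp hR
  have hl : (List.range cs.length).map (ext pos θ) = pos := by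
    rw [← hp.length_src]
    exact map_range_ext pos θ
  have ht : (fun x => ext pos θ (x + cs.length)) = θ := by
    funext x
    rw [ext_add' _ _ _ _ hp.length_src]
  have S := H.body
  have e := actEnv_cons (θ := ext pos θ) rfl hR (levelEnv δ L)
  rw [levelEnv_cons, hl, ht] at e
  rw [reify]
  simp only
  rw [obs, obs, coactV_o (sem_fst S.typed (S.ctx.env _)), e,
    app_coactV (by rw [hp.src_eq]; exact hR), sem, app_lamV (by rw [idSeq_map_fst]; exact hR'),
    coactSeqV_id _ hR']

/-- The reduction of an abstraction with identity annotation that is induced by a reduction of its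
body. The result depends only on `ω`, which is determined by the labels for the bodies. -/
theorem Side.lam_reduct {δ cs γ b s θ pos η k Γ r}
    (H : Side δ (.arr cs) γ (.lam (idSeq b) s) (.arr b) θ (.arr pos))
    (st : LStar (.cons b γ) s .o η k Γ r .o) {ω : CtxMor} (hω : η.comp (ext pos θ) = ω)
    {q : Tm × (ℕ → List ℕ)}
    (hq : q = expAct (fun x => Γ (x + cs.length)) ((List.range cs.length).map ω) r) :
    ∃ η' ν, LStar γ (.lam (idSeq b) s) (.arr b) η' (.arr ν)
        (Ctx.sel (fun x => Γ (x + cs.length)) fun x => q.2 (x + cs.length))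
        (.lam (idSeq (cs.mapIdx fun k c => sel c (q.2 k))) q.1)
        (.arr (cs.mapIdx fun k c => sel c (q.2 k))) ∧
      η'.comp θ = (CtxMor.ground (fun x => q.2 (x + cs.length)) fun x => Γ (x + cs.length)).comp
        (fun x => ω (x + cs.length)) ∧
      seqComp ν pos = cs.mapIdx fun k c => ground (q.2 k) c := by
  have hr := st.ok.tgt
  rw [Γ.eq_cons cs.length] at hr
  have hp := Mor.isHom_arr_iff.1 H.ty
  have hl : (List.range cs.length).map (ext pos θ) = pos := by
    rw [← hp.length_src]
    exact map_range_ext pos θ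
  have hbl : b.length = cs.length := hp.length_tgt.symm.trans hp.length_src
  obtain ⟨a, d, e, hne, hf, hs⟩ := H.typed.lam_inv
  -- The labels of the reduction of the body become the annotation; these are then eliminated.
  have h1 := LStar.lam hne (idSeq_isHom b) st
  have hκ := st.ok.ctx.seqIsHom hbl
  rw [(idSeq_isHom b).length_src, hbl, hκ.comp_id] at h1
  obtain ⟨α, hα, hb, hlt⟩ := exists_ground_seq hp H.mild
  have hne' : (List.range cs.length).map η ≠ [] := by
    intro e0
    have := congrArg List.length e0
    rw [length_map_range, ← hbl, ← (idSeq_isHom b).length_src] at this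
    exact hne (List.length_eq_zero_iff.1 this)
  rw [← hω, map_range_comp, hl, hα] at hq
  obtain ⟨ν, h2, h3⟩ := LStar.exp_comp hlt hb hne' hκ hr hq
  have h4 := h1.trans h2
  rw [h2.ok.ty.id_comp] at h4
  rw [← hα] at h3
  have ht : (fun x => ω (x + cs.length)) = CtxMor.comp (fun x => η (x + cs.length)) θ := by
    funext x
    rw [← hω]
    simp only [CtxMor.comp]
    rw [ext_add' _ _ _ _ hp.length_src]
  refine ⟨_, ν, h4, ?_, h3⟩
  rw [ht]
  exact H.ctx.assoc h1.ok.ctx h2.ok.ctx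

/-- For abstractions with identity annotations, a common reduct of the bodies yields a common
reduct: the labels of the bodies end up in the annotations, and a complete exponential reduction
turns these into equal labels. -/
theorem JoinHyp.lam_id {P : Tm → Prop} (hP : JoinHyp P) {δ cs γ₁ b₁ s₁ θ₁ pos₁ γ₂ b₂ s₂ θ₂ pos₂}
    (L : ℕ) (h₁ : P s₁) (h₂ : ∃ n, RF n s₂)
    (H₁ : Side δ (.arr cs) γ₁ (.lam (idSeq b₁) s₁) (.arr b₁) θ₁ (.arr pos₁))
    (H₂ : Side δ (.arr cs) γ₂ (.lam (idSeq b₂) s₂) (.arr b₂) θ₂ (.arr pos₂))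
    (h : reify (.arr cs) (obs δ L (.lam (idSeq b₁) s₁) θ₁ (.arr pos₁)) L =
      reify (.arr cs) (obs δ L (.lam (idSeq b₂) s₂) θ₂ (.arr pos₂)) L) :
    Joinable γ₁ (.lam (idSeq b₁) s₁) (.arr b₁) θ₁ (.arr pos₁)
      γ₂ (.lam (idSeq b₂) s₂) (.arr b₂) θ₂ (.arr pos₂) := by
  rw [H₁.obs_lam, H₂.obs_lam, Tree.lam.injEq] at h
  obtain ⟨η₁, k₁, η₂, k₂, Γ, r, c, s1, s2, e, -⟩ := hP (L + cs.length) h₁ h₂ H₁.body H₂.body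
    (by rw [reify_o, reify_o, h.2])
  obtain ⟨rfl, rfl⟩ := isHom_o_inv s1.ok.ty
  obtain ⟨_, ν₁, t1, f1, u1⟩ := H₁.lam_reduct s1 e rfl
  obtain ⟨_, ν₂, t2, f2, u2⟩ := H₂.lam_reduct s2 rfl rfl
  exact ⟨_, _, _, _, _, _, _, t1, t2, f1.trans f2.symm, by rw [Mor.comp_arr, Mor.comp_arr, u1, u2]⟩

/-- Abstractions reduce to abstractions with identity annotations. -/
theorem Side.exp {δ c γ f s a θ m} (H : Side δ c γ (.lam f s) a θ m) : ∃ cs η k γ' b s' pos,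
    c = .arr cs ∧ LStar γ (.lam f s) a η k γ' (.lam (idSeq b) s') (.arr b) ∧
      m.comp k = .arr pos ∧ ∀ n, RF n s → RF n s' := by
  obtain ⟨a, d, rfl, hne, hf, hs⟩ := H.typed.lam_inv
  have h := LStar.exp hne hf hs rfl
  obtain ⟨g⟩ := m
  obtain ⟨_, cs, _, rfl, _⟩ := H.ty.arr_inv
  exact ⟨_, _, _, _, _, _, _, rfl, h, Mor.comp_arr _ _, (expAct_ok hf hs).rf⟩

theorem Side.not_o_of_lam {δ c γ f s a θ m} (H : Side δ c γ (.lam f s) a θ m) : c ≠ .o := by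
  rintro rfl
  obtain ⟨a, d, rfl, hne, hf, hs⟩ := H.typed.lam_inv
  obtain ⟨e, -⟩ := isHom_o_inv H.ty
  cases e
  exact hne (List.length_eq_zero_iff.1 hf.length_src)

/-- Redex-free terms with the same observation are joinable. The induction is on the height of the
first term; exponential reduction does not increase it. -/
theorem joinHyp (n : ℕ) : JoinHyp (RF n) := by
  induction n with
  | zero => exact fun _ h => h.elim
  | succ n ih =>
    intro δ c γ₁ u₁ a₁ θ₁ m₁ γ₂ u₂ a₂ θ₂ m₂ L h₁ h₂ H₁ H₂ h
    obtain ⟨n₂, h₂⟩ := h₂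
    obtain _ | n₂ := n₂
    · exact h₂.elim
    cases u₁ with
    | redex => exact h₁.elim
    | var x₁ q₁ =>
      cases u₂ with
      | redex => exact h₂.elim
      | var x₂ q₂ => exact ih.var L h₁ (fun b hb t ht => ⟨n₂, h₂ b hb t ht⟩) H₁ H₂ h
      | lam f₂ s₂ =>
        obtain ⟨_, _, _, _, _, _, hc, _⟩ := H₁.var_inv
        exact (H₂.not_o_of_lam hc).elim
    | lam f₁ s₁ =>
      cases u₂ with
      | redex => exact h₂.elim
      | var x₂ q₂ =>
        obtain ⟨_, _, _, _, _, _, hc, _⟩ := H₂.var_inv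
        exact (H₁.not_o_of_lam hc).elim
      | lam f₂ s₂ =>
        -- It suffices to join the abstractions once their annotations are identities.
        obtain ⟨cs, _, _, _, _, _, _, rfl, g₁, e₁, r₁⟩ := H₁.exp
        obtain ⟨_, _, _, _, _, _, _, e, g₂, e₂, r₂⟩ := H₂.exp
        rw [H₁.obs_star g₁, H₂.obs_star g₂] at h
        have H₁' := H₁.star g₁
        have H₂' := H₂.star g₂
        refine .of_star H₁ H₂ g₁ g₂ ?_
        rw [e₁] at h H₁' ⊢
        rw [e₂] at h H₂' ⊢
        exact ih.lam_id L (r₁ _ h₁) ⟨_, r₂ _ h₂⟩ H₁' H₂' h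

/-! ### Confluence -/

theorem LStar.of_star {s t : TypedTm} {l : structuralReduction.obj s ⟶ structuralReduction.obj t}
    (h : structuralReduction.Star s t l) :
    LStar s.ctx s.term s.ty l.1.1 l.2.unop.1 t.ctx t.term t.ty := by
  refine LabelledReductionSystem.Star.rec (R := structuralReduction)
    (motive := fun s t l _ => LStar (TypedTm.ctx s) s.term s.ty l.1.1 l.2.unop.1 t.ctx t.term t.ty)
    (fun s => .refl s.typed) (fun h _ ih => .head h ih) h

/-- The label of a reduction sequence as a morphism of the category of labels. -/
def LStar.label {γ s a θ f γ' s' a'} (h : LStar γ s a θ f γ' s' a') :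
    ((γ, Opposite.op a) : Ctx × Tyᵒᵖ) ⟶ (γ', Opposite.op a') :=
  (⟨θ, h.ok.ctx⟩, Quiver.Hom.op (⟨f, h.ok.ty⟩ : a' ⟶ a))

theorem LStar.star {γ s a θ f γ' s' a'} (h : LStar γ s a θ f γ' s' a') :
    structuralReduction.Star ⟨γ, s, a, h.ok.src⟩ ⟨γ', s', a', h.ok.tgt⟩ h.label := by
  induction h with
  | refl hs => exact .refl (R := structuralReduction) ⟨_, _, _, hs⟩
  | @head γ s a θ f γ' s' a' θ' f' γ'' s'' a'' h hs ih =>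
    exact .head (R := structuralReduction) (s := ⟨γ, s, a, h.stepOK.src⟩)
      (t := ⟨γ', s', a', hs.ok.src⟩) (h := (LStar.single h).label) h ih

/-- Structural reduction is confluent as a labelled reduction system. -/
theorem structuralReduction_confluent : structuralReduction.Confluent := by
  intro s t₁ t₂ l₁ l₂ h₁ h₂
  have g₁ := LStar.of_star h₁
  have g₂ := LStar.of_star h₂
  have S := StepOK.refl s.typed
  have H : Side s.ctx s.ty s.ctx s.term s.ty (.id s.ctx) s.ty.id :=
    ⟨S.tgt, S.ctx, S.cmild, S.ty, S.mild⟩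
  -- Redex-free reducts of the two terms have the same observation as `s`, hence can be joined.
  obtain ⟨_, _, _, _, _, r₁, n, hn⟩ := Reach.redexFree t₁.typed
  obtain ⟨_, _, _, _, _, r₂, hr⟩ := Reach.redexFree t₂.typed
  have o := (H.obs_star (g₁.trans r₁) 0).symm.trans (H.obs_star (g₂.trans r₂) 0)
  have J := joinHyp n 0 hn hr (H.star (g₁.trans r₁)) (H.star (g₂.trans r₂)) (congrArg (reify _ · 0) o)
  obtain ⟨η₁, k₁, η₂, k₂, γ, u, a, d₁, d₂, e₁, e₂⟩ := J
  rw [(g₁.trans r₁).ok.ctx.comp_id, (g₂.trans r₂).ok.ctx.comp_id,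
    ← g₁.ok.ctx.assoc r₁.ok.ctx d₁.ok.ctx, ← g₂.ok.ctx.assoc r₂.ok.ctx d₂.ok.ctx] at e₁
  rw [(g₁.trans r₁).ok.ty.id_comp, (g₂.trans r₂).ok.ty.id_comp,
    d₁.ok.ty.assoc r₁.ok.ty g₁.ok.ty, d₂.ok.ty.assoc r₂.ok.ty g₂.ok.ty] at e₂
  refine ⟨⟨γ, u, a, d₁.ok.tgt⟩, (r₁.trans d₁).label, (r₂.trans d₂).label, (r₁.trans d₁).star,
    (r₂.trans d₂).star, ?_⟩
  exact Prod.ext (Subtype.ext e₁) (Quiver.Hom.unop_inj (Subtype.ext e₂))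

end ResourceCalculus

theorem mainTheorem1 : ResourceCalculus.structuralReduction.Confluent :=
  ResourceCalculus.structuralReduction_confluent
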